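/- Let $(\mathsf X,\mathcal X)$ be a measurable space and $\nu$ a reference measure on it. Let $M_0$ be a probability measure with density $m_0$ with respect to $\nu$, let $(M_t)_{t\ge1}$ be Markov kernels on $\mathsf X$ such that $M_t(x,\cdot)$ has density $m_t(x,\cdot)$ with respect to $\nu$, and let $(g_t)_{t\ge0}$ be measurable potentials on $\mathsf X$. Assume that there are constants $G_\infty,\sigma_+>0$ such that $0<g_t(x)\le G_\infty$ for all $t\ge 0$, $x\in\mathsf X$, and $0<m_t(x,y)\le\sigma_+$ for all $t\ge1$, $x,y\in\mathsf X$. Put $Q_{t+1}(x,\mathrm dy)=g_t(x)M_{t+1}(x,\mathrm dy)$, $Q_{s+1:t}=Q_{s+1}\cdots Q_t$ (composition of kernels, the identity if $s=t$), $\gamma_0=M_0$, $\gamma_{t+1}=\gamma_tQ_{t+1}$, and, for $h:\mathsf X\to\mathbb R$ bounded and measurable, $$\sigma^2_{\gamma,t}(h)=\sum_{s=0}^t\Big\{\gamma_s(\mathbf 1)\,\gamma_s\big(Q_{s+1:t}[h]^2\big)-\gamma_t(h)^2\Big\}.$$ For every $N\ge1$ let $(\xi_t^i)_{t\ge0,\,1\le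 i\le N}$ and $(A_t^i)_{t\ge0,\,1\le i\le N}$ be the particles and ancestor indices of the bootstrap particle filter with multinomial resampling: $\xi_0^1,\dots,\xi_0^N$ are i.i.d. with law $M_0$ and, conditionally on the $\sigma$-field $\mathcal F_t$ generated by $(\xi_s^i)_{s\le t,\,i}$ and $(A_s^i)_{s<t,\,i}$, the pairs $(A_t^i,\xi_{t+1}^i)$, $1\le i\le N$, are independent, $A_t^i$ takes the value $j$ with probability $W_t^j=g_t(\xi_t^j)/\Omega_t$, where $\Omega_t=\sum_{\ell=1}^N g_t(\xi_t^\ell)$, and $\xi_{t+1}^i\sim M_{t+1}(\xi_t^{A_t^i},\cdot)$. Let $$\gamma_t^N(h)=\Big\{\prod_{s=0}^{t-1}\frac{\Omega_s}{N}\Big\}\frac1N\sum_{i=1}^Nh(\xi_t^i),\qquad \beta_s(k,\ell)=\frac{g_{s-1}(\xi_{s-1}^\ell)\,m_s(\xi_{s-1}^\ell,\xi_s^k)}{\sum_{j=1}^N g_{s-1}(\xi_{s-1}^j)\,m_s(\xi_{s-1}^j,\xi_s^k)}\quad(s\ge1),$$ and, for index paths $k=k_{0:t}$ and $k'=k'_{0:t}$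 in $\{1,\dots,N\}^{t+1}$, $$\Lambda_{1,t}(k)=\frac1N\prod_{s=1}^t\beta_s(k_s,k_{s-1}),\qquad \Lambda_{2,t}(k;k')=\frac1N\prod_{s=1}^t\Big\{\mathbb 1_{k'_s=k_s}W_{s-1}^{k'_{s-1}}+\mathbb 1_{k'_s\ne k_s}\beta_s(k'_s,k'_{s-1})\Big\}.$$ With $h_t(x_{0:t})=h(x_t)$, define for $N\ge2$ $$\hat\gamma^{\mathsf{BS}}_{\mathbf 0,t}(h_t^{\otimes2})=\Big(\frac N{N-1}\Big)^{t+1}\gamma_t^N(\mathbf 1)^2\sum_{k,k'}\Lambda_{1,t}(k)\,\Lambda_{2,t}(k;k')\Big\{\prod_{s=0}^t\mathbb 1_{k_s\ne k'_s}\Big\}h(\xi_t^{k_t})\,h(\xi_t^{k'_t}).$$ Theorem. For every $t\ge0$ and every bounded measurable $h:\mathsf X\to\mathbb R$, $$N\Big(\gamma_t^N(h)^2-\hat\gamma^{\mathsf{BS}}_{\mathbf 0,t}(h_t^{\otimes2})\Big)\longrightarrow\sigma^2_{\gamma,t}(h)\quad\text{in probability as }N\to\infty .$$ -/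

import Mathlib

open MeasureTheory ProbabilityTheory Filter
open scoped BigOperators

noncomputable section

namespace SMC

/-- A Feynman-Kac model on a measurable space `X`, dominated by a reference measure `ν`:
initial law `M₀` with density `m₀`, Markov transition kernels with densities, potentials.
`M t` (with density `m t x y` in `y`) is the transition from time `t` to time `t + 1`,
usually written `M_{t+1}` (resp. `m_{t+1}`). -/
structure FeynmanKac (X : Type*) [MeasurableSpace X] where
  ν : Measure X
  M₀ : Measure X
  m₀ : X → ℝ
  M : ℕ → Kernel X X
  m : ℕ → X → X → ℝ
  g : ℕ → X → ℝ
  isProbabilityMeasure_M₀ : IsProbabilityMeasure M₀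
  isMarkovKernel_M : ∀ t, IsMarkovKernel (M t)
  measurable_m₀ : Measurable m₀
  m₀_nonneg : ∀ x, 0 ≤ m₀ x
  M₀_eq : M₀ = ν.withDensity (fun x => ENNReal.ofReal (m₀ x))
  measurable_m : ∀ t, Measurable (Function.uncurry (m t))
  m_nonneg : ∀ t x y, 0 ≤ m t x y
  M_eq : ∀ t x, M t x = ν.withDensity (fun y => ENNReal.ofReal (m t x y))
  measurable_g : ∀ t, Measurable (g t)
  g_nonneg : ∀ t x, 0 ≤ g t x

attribute [instance] FeynmanKac.isProbabilityMeasure_M₀ FeynmanKac.isMarkovKernel_M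

namespace FeynmanKac

variable {X : Type*} [MeasurableSpace X] (F : FeynmanKac X)

/-- The potentials are positive and uniformly bounded. -/
def PotentialsBounded : Prop :=
  ∃ G : ℝ, 0 < G ∧ ∀ t x, 0 < F.g t x ∧ F.g t x ≤ G

/-- The transition densities are positive everywhere. -/
def DensitiesPositive : Prop := ∀ t x y, 0 < F.m t x y

/-- The transition densities are uniformly bounded. -/
def DensitiesBounded : Prop := ∃ σ : ℝ, 0 < σ ∧ ∀ t x y, F.m t x y ≤ σ

/-- The unnormalized kernel `Q_{t+1}(x, dy) = g_t(x) M_{t+1}(x, dy)`. -/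
def Q (t : ℕ) : Kernel X X :=
  Kernel.withDensity (F.M t) (fun x _ => ENNReal.ofReal (F.g t x))

/-- The marginal on the last coordinate of `Q_{s+1} ⊗ ⋯ ⊗ Q_{s+n}`, that is the composition
`Q_{s+1} ⋯ Q_{s+n}`, from time `s` to time `s + n` (the identity kernel for `n = 0`). -/
def Qmarg (s : ℕ) : ℕ → Kernel X X
  | 0 => Kernel.id
  | n + 1 => (F.Q (s + n)) ∘ₖ (Qmarg s n)

/-- The unnormalized predictive measures: `γ_0 = M_0`, `γ_{t+1} = γ_t Q_{t+1}`. -/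
def γ : ℕ → Measure X
  | 0 => F.M₀
  | t + 1 => (γ t).bind (F.Q t)

/-- `σ²_{γ,t}(h) = ∑_{s=0}^t { γ_s(1) γ_s(Q_{s+1:t}[h]²) - γ_t(h)² }`. -/
def asymptVar (t : ℕ) (h : X → ℝ) : ℝ :=
  ∑ s ∈ Finset.range (t + 1),
    ((F.γ s).real Set.univ * ∫ x, (∫ y, h y ∂(F.Qmarg s (t - s) x)) ^ 2 ∂(F.γ s)
      - (∫ x, h x ∂(F.γ t)) ^ 2)

/-! Quantities computed from a realization `ξ s i` of the particles
(`s` is the time, `i : Fin N` the index of the particle). -/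

variable {N : ℕ}

/-- `Ω_s = ∑ i, g_s(ξ_s^i)`. -/
def totalWeight (ξ : ℕ → Fin N → X) (s : ℕ) : ℝ := ∑ i, F.g s (ξ s i)

/-- The normalized weight `g_s(ξ_s^i) / Ω_s`. -/
def normWeight (ξ : ℕ → Fin N → X) (s : ℕ) (i : Fin N) : ℝ :=
  F.g s (ξ s i) / F.totalWeight ξ s

/-- `γ_t^N(h) = {∏_{s=0}^{t-1} Ω_s / N} N⁻¹ ∑ i, h(ξ_t^i)`. -/
def γN (ξ : ℕ → Fin N → X) (t : ℕ) (h : X → ℝ) : ℝ :=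
  (∏ s ∈ Finset.range t, (N : ℝ)⁻¹ * F.totalWeight ξ s) * ((N : ℝ)⁻¹ * ∑ i, h (ξ t i))

/-- The backward sampling weight `β_{s+1}(k, l)`: `k` is an index at time `s + 1`,
`l` an index at time `s`. -/
def β (ξ : ℕ → Fin N → X) (s : ℕ) (k l : Fin N) : ℝ :=
  F.g s (ξ s l) * F.m s (ξ s l) (ξ (s + 1) k) /
    ∑ j, F.g s (ξ s j) * F.m s (ξ s j) (ξ (s + 1) k)

/-- `Λ_{1,t}(k_{0:t}) = N⁻¹ ∏_{s=1}^t β_s(k_s, k_{s-1})`. -/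
def Λ₁ (ξ : ℕ → Fin N → X) (t : ℕ) (k : Fin (t + 1) → Fin N) : ℝ :=
  (N : ℝ)⁻¹ * ∏ s : Fin t, F.β ξ s (k s.succ) (k s.castSucc)

/-- `Λ_{2,t}(k¹_{0:t}; k²_{0:t})`: as `Λ₁` in `k²`, but the predecessor of `k²_s` is drawn from
the normalized weights at the times `s` at which `k²_s = k¹_s`. -/
def Λ₂ (ξ : ℕ → Fin N → X) (t : ℕ) (k₁ k₂ : Fin (t + 1) → Fin N) : ℝ :=
  (N : ℝ)⁻¹ * ∏ s : Fin t,
    if k₂ s.succ = k₁ s.succ then F.normWeight ξ s (k₂ s.castSucc)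
    else F.β ξ s (k₂ s.succ) (k₂ s.castSucc)

/-- The conditional expectation `E_BS[ f(K¹_{0:t}, K²_{0:t}) | F_t ]`, where given `F_t` the pair
of index paths has the probability mass function `Λ₁(k¹) Λ₂(k¹; k²)`. -/
def expectBS (ξ : ℕ → Fin N → X) (t : ℕ)
    (f : (Fin (t + 1) → Fin N) → (Fin (t + 1) → Fin N) → ℝ) : ℝ :=
  ∑ k₁ : Fin (t + 1) → Fin N, ∑ k₂ : Fin (t + 1) → Fin N,
    F.Λ₁ ξ t k₁ * F.Λ₂ ξ t k₁ k₂ * f k₁ k₂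

/-- The coalescence function `I_{b,t}`: it is `1` if for all `s`, `k¹_s = k²_s` exactly when
`b_s = 1`, and `0` otherwise. -/
def coalescence {t : ℕ} (b : Fin (t + 1) → Fin 2) (k₁ k₂ : Fin (t + 1) → Fin N) : ℝ :=
  ∏ s, if (k₁ s = k₂ s ↔ b s = 1) then 1 else 0

/-- The backward sampling estimator `μ^BS_{b,t}(h)` of a function `h` of two paths. -/
def μBS (ξ : ℕ → Fin N → X) (t : ℕ) (b : Fin (t + 1) → Fin 2)
    (h : (Fin (t + 1) → X) → (Fin (t + 1) → X) → ℝ) : ℝ :=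
  (∏ s, (N : ℝ) ^ (b s : ℕ) * ((N : ℝ) / ((N : ℝ) - 1)) ^ (1 - (b s : ℕ))) *
    F.γN ξ t (fun _ => 1) ^ 2 *
    F.expectBS ξ t (fun k₁ k₂ =>
      coalescence b k₁ k₂ * h (fun s => ξ s (k₁ s)) (fun s => ξ s (k₂ s)))

/-- `V^BS_{γ,t}(h) = N (γ_t^N(h)² - μ^BS_{0,t}(h_t ⊗ h_t))` with `h_t(x_{0:t}) = h(x_t)`. -/
def varEstimator (ξ : ℕ → Fin N → X) (t : ℕ) (h : X → ℝ) : ℝ :=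
  (N : ℝ) * (F.γN ξ t h ^ 2 -
    F.μBS ξ t (fun _ => 0) (fun x x' => h (x (Fin.last t)) * h (x' (Fin.last t))))

end FeynmanKac

/-- The σ-field generated by the particles up to time `t` and the ancestor indices
up to time `t - 1`. -/
@[reducible]
def history {X Ω : Type*} [MeasurableSpace X] {N : ℕ}
    (ξ : ℕ → Fin N → Ω → X) (A : ℕ → Fin N → Ω → Fin N) (t : ℕ) : MeasurableSpace Ω :=
  (⨆ s ≤ t, ⨆ i, MeasurableSpace.comap (ξ s i) inferInstance) ⊔
    (⨆ s < t, ⨆ i, MeasurableSpace.comap (A s i) inferInstance)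

/-- `ξ s i` and `A s i` are the particles and the ancestor indices of the bootstrap particle filter
with `N` particles and multinomial resampling: the particles at time `0` are i.i.d. with law `M₀`;
given the past up to time `t`, the pairs `(A_t^i, ξ_{t+1}^i)` are independent, `A_t^i` takes the
value `a` with probability the normalized weight of `ξ_t^a`, and `ξ_{t+1}^i` has
law `M_{t+1}(ξ_t^a, ·)` given `A_t^i = a`. -/
structure IsBootstrapFilter {X Ω : Type*} [MeasurableSpace X] [MeasurableSpace Ω]
    (F : FeynmanKac X) (P : Measure Ω) {N : ℕ}
    (ξ : ℕ → Fin N → Ω → X) (A : ℕ → Fin N → Ω → Fin N) : Prop where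
  measurable_particle : ∀ t i, Measurable (ξ t i)
  measurable_ancestor : ∀ t i, Measurable (A t i)
  init : P.map (fun ω i => ξ 0 i ω) = Measure.pi (fun _ : Fin N => F.M₀)
  step : ∀ (t : ℕ) (a : Fin N → Fin N) (C : Fin N → Set X), (∀ i, MeasurableSet (C i)) →
    P[Set.indicator {ω | ∀ i, A t i ω = a i ∧ ξ (t + 1) i ω ∈ C i} (fun _ => (1 : ℝ)) |
        history ξ A t]
      =ᵐ[P] fun ω => ∏ i, F.normWeight (fun s j => ξ s j ω) t (a i) *
        (F.M t (ξ t (a i) ω)).real (C i)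

end SMC

end

/-! The coalescence indicator vanishes as soon as the two index paths share an index at some time.
On disjoint paths `Λ₂` agrees with `Λ₁` (`Λ₂_eq_of_forall_ne`), so the estimator is a sum over two
independent backward paths. The last index of a backward path is uniform, so `γ_t^N(h)²` is the same
sum without the indicator (`γN_mul_self_eq_pairSum`). What remains is `N` times the contribution of
the pairs that meet, plus the effect of the factor `(N/(N-1))^(t+1)`. Since `N((N/(N-1))^(t+1) - 1)`
tends to `t + 1`, that factor yields the terms `-γ_t(h)²` (`varEstimator_eq`,
`tendsto_mul_pow_sub_one`).

By a Bonferroni bound the indicator of at least one meeting is the sum over `s` of the indicators of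
a meeting at `s`, up to pairs that meet twice (`abs_one_sub_coalescence_sub_le`). Grouping pairs by
their common index `l` at time `s` turns the meeting at `s` into the mean over `l` of `backSum l ^
2`, where `backSum l` carries the terminal values of `h` back to particle `l` along the backward
chain (`sum_sum_meet`).

The core is that `backSum l` is close in mean square to `normConst s * Q_{s+1:t}[h](ξ_s^l)`
(`tendsto_integral_backErr`). Given the past, the next particles are i.i.d. from a mixture whose
density is, up to `Ω`, the denominator of the backward weight. Averaging over the new position thus
cancels that denominator (`integral_mul_backWeight_mixture`), and lengthening the chain by one step
leaves the conditional mean of `backSum` equal to the previous `backSum` of `Q h`. The added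
variance is controlled by `coal`, the probability that two backward chains from one particle meet.

That probability vanishes after one step: on a set `B` of finite reference measure the bound `σ` on
the density gives order `1/N`, and the complement has small `γ_{s+1}` mass (`integral_coal_one_le`,
`exists_set_of_finite_measure`). Jensen's inequality propagates this to longer lags
(`integral_coal_succ_le`). Every estimate is weighted by `normConst`, whose factor `Ω/N` absorbs the
`1/Ω` of the weights, so no lower bound on the potentials is needed. The laws of large numbers for
`γ_s^N` then identify the limits, and convergence in mean gives convergence in probability. -/

noncomputable section

namespace SMC

/-! ### Second moments of conditionally i.i.d. samples. -/

section CondIID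

variable {X Ω E : Type*} [MeasurableSpace X] [MeasurableSpace Ω] [MeasurableSpace E]

/-- Given `Z`, the variables `Y i` are independent with common law `κ Z`. -/
def CondIID (P : Measure Ω) {N : ℕ} (Z : Ω → E) (Y : Fin N → Ω → X) (κ : Kernel E X) : Prop :=
  ∀ (D : Set E) (C : Fin N → Set X), MeasurableSet D → (∀ i, MeasurableSet (C i)) →
    P.real (Z ⁻¹' D ∩ {ω | ∀ i, Y i ω ∈ C i}) =
      ∫ ω in Z ⁻¹' D, ∏ i, (κ (Z ω)).real (C i) ∂P

lemma integrable_of_abs_le {α : Type*} [MeasurableSpace α] {μ : Measure α} [IsFiniteMeasure μ]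
    {f : α → ℝ} (hf : Measurable f) {C : ℝ} (hC : ∀ x, |f x| ≤ C) : Integrable f μ :=
  Integrable.of_bound hf.aestronglyMeasurable C (ae_of_all _ hC)

variable {P : Measure Ω} [IsProbabilityMeasure P] {N : ℕ} {Z : Ω → E} {Y : Fin N → Ω → X}
  {κ : Kernel E X} [IsMarkovKernel κ]

/-- This reads the right-hand side of `CondIID` as the mass of a rectangle, and rectangles determine
a finite measure. It is used with `κ` for one sample and with `κ ×ₖ κ` for two. -/
lemma measure_prod_eq_compProd {X' : Type*} [MeasurableSpace X'] {κ' : Kernel E X'}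
    [IsMarkovKernel κ'] (hZ : Measurable Z) {D : Set E} (hD : MeasurableSet D) {C : Set X'}
    (hC : MeasurableSet C) :
    ENNReal.ofReal (∫ ω in Z ⁻¹' D, (κ' (Z ω)).real C ∂P) = (P.map Z ⊗ₘ κ') (D ×ˢ C) := by
  rw [Measure.compProd_apply_prod hD hC, setLIntegral_map hD (Kernel.measurable_coe κ' hC) hZ,
    ofReal_integral_eq_lintegral_ofReal]
  · simp
  · refine Integrable.of_bound (C := 1) ?_ (ae_of_all _ fun ω => ?_)
    · exact ((Kernel.measurable_coe κ' hC).ennreal_toReal.comp hZ).aestronglyMeasurable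
    · rw [Real.norm_eq_abs, abs_of_nonneg measureReal_nonneg]
      exact measureReal_le_one
  · exact ae_of_all _ fun ω => measureReal_nonneg

lemma CondIID.map_single (hcond : CondIID P Z Y κ) (hZ : Measurable Z)
    (hY : ∀ i, Measurable (Y i)) (k : Fin N) :
    P.map (fun ω => (Z ω, Y k ω)) = P.map Z ⊗ₘ κ := by
  have := Measure.isProbabilityMeasure_map (μ := P) (hZ.prodMk (hY k)).aemeasurable
  refine Measure.ext_prod fun {D C} hD hC => ?_
  rw [← measure_prod_eq_compProd hZ hD hC, Measure.map_apply (hZ.prodMk (hY k)) (hD.prod hC)]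
  have h1 := hcond D (fun i => if i = k then C else Set.univ) hD
    (fun i => by split_ifs <;> simp [hC])
  have h2 : (fun ω => ∏ i, (κ (Z ω)).real (if i = k then C else Set.univ)) =
      fun ω => (κ (Z ω)).real C := by
    ext ω
    rw [Finset.prod_eq_single k]
    · simp
    · intro b _ hb; simp [hb]
    · simp
  rw [h2] at h1
  rw [← h1, Measure.real, ENNReal.ofReal_toReal (measure_ne_top _ _)]
  congr 1
  ext ω
  simp only [Set.mem_preimage, Set.mem_prod, Set.mem_inter_iff, Set.mem_ofPred_eq]
  refine and_congr_right fun _ => ⟨fun h i => ?_, fun h => ?_⟩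
  · split_ifs with hi
    · subst hi; exact h
    · trivial
  · simpa using h k

lemma CondIID.map_pair (hcond : CondIID P Z Y κ) (hZ : Measurable Z)
    (hY : ∀ i, Measurable (Y i)) {k l : Fin N} (hkl : k ≠ l) :
    P.map (fun ω => (Z ω, Y k ω, Y l ω)) = P.map Z ⊗ₘ (κ ×ₖ κ) := by
  have hm := hZ.prodMk ((hY k).prodMk (hY l))
  have := Measure.isProbabilityMeasure_map (μ := P) hm.aemeasurable
  refine Measure.ext_prod₃ fun {D C C'} hD hC hC' => ?_
  rw [← measure_prod_eq_compProd hZ hD (hC.prod hC'), Measure.map_apply hm (hD.prod (hC.prod hC'))]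
  have h1 := hcond D (fun i => if i = k then C else if i = l then C' else Set.univ) hD
    (fun i => by split_ifs <;> simp [hC, hC'])
  have h2 : (fun ω => ∏ i, (κ (Z ω)).real (if i = k then C else if i = l then C' else Set.univ)) =
      fun ω => ((κ ×ₖ κ) (Z ω)).real (C ×ˢ C') := by
    ext ω
    rw [Finset.prod_eq_mul k l hkl]
    · rw [Kernel.prod_apply, measureReal_prod_prod]
      simp [hkl.symm]
    · rintro b _ ⟨hb, hb'⟩; simp [hb, hb']
    · simp
    · simp
  rw [h2] at h1
  rw [← h1, Measure.real, ENNReal.ofReal_toReal (measure_ne_top _ _)]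
  congr 1
  ext ω
  simp only [Set.mem_preimage, Set.mem_prod, Set.mem_inter_iff, Set.mem_ofPred_eq]
  refine and_congr_right fun _ => ⟨fun h i => ?_, fun h => ⟨?_, ?_⟩⟩
  · split_ifs with hi hi'
    · subst hi; exact h.1
    · subst hi'; exact h.2
    · trivial
  · simpa using h k
  · simpa [hkl.symm] using h l

/-- The expectation of a function of `Z` and one of the `Y k`. -/
lemma CondIID.integral_single (hcond : CondIID P Z Y κ) (hZ : Measurable Z)
    (hY : ∀ i, Measurable (Y i)) (k : Fin N) {φ : E → X → ℝ}
    (hφ : Measurable (Function.uncurry φ)) {C : ℝ} (hC : ∀ z y, |φ z y| ≤ C) :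
    ∫ ω, φ (Z ω) (Y k ω) ∂P = ∫ ω, ∫ y, φ (Z ω) y ∂(κ (Z ω)) ∂P := by
  have hi : Integrable (Function.uncurry φ) (P.map Z ⊗ₘ κ) := by
    have := Measure.isProbabilityMeasure_map (μ := P) hZ.aemeasurable
    exact integrable_of_abs_le hφ fun x => hC x.1 x.2
  calc ∫ ω, φ (Z ω) (Y k ω) ∂P
      = ∫ x, Function.uncurry φ x ∂(P.map (fun ω => (Z ω, Y k ω))) :=
        (integral_map (hZ.prodMk (hY k)).aemeasurable hφ.aestronglyMeasurable).symm
    _ = ∫ z, ∫ y, φ z y ∂(κ z) ∂(P.map Z) := by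
        rw [hcond.map_single hZ hY k, Measure.integral_compProd hi]; rfl
    _ = _ := integral_map hZ.aemeasurable
        (StronglyMeasurable.integral_kernel_prod_right' (κ := κ)
          hφ.stronglyMeasurable).aestronglyMeasurable

/-- The expectation of a product of functions of `Z` and two distinct `Y`s. -/
lemma CondIID.integral_pair (hcond : CondIID P Z Y κ) (hZ : Measurable Z)
    (hY : ∀ i, Measurable (Y i)) {k l : Fin N} (hkl : k ≠ l) {φ : E → X → ℝ}
    (hφ : Measurable (Function.uncurry φ)) {C : ℝ} (hC : ∀ z y, |φ z y| ≤ C) :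
    ∫ ω, φ (Z ω) (Y k ω) * φ (Z ω) (Y l ω) ∂P = ∫ ω, (∫ y, φ (Z ω) y ∂(κ (Z ω))) ^ 2 ∂P := by
  have hm : Measurable fun x : E × X × X => φ x.1 x.2.1 * φ x.1 x.2.2 :=
    (hφ.comp (measurable_fst.prodMk (measurable_fst.comp measurable_snd))).mul
      (hφ.comp (measurable_fst.prodMk (measurable_snd.comp measurable_snd)))
  have hi : Integrable (fun x : E × X × X => φ x.1 x.2.1 * φ x.1 x.2.2)
      (P.map Z ⊗ₘ (κ ×ₖ κ)) := by
    have := Measure.isProbabilityMeasure_map (μ := P) hZ.aemeasurable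
    refine integrable_of_abs_le hm (C := C * C) fun x => ?_
    rw [abs_mul]
    exact mul_le_mul (hC _ _) (hC _ _) (abs_nonneg _) ((abs_nonneg _).trans (hC x.1 x.2.1))
  calc ∫ ω, φ (Z ω) (Y k ω) * φ (Z ω) (Y l ω) ∂P
      = ∫ x, φ x.1 x.2.1 * φ x.1 x.2.2 ∂(P.map (fun ω => (Z ω, Y k ω, Y l ω))) :=
        (integral_map (hZ.prodMk ((hY k).prodMk (hY l))).aemeasurable
          hm.aestronglyMeasurable).symm
    _ = ∫ z, (∫ y, φ z y ∂(κ z)) ^ 2 ∂(P.map Z) := by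
        rw [hcond.map_pair hZ hY hkl, Measure.integral_compProd hi]
        refine integral_congr_ae (ae_of_all _ fun z => ?_)
        simp only [Kernel.prod_apply, sq]
        exact integral_prod_mul (fun y => φ z y) (fun y => φ z y)
    _ = _ := integral_map hZ.aemeasurable
        ((StronglyMeasurable.integral_kernel_prod_right' (κ := κ)
          hφ.stronglyMeasurable).measurable.pow_const 2).aestronglyMeasurable

lemma measurable_integral_kernel {φ : E → X → ℝ} (hφ : Measurable (Function.uncurry φ)) :
    Measurable fun z => ∫ y, φ z y ∂(κ z) :=
  (StronglyMeasurable.integral_kernel_prod_right' (κ := κ) hφ.stronglyMeasurable).measurable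

lemma abs_integral_le_of_abs_le {α : Type*} [MeasurableSpace α] {μ : Measure α}
    [IsProbabilityMeasure μ] {f : α → ℝ} {C : ℝ} (hC : ∀ x, |f x| ≤ C) : |∫ x, f x ∂μ| ≤ C := by
  simpa using norm_integral_le_of_norm_le_const (μ := μ) (f := f) (C := C) (ae_of_all _ hC)

/-- The bias-variance decomposition of a sum of conditionally i.i.d. variables. -/
lemma CondIID.integral_sq_sum_sub_le (hcond : CondIID P Z Y κ) (hZ : Measurable Z)
    (hY : ∀ i, Measurable (Y i)) {φ : E → X → ℝ} (hφ : Measurable (Function.uncurry φ))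
    {C : ℝ} (hC : ∀ z y, |φ z y| ≤ C) {a : E → ℝ} (ha : Measurable a) {C' : ℝ}
    (hC' : ∀ z, |a z| ≤ C') :
    ∫ ω, (∑ k, φ (Z ω) (Y k ω) - a (Z ω)) ^ 2 ∂P ≤
      ∫ ω, (N * ∫ y, φ (Z ω) y ∂(κ (Z ω)) - a (Z ω)) ^ 2 ∂P +
        ∑ k, ∫ ω, φ (Z ω) (Y k ω) ^ 2 ∂P := by
  set m : E → ℝ := fun z => ∫ y, φ z y ∂(κ z) with hm
  have hmm : Measurable m := measurable_integral_kernel hφ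
  have hmb : ∀ z, |m z| ≤ C := fun z => abs_integral_le_of_abs_le (hC z)
  have hbig : ∀ z, |N * m z - a z| ≤ N * C + C' := fun z =>
    (abs_sub _ _).trans (add_le_add (by
      rw [abs_mul, Nat.abs_cast]; exact mul_le_mul_of_nonneg_left (hmb z) (Nat.cast_nonneg _))
      (hC' z))
  have hφk : ∀ k, Measurable fun ω => φ (Z ω) (Y k ω) := fun k => hφ.comp (hZ.prodMk (hY k))
  have hψm : Measurable (Function.uncurry fun z y => φ z y - m z) :=
    hφ.sub (hmm.comp measurable_fst)
  have hψb : ∀ z y, |φ z y - m z| ≤ C + C := fun z y =>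
    (abs_sub _ _).trans (add_le_add (hC z y) (hmb z))
  have hψ0 : ∀ z, ∫ y, (φ z y - m z) ∂(κ z) = 0 := fun z => by
    rw [integral_sub (integrable_of_abs_le hφ.of_uncurry_left (hC z)) (integrable_const _)]
    simp [hm]
  have hψk : ∀ k, Measurable fun ω => φ (Z ω) (Y k ω) - m (Z ω) := fun k =>
    hψm.comp (hZ.prodMk (hY k))
  have hprod : ∀ {f g : Ω → ℝ} {c c' : ℝ}, Measurable f → Measurable g → (∀ ω, |f ω| ≤ c) →
      (∀ ω, |g ω| ≤ c') → Integrable (fun ω => f ω * g ω) P := fun {f g c c'} hf hg hfc hgc =>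
    integrable_of_abs_le (hf.mul hg) (C := c * c') fun ω => by
      rw [abs_mul]
      exact mul_le_mul (hfc ω) (hgc ω) (abs_nonneg _) ((abs_nonneg _).trans (hfc ω))
  -- The sum is centred at the conditional mean `m`. The cross terms `hc1` and the off-diagonal
  -- terms `hc2` integrate to zero, so only the bias and the diagonal survive.
  have hexp : ∀ ω, (∑ k, φ (Z ω) (Y k ω) - a (Z ω)) ^ 2 =
      (N * m (Z ω) - a (Z ω)) ^ 2 +
      2 * ∑ k, (φ (Z ω) (Y k ω) - m (Z ω)) * (N * m (Z ω) - a (Z ω)) +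
      ∑ k, ∑ l, (φ (Z ω) (Y k ω) - m (Z ω)) * (φ (Z ω) (Y l ω) - m (Z ω)) := fun ω => by
    rw [← Finset.sum_mul, ← Finset.sum_mul_sum, Finset.sum_sub_distrib]
    simp only [Finset.sum_const, Finset.card_univ, Fintype.card_fin, nsmul_eq_mul]
    ring
  have hbm : Measurable fun ω => N * m (Z ω) - a (Z ω) :=
    ((hmm.comp hZ).const_mul _).sub (ha.comp hZ)
  have hi1 : Integrable (fun ω => (N * m (Z ω) - a (Z ω)) ^ 2) P := by
    simp only [sq]
    exact hprod hbm hbm (fun ω => hbig _) (fun ω => hbig _)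
  have hi2 : ∀ k, Integrable
      (fun ω => (φ (Z ω) (Y k ω) - m (Z ω)) * (N * m (Z ω) - a (Z ω))) P := fun k =>
    hprod (hψk k) hbm (fun ω => hψb _ _) (fun ω => hbig _)
  have hi3 : ∀ k l, Integrable
      (fun ω => (φ (Z ω) (Y k ω) - m (Z ω)) * (φ (Z ω) (Y l ω) - m (Z ω))) P := fun k l =>
    hprod (hψk k) (hψk l) (fun ω => hψb _ _) (fun ω => hψb _ _)
  have hc1 : ∀ k, ∫ ω, (φ (Z ω) (Y k ω) - m (Z ω)) * (N * m (Z ω) - a (Z ω)) ∂P = 0 := by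
    intro k
    have := hcond.integral_single hZ hY k (φ := fun z y => (φ z y - m z) * (N * m z - a z))
      (hψm.mul (((hmm.const_mul _).sub ha).comp measurable_fst))
      (C := (C + C) * (N * C + C')) (fun z y => by
        rw [abs_mul]
        exact mul_le_mul (hψb z y) (hbig z) (abs_nonneg _) ((abs_nonneg _).trans (hψb z y)))
    rw [this]
    simp only [integral_mul_const, hψ0, zero_mul, integral_zero]
  have hc2 : ∀ k l, k ≠ l →
      ∫ ω, (φ (Z ω) (Y k ω) - m (Z ω)) * (φ (Z ω) (Y l ω) - m (Z ω)) ∂P = 0 := by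
    intro k l hkl
    rw [hcond.integral_pair hZ hY hkl hψm hψb]
    simp only [hψ0]
    simp
  -- Centring at the conditional mean can only lower the second moment; the difference is the
  -- integral of `m ^ 2`.
  have hc3 : ∀ k, ∫ ω, (φ (Z ω) (Y k ω) - m (Z ω)) * (φ (Z ω) (Y k ω) - m (Z ω)) ∂P ≤
      ∫ ω, φ (Z ω) (Y k ω) ^ 2 ∂P := by
    intro k
    have hsm : ∀ ω, φ (Z ω) (Y k ω) ^ 2 =
        (φ (Z ω) (Y k ω) - m (Z ω)) * (φ (Z ω) (Y k ω) - m (Z ω)) +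
          (2 * ((φ (Z ω) (Y k ω) - m (Z ω)) * m (Z ω)) + m (Z ω) * m (Z ω)) :=
      fun ω => by ring
    have hi4 : Integrable (fun ω => (φ (Z ω) (Y k ω) - m (Z ω)) * m (Z ω)) P :=
      hprod (hψk k) (hmm.comp hZ) (fun ω => hψb _ _) (fun ω => hmb _)
    have hi5 : Integrable (fun ω => m (Z ω) * m (Z ω)) P :=
      hprod (hmm.comp hZ) (hmm.comp hZ) (fun ω => hmb _) (fun ω => hmb _)
    have hc4 : ∫ ω, (φ (Z ω) (Y k ω) - m (Z ω)) * m (Z ω) ∂P = 0 := by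
      rw [hcond.integral_single hZ hY k (φ := fun z y => (φ z y - m z) * m z)
        (hψm.mul (hmm.comp measurable_fst))
        (C := (C + C) * C) (fun z y => by
          rw [abs_mul]
          exact mul_le_mul (hψb z y) (hmb z) (abs_nonneg _) ((abs_nonneg _).trans (hψb z y)))]
      simp only [integral_mul_const, hψ0, zero_mul, integral_zero]
    simp only [hsm]
    have hi6 : Integrable (fun ω => 2 * ((φ (Z ω) (Y k ω) - m (Z ω)) * m (Z ω)) +
        m (Z ω) * m (Z ω)) P := (hi4.const_mul 2).add hi5
    rw [integral_add (hi3 k k) hi6,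
      integral_add (hi4.const_mul 2) hi5, integral_const_mul, hc4]
    have : 0 ≤ ∫ ω, m (Z ω) * m (Z ω) ∂P := integral_nonneg fun ω => mul_self_nonneg _
    linarith
  simp only [hexp]
  have hi7 : Integrable (fun ω =>
      2 * ∑ k, (φ (Z ω) (Y k ω) - m (Z ω)) * (N * m (Z ω) - a (Z ω))) P :=
    (integrable_finsetSum _ fun k _ => hi2 k).const_mul 2
  have hi8 : Integrable (fun ω => (N * m (Z ω) - a (Z ω)) ^ 2 +
      2 * ∑ k, (φ (Z ω) (Y k ω) - m (Z ω)) * (N * m (Z ω) - a (Z ω))) P := hi1.add hi7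
  rw [integral_add hi8
      (integrable_finsetSum _ fun k _ => integrable_finsetSum _ fun l _ => hi3 k l),
    integral_add hi1 hi7,
    integral_const_mul, integral_finsetSum _ (fun k _ => hi2 k),
    integral_finsetSum _ (fun k _ => integrable_finsetSum _ fun l _ => hi3 k l)]
  simp only [hc1, Finset.sum_const_zero, mul_zero, add_zero]
  refine add_le_add le_rfl (Finset.sum_le_sum fun k _ => ?_)
  rw [integral_finsetSum _ (fun l _ => hi3 k l), Finset.sum_eq_single k
    (fun l _ hl => hc2 k l hl.symm) (by simp)]
  exact hc3 k

end CondIID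

end SMC

end

/-! ### Backward weights and the conditional law of the next particle. -/

noncomputable section

namespace SMC

namespace FeynmanKac

variable {X : Type*} [MeasurableSpace X] (F : FeynmanKac X) {N : ℕ}

/-- The conditional probability that the ancestor at time `r` of a particle located at `y` at time
`r + 1` is the one with index `j`. -/
def backWeight (z : ℕ → Fin N → X) (r : ℕ) (y : X) (j : Fin N) : ℝ :=
  F.g r (z r j) * F.m r (z r j) y / ∑ i, F.g r (z r i) * F.m r (z r i) y

/-- In `backWeight` the position of the offspring is a free variable, so it can be integrated with
the past frozen. -/
lemma β_eq_backWeight (z : ℕ → Fin N → X) (r : ℕ) (k j : Fin N) :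
    F.β z r k j = F.backWeight z r (z (r + 1) k) j := rfl

lemma measurable_eval (r : ℕ) (j : Fin N) : Measurable fun z : ℕ → Fin N → X => z r j :=
  (measurable_pi_apply j).comp (measurable_pi_apply r)

lemma measurable_totalWeight (r : ℕ) :
    Measurable fun z : ℕ → Fin N → X => F.totalWeight z r :=
  Finset.measurable_sum _ fun i _ => (F.measurable_g r).comp (measurable_eval r i)

lemma measurable_normWeight (r : ℕ) (j : Fin N) :
    Measurable fun z : ℕ → Fin N → X => F.normWeight z r j :=
  ((F.measurable_g r).comp (measurable_eval r j)).div (F.measurable_totalWeight r)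

lemma measurable_backWeight (r : ℕ) (j : Fin N) :
    Measurable (Function.uncurry fun (z : ℕ → Fin N → X) y => F.backWeight z r y j) := by
  have h : ∀ i : Fin N, Measurable fun p : (ℕ → Fin N → X) × X =>
      F.g r (p.1 r i) * F.m r (p.1 r i) p.2 := fun i =>
    ((F.measurable_g r).comp ((measurable_eval r i).comp measurable_fst)).mul
      ((F.measurable_m r).comp (((measurable_eval r i).comp measurable_fst).prodMk measurable_snd))
  exact (h j).div (Finset.measurable_sum _ fun i _ => h i)

lemma totalWeight_nonneg (z : ℕ → Fin N → X) (r : ℕ) : 0 ≤ F.totalWeight z r :=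
  Finset.sum_nonneg fun _ _ => F.g_nonneg r _

lemma normWeight_nonneg (z : ℕ → Fin N → X) (r : ℕ) (j : Fin N) : 0 ≤ F.normWeight z r j :=
  div_nonneg (F.g_nonneg r _) (F.totalWeight_nonneg z r)

lemma backWeight_nonneg (z : ℕ → Fin N → X) (r : ℕ) (y : X) (j : Fin N) :
    0 ≤ F.backWeight z r y j :=
  div_nonneg (mul_nonneg (F.g_nonneg r _) (F.m_nonneg r _ _))
    (Finset.sum_nonneg fun _ _ => mul_nonneg (F.g_nonneg r _) (F.m_nonneg r _ _))

variable {F}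

lemma totalWeight_pos (hg : F.PotentialsBounded) (hN : 0 < N) (z : ℕ → Fin N → X) (r : ℕ) :
    0 < F.totalWeight z r := by
  obtain ⟨G, -, hG⟩ := hg
  have : Nonempty (Fin N) := ⟨⟨0, hN⟩⟩
  exact Finset.sum_pos (fun i _ => (hG r _).1) Finset.univ_nonempty

lemma sum_normWeight (hg : F.PotentialsBounded) (hN : 0 < N) (z : ℕ → Fin N → X) (r : ℕ) :
    ∑ j, F.normWeight z r j = 1 := by
  simp only [normWeight, ← Finset.sum_div]
  exact div_self (totalWeight_pos hg hN z r).ne'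

lemma sum_mul_density_pos (hg : F.PotentialsBounded) (hpos : F.DensitiesPositive) (hN : 0 < N)
    (z : ℕ → Fin N → X) (r : ℕ) (y : X) : 0 < ∑ i, F.g r (z r i) * F.m r (z r i) y := by
  obtain ⟨G, -, hG⟩ := hg
  have : Nonempty (Fin N) := ⟨⟨0, hN⟩⟩
  exact Finset.sum_pos (fun i _ => mul_pos (hG r _).1 (hpos _ _ _)) Finset.univ_nonempty

lemma sum_backWeight (hg : F.PotentialsBounded) (hpos : F.DensitiesPositive) (hN : 0 < N)
    (z : ℕ → Fin N → X) (r : ℕ) (y : X) : ∑ j, F.backWeight z r y j = 1 := by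
  simp only [backWeight, ← Finset.sum_div]
  exact div_self (sum_mul_density_pos hg hpos hN z r y).ne'

variable (F)

lemma backWeight_le_one (z : ℕ → Fin N → X) (r : ℕ) (y : X) (j : Fin N) :
    F.backWeight z r y j ≤ 1 :=
  div_le_one_of_le₀ (Finset.single_le_sum (f := fun i => F.g r (z r i) * F.m r (z r i) y)
      (fun _ _ => mul_nonneg (F.g_nonneg r _) (F.m_nonneg r _ _)) (Finset.mem_univ j))
    (Finset.sum_nonneg fun _ _ => mul_nonneg (F.g_nonneg r _) (F.m_nonneg r _ _))

/-- The conditional law of a particle at time `r + 1` given the particles at time `r`. -/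
def mixture (N : ℕ) (r : ℕ) : Kernel (ℕ → Fin N → X) X where
  toFun z := ∑ j, ENNReal.ofReal (F.normWeight z r j) • F.M r (z r j)
  measurable' := by
    refine Measure.measurable_of_measurable_coe _ fun s hs => ?_
    simp only [Measure.coe_finsetSum, Finset.sum_apply, Measure.smul_apply, smul_eq_mul]
    exact Finset.measurable_sum _ fun j _ => (F.measurable_normWeight r j).ennreal_ofReal.mul
      ((Kernel.measurable_coe _ hs).comp (measurable_eval r j))

lemma mixture_apply (r : ℕ) (z : ℕ → Fin N → X) :
    F.mixture N r z = ∑ j, ENNReal.ofReal (F.normWeight z r j) • F.M r (z r j) := rfl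

lemma mixture_real (r : ℕ) (z : ℕ → Fin N → X) (s : Set X) :
    (F.mixture N r z).real s = ∑ j, F.normWeight z r j * (F.M r (z r j)).real s := by
  rw [Measure.real, mixture_apply]
  simp only [Measure.coe_finsetSum, Finset.sum_apply, Measure.smul_apply, smul_eq_mul]
  rw [ENNReal.toReal_sum fun j _ => ENNReal.mul_ne_top ENNReal.ofReal_ne_top (measure_ne_top _ _)]
  simp [Measure.real, F.normWeight_nonneg]

variable {F}

lemma isMarkovKernel_mixture (hg : F.PotentialsBounded) (hN : 0 < N) (r : ℕ) :
    IsMarkovKernel (F.mixture N r) := by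
  refine ⟨fun z => ⟨?_⟩⟩
  rw [mixture_apply]
  simp only [Measure.coe_finsetSum, Finset.sum_apply, Measure.smul_apply, smul_eq_mul,
    measure_univ, mul_one]
  rw [← ENNReal.ofReal_sum_of_nonneg fun j _ => F.normWeight_nonneg z r j,
    sum_normWeight hg hN z r, ENNReal.ofReal_one]

variable (F)

lemma integral_mixture (r : ℕ) (z : ℕ → Fin N → X) {φ : X → ℝ} (hφ : Measurable φ) {C : ℝ}
    (hC : ∀ x, |φ x| ≤ C) :
    ∫ y, φ y ∂(F.mixture N r z) = ∑ j, F.normWeight z r j * ∫ y, φ y ∂(F.M r (z r j)) := by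
  rw [mixture_apply, integral_finsetSum_measure]
  · simp [integral_smul_measure, F.normWeight_nonneg]
  · intro j _
    exact (integrable_of_abs_le hφ hC).smul_measure ENNReal.ofReal_ne_top

lemma integral_M_eq (r : ℕ) (x : X) (φ : X → ℝ) :
    ∫ y, φ y ∂(F.M r x) = ∫ y, F.m r x y * φ y ∂F.ν := by
  rw [F.M_eq, integral_withDensity_eq_integral_toReal_smul
    (F.measurable_m r).of_uncurry_left.ennreal_ofReal (by simp)]
  simp [F.m_nonneg]

lemma integrable_m_mul (r : ℕ) (x : X) {φ : X → ℝ} (hφ : Measurable φ) {C : ℝ}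
    (hC : ∀ x, |φ x| ≤ C) : Integrable (fun y => F.m r x y * φ y) F.ν := by
  have h : Integrable φ (F.M r x) := integrable_of_abs_le hφ hC
  rw [F.M_eq, integrable_withDensity_iff_integrable_smul'
    (F.measurable_m r).of_uncurry_left.ennreal_ofReal (by simp)] at h
  simpa [F.m_nonneg] using h

variable {F}

/-- Averaging the backward weights over the position of the offspring cancels their
denominator. -/
lemma integral_mul_backWeight_mixture (hg : F.PotentialsBounded) (hpos : F.DensitiesPositive)
    (hN : 0 < N) (r : ℕ) (z : ℕ → Fin N → X) (j : Fin N) {φ : X → ℝ} (hφ : Measurable φ) {C : ℝ}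
    (hC : ∀ x, |φ x| ≤ C) :
    ∫ y, φ y * F.backWeight z r y j ∂(F.mixture N r z) =
      F.normWeight z r j * ∫ y, φ y ∂(F.M r (z r j)) := by
  have hb : Measurable fun y => F.backWeight z r y j := (F.measurable_backWeight r j).of_uncurry_left
  have hb1 : ∀ y, |F.backWeight z r y j| ≤ 1 := fun y => by
    rw [abs_of_nonneg (F.backWeight_nonneg z r y j)]; exact F.backWeight_le_one z r y j
  have hm : Measurable fun y => φ y * F.backWeight z r y j := hφ.mul hb
  have hCm : ∀ y, |φ y * F.backWeight z r y j| ≤ C * 1 := fun y => by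
    rw [abs_mul]
    exact mul_le_mul (hC y) (hb1 y) (abs_nonneg _) ((abs_nonneg _).trans (hC y))
  rw [F.integral_mixture r z hm hCm]
  simp only [F.integral_M_eq, ← integral_const_mul]
  rw [← integral_finsetSum _ fun i _ => (F.integrable_m_mul r _ hm hCm).const_mul _]
  congr 1
  ext y
  have h1 := (sum_mul_density_pos hg hpos hN z r y).ne'
  have h2 := (totalWeight_pos hg hN z r).ne'
  -- The mixture has density `(∑ i, g m) / Ω` with respect to `ν`, and its numerator is exactly the
  -- denominator of the backward weight.
  have h3 : ∑ i, F.normWeight z r i * (F.m r (z r i) y * (φ y * F.backWeight z r y j)) =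
      (∑ i, F.g r (z r i) * F.m r (z r i) y) / F.totalWeight z r *
        (φ y * F.backWeight z r y j) := by
    rw [Finset.sum_div, Finset.sum_mul]
    exact Finset.sum_congr rfl fun i _ => by simp only [normWeight]; ring
  rw [h3]
  simp only [backWeight, normWeight]
  field_simp

end FeynmanKac

/-! ### The particles of the filter as conditionally i.i.d. samples. -/

section Filter

variable {X Ω : Type*} [MeasurableSpace X] [MeasurableSpace Ω] {F : FeynmanKac X} {P : Measure Ω}
  {N : ℕ} {ξ : ℕ → Fin N → Ω → X} {A : ℕ → Fin N → Ω → Fin N}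

/-- The realization of the particles attached to `ω`. -/
def path {X Ω : Type*} {N : ℕ} (ξ : ℕ → Fin N → Ω → X) (ω : Ω) : ℕ → Fin N → X := fun s i => ξ s i ω

/-- The path that follows `z` until time `r` and stays there. -/
def stopAt {X : Type*} {N : ℕ} (r : ℕ) (z : ℕ → Fin N → X) : ℕ → Fin N → X := fun s => z (min s r)

lemma history_le (hF : IsBootstrapFilter F P ξ A) (r : ℕ) : history ξ A r ≤ ‹MeasurableSpace Ω› :=
  sup_le (iSup₂_le fun s _ => iSup_le fun i => (hF.measurable_particle s i).comap_le)
    (iSup₂_le fun s _ => iSup_le fun i => (hF.measurable_ancestor s i).comap_le)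

/-- The stopped path serves as the conditioning variable `Z`: it takes values in one fixed space for
all `r` and uses only coordinates known at time `r`. The ancestor indices can be forgotten, because
the conditional law in `step` depends on the particles alone. -/
lemma measurable_stopAt_history {Ω : Type*} (ξ : ℕ → Fin N → Ω → X) (A : ℕ → Fin N → Ω → Fin N) (r : ℕ) :
    @Measurable _ _ (history ξ A r) _ fun ω => stopAt r (path ξ ω) := by
  refine @measurable_pi_lambda _ _ _ (history ξ A r) _ _ fun s =>
    @measurable_pi_lambda _ _ _ (history ξ A r) _ _ fun i => ?_
  have h1 : MeasurableSpace.comap (ξ (min s r) i) inferInstance ≤ history ξ A r :=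
    le_sup_of_le_left (le_iSup₂_of_le
      (f := fun s (_ : s ≤ r) => ⨆ i, MeasurableSpace.comap (ξ s i) inferInstance)
      (min s r) (min_le_right _ _)
      (le_iSup (fun i => MeasurableSpace.comap (ξ (min s r) i) inferInstance) i))
  exact measurable_iff_comap_le.2 h1

lemma IsBootstrapFilter.measurable_path (hF : IsBootstrapFilter F P ξ A) :
    Measurable (path ξ) :=
  measurable_pi_lambda _ fun s => measurable_pi_lambda _ fun i => hF.measurable_particle s i

lemma IsBootstrapFilter.measurable_stopAt (hF : IsBootstrapFilter F P ξ A) (r : ℕ) :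
    Measurable fun ω => stopAt r (path ξ ω) :=
  (measurable_stopAt_history ξ A r).mono (history_le hF r) le_rfl

lemma normWeight_stopAt (F : FeynmanKac X) (r : ℕ) (z : ℕ → Fin N → X) (j : Fin N) :
    F.normWeight (stopAt r z) r j = F.normWeight z r j := by
  simp [FeynmanKac.normWeight, FeynmanKac.totalWeight, stopAt]

/-- Given the past, the particles at the next time are i.i.d. -/
lemma IsBootstrapFilter.condIID [IsProbabilityMeasure P] (hF : IsBootstrapFilter F P ξ A) (r : ℕ) :
    CondIID P (fun ω => stopAt r (path ξ ω)) (ξ (r + 1)) (F.mixture N r) := by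
  intro D C hD hC
  set Z : Ω → ℕ → Fin N → X := fun ω => stopAt r (path ξ ω)
  have hZD : MeasurableSet[history ξ A r] (Z ⁻¹' D) := measurable_stopAt_history ξ A r hD
  have hZD' : MeasurableSet (Z ⁻¹' D) := history_le hF r _ hZD
  have hS : ∀ a : Fin N → Fin N,
      MeasurableSet {ω | ∀ i, A r i ω = a i ∧ ξ (r + 1) i ω ∈ C i} := fun a => by
    have : {ω | ∀ i, A r i ω = a i ∧ ξ (r + 1) i ω ∈ C i} =
        ⋂ i, (A r i ⁻¹' {a i} ∩ ξ (r + 1) i ⁻¹' C i) := by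
      ext ω; simp
    rw [this]
    exact MeasurableSet.iInter fun i => (hF.measurable_ancestor r i (measurableSet_singleton _)).inter
      (hF.measurable_particle (r + 1) i (hC i))
  -- With the ancestor vector fixed, this is `step` integrated over an event of the history.
  have hcell : ∀ a : Fin N → Fin N,
      P.real (Z ⁻¹' D ∩ {ω | ∀ i, A r i ω = a i ∧ ξ (r + 1) i ω ∈ C i}) =
        ∫ ω in Z ⁻¹' D, ∏ i, F.normWeight (Z ω) r (a i) * (F.M r (Z ω r (a i))).real (C i) ∂P := by
    intro a
    have h1 := setIntegral_condExp (history_le hF r)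
      ((integrable_const (μ := P) (1 : ℝ)).indicator (hS a)) hZD
    rw [setIntegral_indicator (hS a)] at h1
    simp only [integral_const, smul_eq_mul, mul_one, measureReal_restrict_apply MeasurableSet.univ,
      Set.univ_inter] at h1
    rw [← h1]
    refine setIntegral_congr_ae hZD' ?_
    filter_upwards [hF.step r a C hC] with ω hω _
    rw [hω]
    refine Finset.prod_congr rfl fun i _ => ?_
    rw [normWeight_stopAt]
    simp only [Z, stopAt, path, min_self]
    rfl
  have hunion : Z ⁻¹' D ∩ {ω | ∀ i, ξ (r + 1) i ω ∈ C i} =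
      ⋃ a ∈ (Finset.univ : Finset (Fin N → Fin N)),
        (Z ⁻¹' D ∩ {ω | ∀ i, A r i ω = a i ∧ ξ (r + 1) i ω ∈ C i}) := by
    ext ω
    simp only [Set.mem_inter_iff, Set.mem_ofPred_eq, Set.mem_iUnion, Finset.mem_univ,
      exists_const]
    exact ⟨fun h => ⟨fun i => A r i ω, h.1, fun i => ⟨rfl, h.2 i⟩⟩,
      fun ⟨a, h1, h2⟩ => ⟨h1, fun i => (h2 i).2⟩⟩
  rw [hunion, measureReal_biUnion_finset]
  -- Summing the products over all ancestor vectors gives the product over `i` of the mixture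
  -- masses; this is where the ancestors are integrated out.
  · simp only [hcell, FeynmanKac.mixture_real, Fintype.prod_sum]
    rw [integral_finsetSum]
    intro a _
    refine (integrable_of_abs_le (C := 1) ?_ ?_).integrableOn
    · refine Finset.measurable_prod _ fun i _ => ?_
      exact ((F.measurable_normWeight r _).comp (hF.measurable_stopAt r)).mul
        (((Kernel.measurable_coe _ (hC i)).comp ((FeynmanKac.measurable_eval r _).comp
          (hF.measurable_stopAt r))).ennreal_toReal)
    · intro ω
      rw [Finset.abs_prod]
      refine Finset.prod_le_one (fun i _ => abs_nonneg _) fun i _ => ?_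
      rw [abs_of_nonneg (mul_nonneg (F.normWeight_nonneg _ _ _) measureReal_nonneg)]
      refine mul_le_one₀ ?_ measureReal_nonneg measureReal_le_one
      exact div_le_one_of_le₀ (Finset.single_le_sum (f := fun i => F.g r (Z ω r i))
        (fun i _ => F.g_nonneg r _) (Finset.mem_univ _)) (F.totalWeight_nonneg _ _)
  · intro a _ b _ hab
    refine Set.disjoint_left.2 fun ω h1 h2 => hab ?_
    ext i
    rw [← (h1.2 i).1, ← (h2.2 i).1]
  · exact fun a _ => hZD'.inter (hS a)

/-- The particles at time `0` are i.i.d. -/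
lemma IsBootstrapFilter.condIID_init [IsProbabilityMeasure P] (hF : IsBootstrapFilter F P ξ A) :
    CondIID P (fun _ => ()) (ξ 0) (Kernel.const Unit F.M₀) := by
  intro D C hD hC
  have h1 : P.real {ω | ∀ i, ξ 0 i ω ∈ C i} = ∏ i, F.M₀.real (C i) := by
    have h2 : {ω | ∀ i, ξ 0 i ω ∈ C i} =
        (fun ω i => ξ 0 i ω) ⁻¹' (Set.univ.pi C) := by
      ext ω; simp
    rw [h2, ← map_measureReal_apply
      (measurable_pi_lambda _ fun i => hF.measurable_particle 0 i)
      (MeasurableSet.univ_pi hC), hF.init, Measure.real, Measure.pi_pi, ENNReal.toReal_prod]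
    rfl
  by_cases hu : () ∈ D
  · have h3 : (fun _ : Ω => ()) ⁻¹' D = Set.univ := by ext; simp [hu]
    simp [h3, h1]
  · have h3 : (fun _ : Ω => ()) ⁻¹' D = ∅ := by ext; simp [hu]
    simp [h3]

end Filter

end SMC

end

/-! ### The Feynman-Kac semigroup and the mean square error of `γ_t^N`. -/

noncomputable section

namespace SMC

lemma integral_bind_kernel {α β : Type*} [MeasurableSpace α] [MeasurableSpace β] {μ : Measure α}
    [IsFiniteMeasure μ] {η : Kernel α β} [IsFiniteKernel η] {f : β → ℝ} (hf : Measurable f)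
    {C : ℝ} (hC : ∀ x, |f x| ≤ C) : ∫ y, f y ∂(μ.bind η) = ∫ x, ∫ y, f y ∂(η x) ∂μ := by
  have h1 : μ.bind η = (η ∘ₖ Kernel.const Unit μ) () := by
    rw [Kernel.comp_apply, Kernel.const_apply]
  rw [h1, Kernel.integral_comp (integrable_of_abs_le hf hC), Kernel.const_apply]

namespace FeynmanKac

variable {X : Type*} [MeasurableSpace X] (F : FeynmanKac X) {N : ℕ}

/-- The action of the kernel `Q t` on functions. -/
def opQ (t : ℕ) (h : X → ℝ) (x : X) : ℝ := F.g t x * ∫ y, h y ∂(F.M t x)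

/-- The action of `Q s ⋯ Q (s + n - 1)` on functions. -/
def opQs (s : ℕ) : ℕ → (X → ℝ) → X → ℝ
  | 0, h => h
  | n + 1, h => opQs s n (F.opQ (s + n) h)

lemma measurable_opQ (t : ℕ) {h : X → ℝ} (hh : Measurable h) : Measurable (F.opQ t h) :=
  (F.measurable_g t).mul hh.stronglyMeasurable.integral_kernel.measurable

lemma measurable_opQs (s n : ℕ) : ∀ {h : X → ℝ}, Measurable h → Measurable (F.opQs s n h) := by
  induction n with
  | zero => exact fun hh => hh
  | succ n ih => exact fun hh => ih (F.measurable_opQ _ hh)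

lemma Q_apply (t : ℕ) (x : X) : F.Q t x = ENNReal.ofReal (F.g t x) • F.M t x := by
  have h : Measurable (Function.uncurry fun (x _ : X) => ENNReal.ofReal (F.g t x)) :=
    (F.measurable_g t).ennreal_ofReal.comp measurable_fst
  rw [Q, Kernel.withDensity_apply _ h, withDensity_const]

lemma integral_Q (t : ℕ) (h : X → ℝ) (x : X) : ∫ y, h y ∂(F.Q t x) = F.opQ t h x := by
  rw [Q_apply, integral_smul_measure, ENNReal.toReal_ofReal (F.g_nonneg t x), smul_eq_mul, opQ]

variable {F} {G : ℝ}

lemma abs_opQ_le (hG : ∀ t x, 0 < F.g t x ∧ F.g t x ≤ G) (t : ℕ) {h : X → ℝ} {C : ℝ}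
    (hC : ∀ x, |h x| ≤ C) (x : X) : |F.opQ t h x| ≤ G * C := by
  rw [opQ, abs_mul, abs_of_pos (hG t x).1]
  exact mul_le_mul (hG t x).2 (abs_integral_le_of_abs_le hC) (abs_nonneg _)
    ((hG t x).1.le.trans (hG t x).2)

lemma abs_opQs_le (hG : ∀ t x, 0 < F.g t x ∧ F.g t x ≤ G) (s n : ℕ) :
    ∀ {h : X → ℝ} {C : ℝ}, (∀ x, |h x| ≤ C) → ∀ x, |F.opQs s n h x| ≤ G ^ n * C := by
  induction n with
  | zero => intro h C hC x; simpa [opQs] using hC x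
  | succ n ih =>
    intro h C hC x
    rw [pow_succ, mul_assoc]
    exact ih (abs_opQ_le hG _ hC) x

lemma isFiniteKernel_Q (hG : ∀ t x, 0 < F.g t x ∧ F.g t x ≤ G) (t : ℕ) :
    IsFiniteKernel (F.Q t) := by
  refine ⟨⟨ENNReal.ofReal G, ENNReal.ofReal_lt_top, fun x => ?_⟩⟩
  rw [Q_apply, Measure.smul_apply, measure_univ, smul_eq_mul, mul_one]
  exact ENNReal.ofReal_le_ofReal (hG t x).2

lemma isFiniteKernel_Qmarg (hG : ∀ t x, 0 < F.g t x ∧ F.g t x ≤ G) (s n : ℕ) :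
    IsFiniteKernel (F.Qmarg s n) := by
  induction n with
  | zero => rw [Qmarg]; infer_instance
  | succ n ih => have := isFiniteKernel_Q hG (s + n); rw [Qmarg]; infer_instance

/-- This translates the kernels in `asymptVar` into the recursion on functions. The last kernel acts
on `h` first, hence the induction must let `h` and its bound vary. -/
lemma integral_Qmarg (hG : ∀ t x, 0 < F.g t x ∧ F.g t x ≤ G) (s n : ℕ) :
    ∀ {h : X → ℝ} {C : ℝ}, Measurable h → (∀ x, |h x| ≤ C) → ∀ x,
      ∫ y, h y ∂(F.Qmarg s n x) = F.opQs s n h x := by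
  induction n with
  | zero =>
    intro h C hh _ x
    rw [Qmarg, Kernel.id_apply, integral_dirac' _ _ hh.stronglyMeasurable, opQs]
  | succ n ih =>
    intro h C hh hC x
    have := isFiniteKernel_Q hG (s + n)
    have := isFiniteKernel_Qmarg hG s n
    rw [Qmarg, Kernel.integral_comp (integrable_of_abs_le hh hC), opQs]
    simp only [integral_Q]
    exact ih (F.measurable_opQ _ hh) (abs_opQ_le hG _ hC) x

lemma isFiniteMeasure_γ (hG : ∀ t x, 0 < F.g t x ∧ F.g t x ≤ G) (t : ℕ) :
    IsFiniteMeasure (F.γ t) := by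
  induction t with
  | zero => rw [γ]; infer_instance
  | succ t ih =>
    have := isFiniteKernel_Q hG t
    rw [γ]; infer_instance

lemma integral_γ_succ (hG : ∀ t x, 0 < F.g t x ∧ F.g t x ≤ G) (t : ℕ) {h : X → ℝ} {C : ℝ}
    (hh : Measurable h) (hC : ∀ x, |h x| ≤ C) :
    ∫ x, h x ∂(F.γ (t + 1)) = ∫ x, F.opQ t h x ∂(F.γ t) := by
  have := isFiniteKernel_Q hG t
  have := isFiniteMeasure_γ hG t
  rw [γ, integral_bind_kernel hh hC]
  simp only [integral_Q]

variable (F)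

/-- The normalizing constant `∏_{s < t} N⁻¹ Ω_s`. -/
def normConst (z : ℕ → Fin N → X) (t : ℕ) : ℝ := ∏ s ∈ Finset.range t, (N : ℝ)⁻¹ * F.totalWeight z s

lemma γN_eq (z : ℕ → Fin N → X) (t : ℕ) (h : X → ℝ) :
    F.γN z t h = F.normConst z t * ((N : ℝ)⁻¹ * ∑ i, h (z t i)) := rfl

lemma γN_one (hN : 0 < N) (z : ℕ → Fin N → X) (t : ℕ) :
    F.γN z t (fun _ => 1) = F.normConst z t := by
  have : (N : ℝ) ≠ 0 := Nat.cast_ne_zero.2 hN.ne'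
  simp [γN_eq, this]

lemma normConst_succ (z : ℕ → Fin N → X) (t : ℕ) :
    F.normConst z (t + 1) = F.normConst z t * ((N : ℝ)⁻¹ * F.totalWeight z t) :=
  Finset.prod_range_succ _ _

lemma normConst_nonneg (z : ℕ → Fin N → X) (t : ℕ) : 0 ≤ F.normConst z t :=
  Finset.prod_nonneg fun s _ => mul_nonneg (by positivity) (F.totalWeight_nonneg z s)

lemma measurable_normConst (t : ℕ) : Measurable fun z : ℕ → Fin N → X => F.normConst z t :=
  Finset.measurable_prod _ fun s _ => (F.measurable_totalWeight s).const_mul _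

lemma measurable_γN (t : ℕ) {h : X → ℝ} (hh : Measurable h) :
    Measurable fun z : ℕ → Fin N → X => F.γN z t h :=
  (F.measurable_normConst t).mul
    ((Finset.measurable_sum _ fun i _ => hh.comp (measurable_eval t i)).const_mul _)

lemma totalWeight_stopAt {r s : ℕ} (hs : s ≤ r) (z : ℕ → Fin N → X) :
    F.totalWeight (stopAt r z) s = F.totalWeight z s := by
  simp [totalWeight, stopAt, hs]

/-- The product defining `normConst` stops at time `t - 1`, so the constant of time `r + 1` is
already known at time `r`. This allows it to multiply functions of the next particle. -/
lemma normConst_stopAt {r t : ℕ} (ht : t ≤ r + 1) (z : ℕ → Fin N → X) :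
    F.normConst (stopAt r z) t = F.normConst z t :=
  Finset.prod_congr rfl fun s hs => by
    rw [totalWeight_stopAt F (by have := Finset.mem_range.1 hs; omega)]

lemma mixture_stopAt (r : ℕ) (z : ℕ → Fin N → X) :
    F.mixture N r (stopAt r z) = F.mixture N r z := by
  simp only [mixture_apply, normWeight_stopAt]
  simp [stopAt]

variable {F}

lemma inv_mul_totalWeight_le (hG0 : 0 < G) (hG : ∀ t x, 0 < F.g t x ∧ F.g t x ≤ G)
    (z : ℕ → Fin N → X) (t : ℕ) : (N : ℝ)⁻¹ * F.totalWeight z t ≤ G := by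
  rcases Nat.eq_zero_or_pos N with rfl | hN
  · simpa using hG0.le
  · rw [inv_mul_le_iff₀ (by exact_mod_cast hN)]
    calc F.totalWeight z t ≤ ∑ _i : Fin N, G := Finset.sum_le_sum fun i _ => (hG t _).2
      _ = N * G := by simp

lemma normConst_le (hG0 : 0 < G) (hG : ∀ t x, 0 < F.g t x ∧ F.g t x ≤ G)
    (z : ℕ → Fin N → X) (t : ℕ) : F.normConst z t ≤ G ^ t := by
  calc F.normConst z t ≤ ∏ _s ∈ Finset.range t, G :=
        Finset.prod_le_prod (fun s _ => mul_nonneg (by positivity) (F.totalWeight_nonneg z s))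
          fun s _ => inv_mul_totalWeight_le hG0 hG z s
    _ = G ^ t := by simp

lemma abs_mean_le {X : Type*} (x : Fin N → X) {h : X → ℝ} {C : ℝ} (hC0 : 0 ≤ C) (hC : ∀ x, |h x| ≤ C) :
    |(N : ℝ)⁻¹ * ∑ i, h (x i)| ≤ C := by
  rcases Nat.eq_zero_or_pos N with rfl | hN
  · simpa using hC0
  · rw [abs_mul, abs_of_nonneg (by positivity : (0 : ℝ) ≤ (N : ℝ)⁻¹),
      inv_mul_le_iff₀ (by exact_mod_cast hN)]
    calc |∑ i, h (x i)| ≤ ∑ i, |h (x i)| := Finset.abs_sum_le_sum_abs _ _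
      _ ≤ ∑ _i : Fin N, C := Finset.sum_le_sum fun i _ => hC _
      _ = N * C := by simp

lemma abs_γN_le (hG0 : 0 < G) (hG : ∀ t x, 0 < F.g t x ∧ F.g t x ≤ G)
    (z : ℕ → Fin N → X) (t : ℕ) {h : X → ℝ} {C : ℝ} (hC0 : 0 ≤ C) (hC : ∀ x, |h x| ≤ C) :
    |F.γN z t h| ≤ G ^ t * C := by
  rw [γN_eq, abs_mul, abs_of_nonneg (F.normConst_nonneg z t)]
  exact mul_le_mul (normConst_le hG0 hG z t) (abs_mean_le _ hC0 hC) (abs_nonneg _) (by positivity)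

end FeynmanKac

section Filter

variable {X Ω : Type*} [MeasurableSpace X] [MeasurableSpace Ω] {F : FeynmanKac X} {P : Measure Ω}
  [IsProbabilityMeasure P] {N : ℕ} {ξ : ℕ → Fin N → Ω → X} {A : ℕ → Fin N → Ω → Fin N} {G : ℝ}

/-- The expectation of a function of the past and of one particle at the next time. -/
lemma IsBootstrapFilter.integral_single (hF : IsBootstrapFilter F P ξ A)
    (hg : F.PotentialsBounded) (hN : 0 < N) (r : ℕ) (k : Fin N)
    {φ : (ℕ → Fin N → X) → X → ℝ} (hφ : Measurable (Function.uncurry φ)) {C : ℝ}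
    (hC : ∀ z y, |φ z y| ≤ C) (hφs : ∀ z y, φ (stopAt r z) y = φ z y) :
    ∫ ω, φ (path ξ ω) (ξ (r + 1) k ω) ∂P =
      ∫ ω, ∫ y, φ (path ξ ω) y ∂(F.mixture N r (path ξ ω)) ∂P := by
  have := FeynmanKac.isMarkovKernel_mixture (F := F) hg hN r
  have h1 := (hF.condIID r).integral_single (hF.measurable_stopAt r)
    (fun i => hF.measurable_particle (r + 1) i) k hφ hC
  simpa only [hφs, FeynmanKac.mixture_stopAt] using h1

/-- The bias-variance decomposition for a sum over the particles at the next time. -/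
lemma IsBootstrapFilter.integral_sq_sum_sub_le (hF : IsBootstrapFilter F P ξ A)
    (hg : F.PotentialsBounded) (hN : 0 < N) (r : ℕ)
    {φ : (ℕ → Fin N → X) → X → ℝ} (hφ : Measurable (Function.uncurry φ)) {C : ℝ}
    (hC : ∀ z y, |φ z y| ≤ C) (hφs : ∀ z y, φ (stopAt r z) y = φ z y)
    {a : (ℕ → Fin N → X) → ℝ} (ha : Measurable a) {C' : ℝ} (hC' : ∀ z, |a z| ≤ C')
    (has : ∀ z, a (stopAt r z) = a z) :
    ∫ ω, (∑ k, φ (path ξ ω) (ξ (r + 1) k ω) - a (path ξ ω)) ^ 2 ∂P ≤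
      ∫ ω, (N * ∫ y, φ (path ξ ω) y ∂(F.mixture N r (path ξ ω)) - a (path ξ ω)) ^ 2 ∂P +
        ∑ k, ∫ ω, φ (path ξ ω) (ξ (r + 1) k ω) ^ 2 ∂P := by
  have := FeynmanKac.isMarkovKernel_mixture (F := F) hg hN r
  have h1 := (hF.condIID r).integral_sq_sum_sub_le (hF.measurable_stopAt r)
    (fun i => hF.measurable_particle (r + 1) i) hφ hC ha hC'
  simpa only [hφs, has, FeynmanKac.mixture_stopAt] using h1

lemma integral_le_of_forall_le {f : Ω → ℝ} {c : ℝ} (hf : Measurable f) (h0 : ∀ ω, 0 ≤ f ω)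
    (h : ∀ ω, f ω ≤ c) : ∫ ω, f ω ∂P ≤ c := by
  have := integral_mono (μ := P) (integrable_of_abs_le hf (C := c)
    fun ω => by rw [abs_of_nonneg (h0 ω)]; exact h ω) (integrable_const c) h
  simpa using this

/-- The mean square error of `γ_t^N(f)` is of order `N⁻¹`. -/
lemma exists_integral_sq_γN_sub_le (hG0 : 0 < G) (hG : ∀ t x, 0 < F.g t x ∧ F.g t x ≤ G) (t : ℕ) :
    ∀ C : ℝ, 0 ≤ C → ∃ K : ℝ, ∀ f : X → ℝ, Measurable f → (∀ x, |f x| ≤ C) →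
      ∀ {N : ℕ} (ξ : ℕ → Fin N → Ω → X) (A : ℕ → Fin N → Ω → Fin N), 0 < N →
      IsBootstrapFilter F P ξ A →
      ∫ ω, (F.γN (path ξ ω) t f - ∫ x, f x ∂(F.γ t)) ^ 2 ∂P ≤ K * (N : ℝ)⁻¹ := by
  have hg : F.PotentialsBounded := ⟨G, hG0, hG⟩
  induction t with
  | zero =>
    intro C hC0
    refine ⟨C ^ 2, fun f hf hC N ξ A hN hF => ?_⟩
    have hN' : (0 : ℝ) < N := by exact_mod_cast hN
    have hb : ∀ x, |(N : ℝ)⁻¹ * f x| ≤ (N : ℝ)⁻¹ * C := fun x => by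
      rw [abs_mul, abs_of_pos (inv_pos.2 hN')]
      exact mul_le_mul_of_nonneg_left (hC x) (inv_pos.2 hN').le
    have h1 := hF.condIID_init.integral_sq_sum_sub_le measurable_const
      (fun i => hF.measurable_particle 0 i) (φ := fun _ y => (N : ℝ)⁻¹ * f y)
      ((hf.const_mul _).comp measurable_snd) (fun _ => hb)
      (a := fun _ => ∫ x, f x ∂F.M₀) measurable_const (C' := C)
      (fun _ => abs_integral_le_of_abs_le hC)
    have h2 : (N : ℝ) * ∫ y, (N : ℝ)⁻¹ * f y ∂F.M₀ - ∫ x, f x ∂F.M₀ = 0 := by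
      rw [integral_const_mul, mul_inv_cancel_left₀ hN'.ne', sub_self]
    simp only [Kernel.const_apply, h2] at h1
    have h3 : ∀ k, ∫ ω, ((N : ℝ)⁻¹ * f (ξ 0 k ω)) ^ 2 ∂P ≤ ((N : ℝ)⁻¹ * C) ^ 2 := fun k =>
      integral_le_of_forall_le
        (((hf.comp (hF.measurable_particle 0 k)).const_mul _).pow_const 2)
        (fun ω => sq_nonneg _) fun ω => sq_le_sq' (neg_le_of_abs_le (hb _)) (le_of_abs_le (hb _))
    have h4 : ∀ ω, F.γN (path ξ ω) 0 f = ∑ k, (N : ℝ)⁻¹ * f (ξ 0 k ω) := fun ω => by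
      simp [FeynmanKac.γN_eq, FeynmanKac.normConst, Finset.mul_sum, path]
    simp only [h4, FeynmanKac.γ]
    refine h1.trans ?_
    refine (add_le_add le_rfl (Finset.sum_le_sum fun k _ => h3 k)).trans (le_of_eq ?_)
    simp only [Finset.sum_const, Finset.card_univ, Fintype.card_fin, nsmul_eq_mul]
    simp
    field_simp
  | succ t ih =>
    intro C hC0
    obtain ⟨K, hK⟩ := ih (G * C) (by positivity)
    -- The first part is the bias, namely the error at time `t` for `opQ t f`, which is bounded by
    -- `G * C`. The second is the variance: `N` terms of size at most `(G ^ (t + 1) * C / N) ^ 2`.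
    refine ⟨K + (G ^ (t + 1) * C) ^ 2, fun f hf hC N ξ A hN hF => ?_⟩
    have hN' : (0 : ℝ) < N := by exact_mod_cast hN
    have hK' := hK (F.opQ t f) (F.measurable_opQ t hf) (FeynmanKac.abs_opQ_le hG t hC) ξ A hN hF
    have hb : ∀ (z : ℕ → Fin N → X) x,
        |F.normConst z (t + 1) * ((N : ℝ)⁻¹ * f x)| ≤ G ^ (t + 1) * ((N : ℝ)⁻¹ * C) := fun z x => by
      rw [abs_mul, abs_mul, abs_of_pos (inv_pos.2 hN'), abs_of_nonneg (F.normConst_nonneg z _)]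
      have := FeynmanKac.normConst_le hG0 hG z (t + 1)
      have := hC x
      gcongr
    have h1 := hF.integral_sq_sum_sub_le hg hN t
      (φ := fun z y => F.normConst z (t + 1) * ((N : ℝ)⁻¹ * f y))
      (((F.measurable_normConst _).comp measurable_fst).mul
        ((hf.const_mul _).comp measurable_snd)) hb
      (fun z y => by rw [F.normConst_stopAt le_rfl])
      (a := fun _ => ∫ x, f x ∂F.γ (t + 1)) measurable_const (C' := |∫ x, f x ∂F.γ (t + 1)|)
      (fun _ => le_rfl) (fun _ => rfl)
    -- The conditional mean of `γ_{t+1}^N(f)` is `γ_t^N(Q f)`: the factor `Ω_t / N` undoes the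
    -- normalization of the weights.
    have h2 : ∀ z : ℕ → Fin N → X,
        N * ∫ y, F.normConst z (t + 1) * ((N : ℝ)⁻¹ * f y) ∂(F.mixture N t z) =
          F.γN z t (F.opQ t f) := fun z => by
      have h3 := (FeynmanKac.totalWeight_pos hg hN z t).ne'
      rw [integral_const_mul, integral_const_mul, F.integral_mixture t z hf hC, FeynmanKac.γN_eq,
        FeynmanKac.normConst_succ]
      simp only [FeynmanKac.normWeight, FeynmanKac.opQ, Finset.mul_sum]
      refine Finset.sum_congr rfl fun j _ => ?_
      field_simp
    have h3 : ∀ k, ∫ ω, (F.normConst (path ξ ω) (t + 1) * ((N : ℝ)⁻¹ * f (ξ (t + 1) k ω))) ^ 2 ∂P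
        ≤ (G ^ (t + 1) * ((N : ℝ)⁻¹ * C)) ^ 2 := fun k =>
      integral_le_of_forall_le
        ((((F.measurable_normConst (t + 1)).comp hF.measurable_path).mul
          ((hf.comp (hF.measurable_particle (t + 1) k)).const_mul _)).pow_const 2)
        (fun ω => sq_nonneg _)
        fun ω => sq_le_sq' (neg_le_of_abs_le (hb _ _)) (le_of_abs_le (hb _ _))
    have h4 : ∀ ω, F.γN (path ξ ω) (t + 1) f =
        ∑ k, F.normConst (path ξ ω) (t + 1) * ((N : ℝ)⁻¹ * f (ξ (t + 1) k ω)) := fun ω => by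
      simp [FeynmanKac.γN_eq, Finset.mul_sum, path]
    simp only [h2] at h1
    simp only [h4]
    refine h1.trans ?_
    rw [FeynmanKac.integral_γ_succ hG t hf hC]
    refine (add_le_add hK' (Finset.sum_le_sum fun k _ => h3 k)).trans (le_of_eq ?_)
    simp only [Finset.sum_const, Finset.card_univ, Fintype.card_fin, nsmul_eq_mul]
    field_simp

end Filter

end SMC

end

/-! ### The backward index chain and its collision probability. -/

noncomputable section

namespace SMC

namespace FeynmanKac

variable {X : Type*} [MeasurableSpace X] (F : FeynmanKac X) {N : ℕ} {G : ℝ}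

/-- The transition probabilities of the backward index chain from time `s + n` to time `s`. -/
def backMat (z : ℕ → Fin N → X) (s : ℕ) : ℕ → Fin N → Fin N → ℝ
  | 0, k, l => if k = l then 1 else 0
  | n + 1, k, l => ∑ j, F.β z (s + n) k j * backMat z s n j l

lemma β_nonneg (z : ℕ → Fin N → X) (r : ℕ) (k j : Fin N) : 0 ≤ F.β z r k j :=
  F.backWeight_nonneg z r _ j

lemma measurable_β (r : ℕ) (k j : Fin N) : Measurable fun z : ℕ → Fin N → X => F.β z r k j :=
  (F.measurable_backWeight r j).comp (measurable_id.prodMk (measurable_eval (r + 1) k))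

lemma backMat_nonneg (z : ℕ → Fin N → X) (s n : ℕ) (k l : Fin N) : 0 ≤ F.backMat z s n k l := by
  induction n generalizing k with
  | zero => rw [backMat]; split_ifs <;> norm_num
  | succ n ih =>
    rw [backMat]; exact Finset.sum_nonneg fun j _ => mul_nonneg (F.β_nonneg z _ k j) (ih j)

lemma measurable_backMat (s n : ℕ) (k l : Fin N) :
    Measurable fun z : ℕ → Fin N → X => F.backMat z s n k l := by
  induction n generalizing k with
  | zero => simp only [backMat]; exact measurable_const
  | succ n ih =>
    simp only [backMat]
    exact Finset.measurable_sum _ fun j _ => (F.measurable_β _ k j).mul (ih j)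

lemma backWeight_stopAt {r s : ℕ} (hs : s ≤ r) (z : ℕ → Fin N → X) (y : X) (j : Fin N) :
    F.backWeight (stopAt r z) s y j = F.backWeight z s y j := by
  simp [backWeight, stopAt, hs]

lemma backMat_stopAt {r s n : ℕ} (hs : s + n ≤ r) (z : ℕ → Fin N → X) (k l : Fin N) :
    F.backMat (stopAt r z) s n k l = F.backMat z s n k l := by
  induction n generalizing k with
  | zero => rfl
  | succ n ih =>
    rw [backMat, backMat]
    refine Finset.sum_congr rfl fun j _ => ?_
    rw [ih (by omega), β_eq_backWeight, β_eq_backWeight, backWeight_stopAt F (by omega)]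
    simp only [stopAt]
    rw [min_eq_left (by omega)]

/-- The sum over the terminal index of the terminal values of `h`, transported back to time `s`
by the backward chain and multiplied by the normalizing constant. -/
def backSum (z : ℕ → Fin N → X) (s n : ℕ) (h : X → ℝ) (l : Fin N) : ℝ :=
  F.normConst z (s + n) * ∑ k, h (z (s + n) k) * F.backMat z s n k l

lemma measurable_backSum (s n : ℕ) {h : X → ℝ} (hh : Measurable h) (l : Fin N) :
    Measurable fun z : ℕ → Fin N → X => F.backSum z s n h l :=
  (F.measurable_normConst _).mul (Finset.measurable_sum _ fun k _ =>
    (hh.comp (measurable_eval _ k)).mul (F.measurable_backMat s n k l))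

/-- The mean over `k` of the probability that two independent backward chains which
start from `k` at time `s + n` meet at time `s`. -/
def coal (z : ℕ → Fin N → X) (s n : ℕ) : ℝ :=
  (N : ℝ)⁻¹ * ∑ k, ∑ l, F.backMat z s n k l ^ 2

lemma measurable_coal (s n : ℕ) : Measurable fun z : ℕ → Fin N → X => F.coal z s n :=
  (Finset.measurable_sum _ fun k _ => Finset.measurable_sum _ fun l _ =>
    (F.measurable_backMat s n k l).pow_const 2).const_mul _

lemma coal_nonneg (z : ℕ → Fin N → X) (s n : ℕ) : 0 ≤ F.coal z s n :=
  mul_nonneg (by positivity) (Finset.sum_nonneg fun _ _ => Finset.sum_nonneg fun _ _ => sq_nonneg _)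

variable {F}

lemma sum_β (hg : F.PotentialsBounded) (hpos : F.DensitiesPositive) (hN : 0 < N)
    (z : ℕ → Fin N → X) (r : ℕ) (k : Fin N) : ∑ j, F.β z r k j = 1 :=
  sum_backWeight hg hpos hN z r _

lemma sum_backMat (hg : F.PotentialsBounded) (hpos : F.DensitiesPositive) (hN : 0 < N)
    (z : ℕ → Fin N → X) (s n : ℕ) (k : Fin N) : ∑ l, F.backMat z s n k l = 1 := by
  induction n generalizing k with
  | zero => simp [backMat]
  | succ n ih =>
    simp only [backMat]
    rw [Finset.sum_comm]
    simp only [← Finset.mul_sum, ih, mul_one]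
    exact sum_β hg hpos hN z _ k

lemma backMat_le_one (hg : F.PotentialsBounded) (hpos : F.DensitiesPositive) (hN : 0 < N)
    (z : ℕ → Fin N → X) (s n : ℕ) (k l : Fin N) : F.backMat z s n k l ≤ 1 := by
  rw [← sum_backMat hg hpos hN z s n k]
  exact Finset.single_le_sum (f := fun l => F.backMat z s n k l)
    (fun l _ => F.backMat_nonneg z s n k l) (Finset.mem_univ l)

lemma sum_backMat_sq_le_one (hg : F.PotentialsBounded) (hpos : F.DensitiesPositive) (hN : 0 < N)
    (z : ℕ → Fin N → X) (s n : ℕ) (k : Fin N) : ∑ l, F.backMat z s n k l ^ 2 ≤ 1 := by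
  rw [← sum_backMat hg hpos hN z s n k]
  refine Finset.sum_le_sum fun l _ => ?_
  exact pow_le_of_le_one (F.backMat_nonneg z s n k l) (backMat_le_one hg hpos hN z s n k l)
    two_ne_zero

lemma coal_le_one (hg : F.PotentialsBounded) (hpos : F.DensitiesPositive) (hN : 0 < N)
    (z : ℕ → Fin N → X) (s n : ℕ) : F.coal z s n ≤ 1 := by
  rw [coal, inv_mul_le_iff₀ (by exact_mod_cast hN)]
  calc ∑ k, ∑ l, F.backMat z s n k l ^ 2 ≤ ∑ _k : Fin N, (1 : ℝ) :=
        Finset.sum_le_sum fun k _ => sum_backMat_sq_le_one hg hpos hN z s n k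
    _ = N * 1 := by simp

lemma abs_backSum_le (hG0 : 0 < G) (hG : ∀ t x, 0 < F.g t x ∧ F.g t x ≤ G)
    (hpos : F.DensitiesPositive) (hN : 0 < N) (z : ℕ → Fin N → X) (s n : ℕ) {h : X → ℝ} {C : ℝ}
    (hC : ∀ x, |h x| ≤ C) (l : Fin N) : |F.backSum z s n h l| ≤ G ^ (s + n) * (N * C) := by
  rw [backSum, abs_mul, abs_of_nonneg (F.normConst_nonneg z _)]
  refine mul_le_mul (normConst_le hG0 hG z _) ?_ (abs_nonneg _) (by positivity)
  calc |∑ k, h (z (s + n) k) * F.backMat z s n k l|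
      ≤ ∑ k, |h (z (s + n) k) * F.backMat z s n k l| := Finset.abs_sum_le_sum_abs _ _
    _ ≤ ∑ _k : Fin N, C := Finset.sum_le_sum fun k _ => by
        rw [abs_mul, abs_of_nonneg (F.backMat_nonneg z s n k l)]
        exact (mul_le_of_le_one_right (abs_nonneg _)
          (backMat_le_one ⟨G, hG0, hG⟩ hpos hN z s n k l)).trans (hC _)
    _ = N * C := by simp

lemma normConst_mul_coal_le (hG0 : 0 < G) (hG : ∀ t x, 0 < F.g t x ∧ F.g t x ≤ G)
    (hpos : F.DensitiesPositive) (hN : 0 < N) (z : ℕ → Fin N → X) (t s n : ℕ) :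
    F.normConst z t * F.coal z s n ≤ G ^ t := by
  have h1 := normConst_le hG0 hG z t
  have h2 := coal_le_one ⟨G, hG0, hG⟩ hpos hN z s n
  have h3 := F.coal_nonneg z s n
  calc F.normConst z t * F.coal z s n ≤ G ^ t * 1 := by gcongr
    _ = G ^ t := mul_one _

/-- Averaging over the mixture removes one of the two backward weights and leaves a mean of the
other under `M r (z r l)`. On `B` the density is at most `σ`, the normalized weights are at most `G
/ Ω`, and the backward weights sum to one over `l`, which leaves `ν(B)`. Off `B` the backward weight
is bounded by one. -/
lemma sum_sq_backWeight_integral_le (hG0 : 0 < G) (hG : ∀ t x, 0 < F.g t x ∧ F.g t x ≤ G)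
    (hpos : F.DensitiesPositive) {σ : ℝ} (hσ0 : 0 < σ) (hσ : ∀ t x y, F.m t x y ≤ σ) (hN : 0 < N)
    (r : ℕ) (z : ℕ → Fin N → X) {B : Set X} (hB : MeasurableSet B) (hνB : F.ν B ≠ ⊤) :
    ∑ l, ∫ y, F.backWeight z r y l * F.backWeight z r y l ∂(F.mixture N r z) ≤
      G / F.totalWeight z r * (σ * F.ν.real B) +
        ∑ l, F.normWeight z r l * ∫ y, Bᶜ.indicator (fun _ => (1 : ℝ)) y ∂(F.M r (z r l)) := by
  have hg : F.PotentialsBounded := ⟨G, hG0, hG⟩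
  have hbm : ∀ l, Measurable fun y => F.backWeight z r y l := fun l =>
    (F.measurable_backWeight r l).of_uncurry_left
  have hb0 : ∀ y l, 0 ≤ F.backWeight z r y l := fun y l => F.backWeight_nonneg z r y l
  have hb1 : ∀ y l, F.backWeight z r y l ≤ 1 := fun y l => F.backWeight_le_one z r y l
  have hba : ∀ l y, |F.backWeight z r y l| ≤ 1 := fun l y => by
    rw [abs_of_nonneg (hb0 y l)]; exact hb1 y l
  have hΩ := totalWeight_pos hg hN z r
  have hfin : IsFiniteMeasure (F.ν.restrict B) := ⟨by simpa using hνB.lt_top⟩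
  have hiB : ∀ l, IntegrableOn (fun y => F.backWeight z r y l) B F.ν := fun l =>
    integrable_of_abs_le (hbm l) (hba l)
  have hone : ∀ l, ∫ y, F.backWeight z r y l ∂(F.M r (z r l)) ≤
      σ * ∫ y in B, F.backWeight z r y l ∂F.ν +
        ∫ y, Bᶜ.indicator (fun _ => (1 : ℝ)) y ∂(F.M r (z r l)) := by
    intro l
    have hBi : ∀ y, |B.indicator (fun y => F.backWeight z r y l) y| ≤ 1 := fun y => by
      by_cases hy : y ∈ B <;> simp [hy, hba l y]
    have hBi' : ∀ y, |Bᶜ.indicator (fun _ => (1 : ℝ)) y| ≤ 1 := fun y => by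
      by_cases hy : y ∈ B <;> simp [hy]
    have hi1 : Integrable (B.indicator fun y => F.backWeight z r y l) (F.M r (z r l)) :=
      integrable_of_abs_le ((hbm l).indicator hB) hBi
    have hi2 : Integrable (Bᶜ.indicator fun _ => (1 : ℝ)) (F.M r (z r l)) :=
      integrable_of_abs_le (measurable_const.indicator hB.compl) hBi'
    calc ∫ y, F.backWeight z r y l ∂(F.M r (z r l))
        ≤ ∫ y, (B.indicator (fun y => F.backWeight z r y l) y +
            Bᶜ.indicator (fun _ => (1 : ℝ)) y) ∂(F.M r (z r l)) := by
          refine integral_mono (integrable_of_abs_le (hbm l) (hba l)) (hi1.add hi2) fun y => ?_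
          by_cases hy : y ∈ B <;> simp [hy, hb1 y l]
      _ = ∫ y, B.indicator (fun y => F.backWeight z r y l) y ∂(F.M r (z r l)) +
            ∫ y, Bᶜ.indicator (fun _ => (1 : ℝ)) y ∂(F.M r (z r l)) := integral_add hi1 hi2
      _ ≤ _ := by
          refine add_le_add ?_ le_rfl
          rw [F.integral_M_eq, ← integral_indicator hB, ← integral_const_mul]
          refine integral_mono (F.integrable_m_mul r _ ((hbm l).indicator hB) hBi)
            (((integrable_indicator_iff hB).2 (hiB l)).const_mul _) fun y => ?_
          exact mul_le_mul_of_nonneg_right (hσ r _ _) (Set.indicator_nonneg (fun y _ => hb0 y l) y)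
  calc ∑ l, ∫ y, F.backWeight z r y l * F.backWeight z r y l ∂(F.mixture N r z)
      = ∑ l, F.normWeight z r l * ∫ y, F.backWeight z r y l ∂(F.M r (z r l)) :=
        Finset.sum_congr rfl fun l _ =>
          integral_mul_backWeight_mixture hg hpos hN r z l (hbm l) (hba l)
    _ ≤ ∑ l, (G / F.totalWeight z r * (σ * ∫ y in B, F.backWeight z r y l ∂F.ν) +
          F.normWeight z r l * ∫ y, Bᶜ.indicator (fun _ => (1 : ℝ)) y ∂(F.M r (z r l))) := by
        refine Finset.sum_le_sum fun l _ => ?_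
        refine (mul_le_mul_of_nonneg_left (hone l) (F.normWeight_nonneg z r l)).trans ?_
        rw [mul_add]
        refine add_le_add (mul_le_mul_of_nonneg_right ?_ ?_) le_rfl
        · exact div_le_div_of_nonneg_right (hG r _).2 hΩ.le
        · exact mul_nonneg hσ0.le (integral_nonneg fun y => hb0 y l)
    _ = _ := by
        rw [Finset.sum_add_distrib, ← Finset.mul_sum, ← Finset.mul_sum,
          ← integral_finsetSum _ fun l _ => hiB l]
        simp [sum_backWeight hg hpos hN z r]

end FeynmanKac

section Filter

variable {X Ω : Type*} [MeasurableSpace X] [MeasurableSpace Ω] {F : FeynmanKac X} {P : Measure Ω}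
  [IsProbabilityMeasure P] {G : ℝ}

/-- The factor `Ω_s / N` contained in `normConst (s + 1)` turns the `1 / Ω_s` of the preceding bound
into `1 / N`. The same factor turns the part off `B` into an unnormalized particle average, to which
the law of large numbers applies. -/
lemma integral_coal_one_le {N : ℕ} {ξ : ℕ → Fin N → Ω → X} {A : ℕ → Fin N → Ω → Fin N}
    (hG0 : 0 < G) (hG : ∀ t x, 0 < F.g t x ∧ F.g t x ≤ G)
    (hpos : F.DensitiesPositive) {σ : ℝ} (hσ0 : 0 < σ) (hσ : ∀ t x y, F.m t x y ≤ σ) (hN : 0 < N)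
    (hF : IsBootstrapFilter F P ξ A) (s : ℕ) {B : Set X} (hB : MeasurableSet B)
    (hνB : F.ν B ≠ ⊤) :
    ∫ ω, F.normConst (path ξ ω) (s + 1) * F.coal (path ξ ω) s 1 ∂P ≤
      G ^ (s + 1) * (σ * F.ν.real B) * (N : ℝ)⁻¹ +
        ∫ ω, F.γN (path ξ ω) s (F.opQ s (Bᶜ.indicator fun _ => (1 : ℝ))) ∂P := by
  have hg : F.PotentialsBounded := ⟨G, hG0, hG⟩
  have hN' : (0 : ℝ) < N := by exact_mod_cast hN
  have hb2 : ∀ (z : ℕ → Fin N → X) y l,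
      |F.backWeight z s y l * F.backWeight z s y l| ≤ 1 := fun z y l => by
    have h0 := F.backWeight_nonneg z s y l
    have h1 := F.backWeight_le_one z s y l
    rw [abs_of_nonneg (mul_nonneg h0 h0)]
    exact mul_le_one₀ h1 h0 h1
  have hind : ∀ y, |Bᶜ.indicator (fun _ => (1 : ℝ)) y| ≤ 1 := fun y => by
    by_cases hy : y ∈ B <;> simp [hy]
  set φ : (ℕ → Fin N → X) → X → ℝ := fun z y =>
    F.normConst z (s + 1) * ∑ l, F.backWeight z s y l * F.backWeight z s y l with hφ
  have hφm : Measurable (Function.uncurry φ) :=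
    ((F.measurable_normConst _).comp measurable_fst).mul (Finset.measurable_sum _ fun l _ =>
      (F.measurable_backWeight s l).mul (F.measurable_backWeight s l))
  have hφb : ∀ z y, |φ z y| ≤ G ^ (s + 1) * N := fun z y => by
    rw [hφ, abs_mul, abs_of_nonneg (F.normConst_nonneg z _)]
    refine mul_le_mul (FeynmanKac.normConst_le hG0 hG z _) ?_ (abs_nonneg _) (by positivity)
    calc |∑ l, F.backWeight z s y l * F.backWeight z s y l| ≤ ∑ _l : Fin N, (1 : ℝ) :=
          (Finset.abs_sum_le_sum_abs _ _).trans (Finset.sum_le_sum fun l _ => hb2 z y l)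
      _ = N := by simp
  have hsum : ∀ ω, F.normConst (path ξ ω) (s + 1) * F.coal (path ξ ω) s 1 =
      (N : ℝ)⁻¹ * ∑ k, φ (path ξ ω) (ξ (s + 1) k ω) := fun ω => by
    simp only [FeynmanKac.coal, FeynmanKac.backMat, FeynmanKac.β_eq_backWeight, hφ,
      ← Finset.mul_sum, add_zero, mul_ite, mul_one, mul_zero, Finset.sum_ite_eq',
      Finset.mem_univ, if_true, sq]
    rw [mul_left_comm]
    rfl
  have hmix : ∀ z : ℕ → Fin N → X, ∫ y, φ z y ∂(F.mixture N s z) ≤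
      G ^ (s + 1) * (σ * F.ν.real B) * (N : ℝ)⁻¹ +
        F.γN z s (F.opQ s (Bᶜ.indicator fun _ => (1 : ℝ))) := fun z => by
    have := FeynmanKac.isMarkovKernel_mixture (F := F) hg hN s
    have hΩ := FeynmanKac.totalWeight_pos hg hN z s
    have hbi : ∀ l, Integrable (fun y => F.backWeight z s y l * F.backWeight z s y l)
        (F.mixture N s z) := fun l => integrable_of_abs_le
      ((F.measurable_backWeight s l).of_uncurry_left.mul
        (F.measurable_backWeight s l).of_uncurry_left) fun y => hb2 z y l
    rw [hφ, integral_const_mul, integral_finsetSum _ fun l _ => hbi l]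
    refine (mul_le_mul_of_nonneg_left (FeynmanKac.sum_sq_backWeight_integral_le hG0 hG hpos hσ0 hσ
      hN s z hB hνB) (F.normConst_nonneg z _)).trans ?_
    rw [mul_add]
    refine add_le_add ?_ (le_of_eq ?_)
    · have h1 : F.normConst z (s + 1) * (G / F.totalWeight z s * (σ * F.ν.real B)) =
          F.normConst z s * (G * (σ * F.ν.real B) * (N : ℝ)⁻¹) := by
        rw [FeynmanKac.normConst_succ]
        field_simp
      rw [h1]
      refine (mul_le_mul_of_nonneg_right (FeynmanKac.normConst_le hG0 hG z s)
        (by positivity)).trans (le_of_eq ?_)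
      ring
    · rw [FeynmanKac.γN_eq, FeynmanKac.normConst_succ]
      simp only [FeynmanKac.normWeight, FeynmanKac.opQ, Finset.mul_sum]
      refine Finset.sum_congr rfl fun l _ => ?_
      field_simp
  have hγi : Integrable (fun ω =>
      F.γN (path ξ ω) s (F.opQ s (Bᶜ.indicator fun _ => (1 : ℝ)))) P := by
    refine integrable_of_abs_le ((F.measurable_γN s (F.measurable_opQ s
      (measurable_const.indicator hB.compl))).comp hF.measurable_path) fun ω =>
      FeynmanKac.abs_γN_le hG0 hG _ s (by positivity : 0 ≤ G * 1) (FeynmanKac.abs_opQ_le hG s hind)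
  have hmi : Integrable (fun ω => ∫ y, φ (path ξ ω) y ∂(F.mixture N s (path ξ ω))) P := by
    have := FeynmanKac.isMarkovKernel_mixture (F := F) hg hN s
    exact integrable_of_abs_le ((measurable_integral_kernel hφm).comp hF.measurable_path)
      fun ω => abs_integral_le_of_abs_le (hφb _)
  have hk : ∀ k, ∫ ω, φ (path ξ ω) (ξ (s + 1) k ω) ∂P ≤
      G ^ (s + 1) * (σ * F.ν.real B) * (N : ℝ)⁻¹ +
        ∫ ω, F.γN (path ξ ω) s (F.opQ s (Bᶜ.indicator fun _ => (1 : ℝ))) ∂P := fun k => by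
    rw [hF.integral_single hg hN s k hφm hφb fun z y => by
      simp only [hφ, F.normConst_stopAt le_rfl, F.backWeight_stopAt le_rfl]]
    have hci : Integrable (fun ω => G ^ (s + 1) * (σ * F.ν.real B) * (N : ℝ)⁻¹ +
        F.γN (path ξ ω) s (F.opQ s (Bᶜ.indicator fun _ => (1 : ℝ)))) P :=
      (integrable_const _).add hγi
    have h1 := integral_mono hmi hci fun ω => hmix (path ξ ω)
    rw [integral_add (integrable_const _) hγi] at h1
    simpa using h1
  clear_value φ
  have hφi : ∀ k, Integrable (fun ω => φ (path ξ ω) (ξ (s + 1) k ω)) P := fun k =>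
    integrable_of_abs_le
      (hφm.comp (hF.measurable_path.prodMk (hF.measurable_particle (s + 1) k))) fun ω => hφb _ _
  simp only [hsum]
  rw [integral_const_mul, integral_finsetSum _ fun k _ => hφi k, inv_mul_le_iff₀ hN']
  have h2 := Finset.sum_le_sum fun k (_ : k ∈ Finset.univ) => hk k
  rw [Finset.sum_const, Finset.card_univ, Fintype.card_fin, nsmul_eq_mul] at h2
  exact h2

/-- By Jensen's inequality, the collision probability from `k` is at most the average, under the
first backward step, of the collision probabilities from the predecessors. Averaging over the
offspring replaces the backward weight by a normalized weight, at most `G / Ω`, and `Ω / N` cancels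
against the normalizing constant. -/
lemma integral_coal_succ_le {N : ℕ} {ξ : ℕ → Fin N → Ω → X} {A : ℕ → Fin N → Ω → Fin N}
    (hG0 : 0 < G) (hG : ∀ t x, 0 < F.g t x ∧ F.g t x ≤ G)
    (hpos : F.DensitiesPositive) (hN : 0 < N) (hF : IsBootstrapFilter F P ξ A) (s n : ℕ) :
    ∫ ω, F.normConst (path ξ ω) (s + (n + 1)) * F.coal (path ξ ω) s (n + 1) ∂P ≤
      G * ∫ ω, F.normConst (path ξ ω) (s + n) * F.coal (path ξ ω) s n ∂P := by
  have hg : F.PotentialsBounded := ⟨G, hG0, hG⟩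
  have hN' : (0 : ℝ) < N := by exact_mod_cast hN
  set φ : (ℕ → Fin N → X) → X → ℝ := fun z y =>
    F.normConst z (s + n + 1) * ∑ j, (∑ l, F.backMat z s n j l ^ 2) * F.backWeight z (s + n) y j with hφ
  have hTm : ∀ j, Measurable fun z : ℕ → Fin N → X => ∑ l, F.backMat z s n j l ^ 2 := fun j =>
    Finset.measurable_sum _ fun l _ => (F.measurable_backMat s n j l).pow_const 2
  have hT0 : ∀ (z : ℕ → Fin N → X) j, 0 ≤ ∑ l, F.backMat z s n j l ^ 2 := fun z j =>
    Finset.sum_nonneg fun _ _ => sq_nonneg _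
  have hT1 : ∀ (z : ℕ → Fin N → X) j, ∑ l, F.backMat z s n j l ^ 2 ≤ 1 := fun z j =>
    FeynmanKac.sum_backMat_sq_le_one hg hpos hN z s n j
  have hφm : Measurable (Function.uncurry φ) :=
    ((F.measurable_normConst _).comp measurable_fst).mul (Finset.measurable_sum _ fun j _ =>
      ((hTm j).comp measurable_fst).mul (F.measurable_backWeight (s + n) j))
  have hφ0 : ∀ z y, 0 ≤ φ z y := fun z y => mul_nonneg (F.normConst_nonneg z _)
    (Finset.sum_nonneg fun j _ => mul_nonneg (hT0 z j) (F.backWeight_nonneg z (s + n) y j))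
  have hφb : ∀ z y, |φ z y| ≤ G ^ (s + n + 1) * 1 := fun z y => by
    rw [abs_of_nonneg (hφ0 z y)]
    refine mul_le_mul (FeynmanKac.normConst_le hG0 hG z _) ?_ (Finset.sum_nonneg fun j _ =>
      mul_nonneg (hT0 z j) (F.backWeight_nonneg z (s + n) y j)) (by positivity)
    rw [← FeynmanKac.sum_backWeight hg hpos hN z (s + n) y]
    exact Finset.sum_le_sum fun j _ =>
      mul_le_of_le_one_left (F.backWeight_nonneg z (s + n) y j) (hT1 z j)
  have hsum : ∀ ω, F.normConst (path ξ ω) (s + n + 1) * F.coal (path ξ ω) s (n + 1) ≤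
      (N : ℝ)⁻¹ * ∑ k, φ (path ξ ω) (ξ (s + n + 1) k ω) := fun ω => by
    simp only [hφ, FeynmanKac.coal, FeynmanKac.backMat, ← Finset.mul_sum]
    rw [mul_left_comm]
    refine mul_le_mul_of_nonneg_left (mul_le_mul_of_nonneg_left
      (Finset.sum_le_sum fun k _ => ?_) (F.normConst_nonneg _ _)) (by positivity)
    calc ∑ l, (∑ j, F.β (path ξ ω) (s + n) k j * F.backMat (path ξ ω) s n j l) ^ 2
        ≤ ∑ l, ∑ j, F.β (path ξ ω) (s + n) k j * F.backMat (path ξ ω) s n j l ^ 2 :=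
          Finset.sum_le_sum fun l _ => Real.pow_arith_mean_le_arith_mean_pow_of_even _ _ _
            (fun j _ => F.β_nonneg _ _ _ _) (FeynmanKac.sum_β hg hpos hN _ _ k) even_two
      _ = ∑ j, (∑ l, F.backMat (path ξ ω) s n j l ^ 2) *
            F.backWeight (path ξ ω) (s + n) (ξ (s + n + 1) k ω) j := by
          rw [Finset.sum_comm]
          refine Finset.sum_congr rfl fun j _ => ?_
          rw [← Finset.mul_sum, mul_comm]
          rfl
  have hmix : ∀ z : ℕ → Fin N → X, ∫ y, φ z y ∂(F.mixture N (s + n) z) ≤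
      G * (F.normConst z (s + n) * F.coal z s n) := fun z => by
    have := FeynmanKac.isMarkovKernel_mixture (F := F) hg hN (s + n)
    have hΩ := FeynmanKac.totalWeight_pos hg hN z (s + n)
    have hbi : ∀ j, Integrable (fun y => (∑ l, F.backMat z s n j l ^ 2) * F.backWeight z (s + n) y j)
        (F.mixture N (s + n) z) := fun j =>
      (integrable_of_abs_le (F.measurable_backWeight (s + n) j).of_uncurry_left (C := 1) fun y => by
        rw [abs_of_nonneg (F.backWeight_nonneg z (s + n) y j)]
        exact F.backWeight_le_one z (s + n) y j).const_mul _
    rw [hφ, integral_const_mul, integral_finsetSum _ fun j _ => hbi j]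
    have h1 : ∀ j, ∫ y, (∑ l, F.backMat z s n j l ^ 2) * F.backWeight z (s + n) y j ∂(F.mixture N (s + n) z) =
        F.normWeight z (s + n) j * ∑ l, F.backMat z s n j l ^ 2 := fun j => by
      rw [FeynmanKac.integral_mul_backWeight_mixture hg hpos hN (s + n) z j
        (φ := fun _ => ∑ l, F.backMat z s n j l ^ 2) measurable_const
        (fun _ => (abs_of_nonneg (hT0 z j)).le)]
      simp
    simp only [h1]
    have h2 : ∑ j, F.normWeight z (s + n) j * ∑ l, F.backMat z s n j l ^ 2 ≤
        G / F.totalWeight z (s + n) * ∑ j, ∑ l, F.backMat z s n j l ^ 2 := by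
      rw [Finset.mul_sum]
      exact Finset.sum_le_sum fun j _ => mul_le_mul_of_nonneg_right
        (div_le_div_of_nonneg_right (hG (s + n) _).2 hΩ.le) (hT0 z j)
    refine (mul_le_mul_of_nonneg_left h2 (F.normConst_nonneg z _)).trans (le_of_eq ?_)
    rw [FeynmanKac.normConst_succ, FeynmanKac.coal]
    field_simp
  have hci : ∀ t n', Integrable (fun ω => F.normConst (path ξ ω) t * F.coal (path ξ ω) s n') P :=
    fun t n' => integrable_of_abs_le
      (((F.measurable_normConst t).mul (F.measurable_coal s n')).comp hF.measurable_path)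
      fun ω => by
        rw [abs_of_nonneg (mul_nonneg (F.normConst_nonneg _ _) (F.coal_nonneg _ _ _))]
        exact FeynmanKac.normConst_mul_coal_le hG0 hG hpos hN _ t s n'
  have hmi : Integrable (fun ω => ∫ y, φ (path ξ ω) y ∂(F.mixture N (s + n) (path ξ ω))) P := by
    have := FeynmanKac.isMarkovKernel_mixture (F := F) hg hN (s + n)
    exact integrable_of_abs_le ((measurable_integral_kernel hφm).comp hF.measurable_path)
      fun ω => abs_integral_le_of_abs_le (hφb _)
  clear_value φ
  have hφi : ∀ k, Integrable (fun ω => φ (path ξ ω) (ξ (s + n + 1) k ω)) P := fun k =>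
    integrable_of_abs_le
      (hφm.comp (hF.measurable_path.prodMk (hF.measurable_particle (s + n + 1) k))) fun ω => hφb _ _
  have hk : ∀ k, ∫ ω, φ (path ξ ω) (ξ (s + n + 1) k ω) ∂P ≤
      G * ∫ ω, F.normConst (path ξ ω) (s + n) * F.coal (path ξ ω) s n ∂P := fun k => by
    rw [hF.integral_single hg hN (s + n) k hφm hφb fun z y => by
      simp only [hφ, F.normConst_stopAt le_rfl, F.backWeight_stopAt le_rfl,
        F.backMat_stopAt le_rfl], ← integral_const_mul]
    exact integral_mono hmi ((hci (s + n) n).const_mul _) fun ω => hmix _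
  have hsi : Integrable (fun ω => (N : ℝ)⁻¹ * ∑ k, φ (path ξ ω) (ξ (s + n + 1) k ω)) P :=
    (integrable_finsetSum _ fun k _ => hφi k).const_mul _
  refine (integral_mono (hci (s + n + 1) (n + 1)) hsi hsum).trans ?_
  rw [integral_const_mul, integral_finsetSum _ fun k _ => hφi k, inv_mul_le_iff₀ hN']
  have h2 := Finset.sum_le_sum fun k (_ : k ∈ Finset.univ) => hk k
  rw [Finset.sum_const, Finset.card_univ, Fintype.card_fin, nsmul_eq_mul] at h2
  exact h2

end Filter

end SMC

end

/-! ### Mean square convergence of the backward sums. -/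

noncomputable section

namespace SMC

namespace FeynmanKac

variable {X : Type*} [MeasurableSpace X] (F : FeynmanKac X) {N : ℕ} {G : ℝ}

/-- The mean square distance between `backSum` and its limit. -/
def backErr (z : ℕ → Fin N → X) (s n : ℕ) (h : X → ℝ) : ℝ :=
  (N : ℝ)⁻¹ * ∑ l, (F.backSum z s n h l - F.normConst z s * F.opQs s n h (z s l)) ^ 2

lemma measurable_backErr (s n : ℕ) {h : X → ℝ} (hh : Measurable h) :
    Measurable fun z : ℕ → Fin N → X => F.backErr z s n h :=
  (Finset.measurable_sum _ fun l _ => ((F.measurable_backSum s n hh l).sub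
    ((F.measurable_normConst s).mul
      ((F.measurable_opQs s n hh).comp (measurable_eval s l)))).pow_const 2).const_mul _

lemma backErr_nonneg (z : ℕ → Fin N → X) (s n : ℕ) (h : X → ℝ) : 0 ≤ F.backErr z s n h :=
  mul_nonneg (by positivity) (Finset.sum_nonneg fun _ _ => sq_nonneg _)

variable {F}

/-- The bound grows with `N`; it serves integrability only and never enters a limit. -/
lemma abs_backSum_sub_le (hG0 : 0 < G) (hG : ∀ t x, 0 < F.g t x ∧ F.g t x ≤ G)
    (hpos : F.DensitiesPositive) (hN : 0 < N) (z : ℕ → Fin N → X) (s n : ℕ) {h : X → ℝ} {C : ℝ}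
    (hC : ∀ x, |h x| ≤ C) (l : Fin N) :
    |F.backSum z s n h l - F.normConst z s * F.opQs s n h (z s l)| ≤
      G ^ (s + n) * (N * C) + G ^ s * (G ^ n * C) := by
  refine (abs_sub _ _).trans (add_le_add (abs_backSum_le hG0 hG hpos hN z s n hC l) ?_)
  rw [abs_mul, abs_of_nonneg (F.normConst_nonneg z s)]
  exact mul_le_mul (normConst_le hG0 hG z s) (abs_opQs_le hG s n hC _) (abs_nonneg _)
    (by positivity)

/-- `backErr` is bounded for each number of particles. -/
lemma exists_abs_backErr_le (hG0 : 0 < G) (hG : ∀ t x, 0 < F.g t x ∧ F.g t x ≤ G)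
    (hpos : F.DensitiesPositive) (hN : 0 < N) (s n : ℕ) {h : X → ℝ} {C : ℝ}
    (hC : ∀ x, |h x| ≤ C) : ∃ K, ∀ z : ℕ → Fin N → X, |F.backErr z s n h| ≤ K := by
  refine ⟨(N : ℝ)⁻¹ * ∑ _l : Fin N, (G ^ (s + n) * (N * C) + G ^ s * (G ^ n * C)) ^ 2,
    fun z => ?_⟩
  rw [abs_of_nonneg (F.backErr_nonneg z s n h)]
  refine mul_le_mul_of_nonneg_left (Finset.sum_le_sum fun l _ => ?_) (by positivity)
  have h1 := abs_backSum_sub_le hG0 hG hpos hN z s n hC l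
  exact sq_le_sq' (neg_le_of_abs_le h1) (le_of_abs_le h1)

end FeynmanKac

section Filter

variable {X Ω : Type*} [MeasurableSpace X] [MeasurableSpace Ω] {F : FeynmanKac X} {P : Measure Ω}
  [IsProbabilityMeasure P] {G : ℝ}

section FixedN

variable {N : ℕ} {ξ : ℕ → Fin N → Ω → X} {A : ℕ → Fin N → Ω → Fin N}

lemma integrable_normConst_mul_coal (hG0 : 0 < G) (hG : ∀ t x, 0 < F.g t x ∧ F.g t x ≤ G)
    (hpos : F.DensitiesPositive) (hN : 0 < N) (hF : IsBootstrapFilter F P ξ A) (t s n : ℕ) :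
    Integrable (fun ω => F.normConst (path ξ ω) t * F.coal (path ξ ω) s n) P :=
  integrable_of_abs_le
    (((F.measurable_normConst t).mul (F.measurable_coal s n)).comp hF.measurable_path)
    fun ω => by
      rw [abs_of_nonneg (mul_nonneg (F.normConst_nonneg _ _) (F.coal_nonneg _ _ _))]
      exact FeynmanKac.normConst_mul_coal_le hG0 hG hpos hN _ t s n

lemma integrable_backErr (hG0 : 0 < G) (hG : ∀ t x, 0 < F.g t x ∧ F.g t x ≤ G)
    (hpos : F.DensitiesPositive) (hN : 0 < N) (hF : IsBootstrapFilter F P ξ A) (s n : ℕ)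
    {h : X → ℝ} (hh : Measurable h) {C : ℝ} (hC : ∀ x, |h x| ≤ C) :
    Integrable (fun ω => F.backErr (path ξ ω) s n h) P := by
  obtain ⟨K, hK⟩ := FeynmanKac.exists_abs_backErr_le hG0 hG hpos hN s n hC
  exact integrable_of_abs_le ((F.measurable_backErr s n hh).comp hF.measurable_path)
    fun ω => hK _

/-- This is the bias-variance bound for the sample at time `s + n + 1`, applied for each `l`. The
target is the same for the pair `n + 1`, `h` as for `n`, `Q h`, so the bias is the error at the
shorter lag; the variances summed over `l` form the collision probability. -/
lemma integral_backErr_succ_le (hG0 : 0 < G) (hG : ∀ t x, 0 < F.g t x ∧ F.g t x ≤ G)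
    (hpos : F.DensitiesPositive) (hN : 0 < N) (hF : IsBootstrapFilter F P ξ A) (s n : ℕ)
    {h : X → ℝ} (hh : Measurable h) {C : ℝ} (hC : ∀ x, |h x| ≤ C) :
    ∫ ω, F.backErr (path ξ ω) s (n + 1) h ∂P ≤
      ∫ ω, F.backErr (path ξ ω) s n (F.opQ (s + n) h) ∂P +
        C ^ 2 * G ^ (s + n + 1) *
          ∫ ω, F.normConst (path ξ ω) (s + n + 1) * F.coal (path ξ ω) s (n + 1) ∂P := by
  have hg : F.PotentialsBounded := ⟨G, hG0, hG⟩
  have hN' : (0 : ℝ) < N := by exact_mod_cast hN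
  obtain ⟨φ, hφ⟩ : ∃ φ : Fin N → (ℕ → Fin N → X) → X → ℝ, φ = fun l z y =>
    F.normConst z (s + n + 1) *
      ∑ j, F.backMat z s n j l * (h y * F.backWeight z (s + n) y j) := ⟨_, rfl⟩
  have hφm : ∀ l, Measurable (Function.uncurry (φ l)) := fun l => by
    rw [hφ]
    exact ((F.measurable_normConst _).comp measurable_fst).mul (Finset.measurable_sum _ fun j _ =>
      ((F.measurable_backMat s n j l).comp measurable_fst).mul
        ((hh.comp measurable_snd).mul (F.measurable_backWeight (s + n) j)))
  have hφT : ∀ l ω k, φ l (path ξ ω) (ξ (s + n + 1) k ω) = F.normConst (path ξ ω) (s + n + 1) *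
      (h (ξ (s + n + 1) k ω) * F.backMat (path ξ ω) s (n + 1) k l) := fun l ω k => by
    simp only [hφ, FeynmanKac.backMat, Finset.mul_sum]
    refine Finset.sum_congr rfl fun j _ => ?_
    rw [FeynmanKac.β_eq_backWeight]
    simp only [path]
    ring
  have hhb : ∀ (z : ℕ → Fin N → X) j y, |h y * F.backWeight z (s + n) y j| ≤
      C * F.backWeight z (s + n) y j := fun z j y => by
    rw [abs_mul, abs_of_nonneg (F.backWeight_nonneg z _ y j)]
    exact mul_le_mul_of_nonneg_right (hC y) (F.backWeight_nonneg z _ y j)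
  have hφb : ∀ l z y, |φ l z y| ≤ G ^ (s + n + 1) * C := fun l z y => by
    rw [hφ, abs_mul, abs_of_nonneg (F.normConst_nonneg z _)]
    refine mul_le_mul (FeynmanKac.normConst_le hG0 hG z _) ?_ (abs_nonneg _) (by positivity)
    calc |∑ j, F.backMat z s n j l * (h y * F.backWeight z (s + n) y j)|
        ≤ ∑ j, |F.backMat z s n j l * (h y * F.backWeight z (s + n) y j)| :=
          Finset.abs_sum_le_sum_abs _ _
      _ ≤ ∑ j, C * F.backWeight z (s + n) y j := Finset.sum_le_sum fun j _ => by
          rw [abs_mul, abs_of_nonneg (F.backMat_nonneg z s n j l)]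
          exact (mul_le_of_le_one_left (abs_nonneg _)
            (FeynmanKac.backMat_le_one hg hpos hN z s n j l)).trans (hhb z j y)
      _ = C := by
          rw [← Finset.mul_sum, FeynmanKac.sum_backWeight hg hpos hN, mul_one]
  -- The cancellation of the backward denominator makes the last backward step an application of
  -- `Q`, with no error.
  have hmean : ∀ l z, N * ∫ y, φ l z y ∂(F.mixture N (s + n) z) =
      F.backSum z s n (F.opQ (s + n) h) l := fun l z => by
    have := FeynmanKac.isMarkovKernel_mixture (F := F) hg hN (s + n)
    have hΩ := (FeynmanKac.totalWeight_pos hg hN z (s + n)).ne'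
    have hbi : ∀ j, Integrable
        (fun y => F.backMat z s n j l * (h y * F.backWeight z (s + n) y j))
        (F.mixture N (s + n) z) := fun j =>
      (integrable_of_abs_le (hh.mul (F.measurable_backWeight (s + n) j).of_uncurry_left)
        (C := C) fun y => (hhb z j y).trans (mul_le_of_le_one_right
          ((abs_nonneg _).trans (hC y)) (F.backWeight_le_one z _ y j))).const_mul _
    rw [hφ, integral_const_mul, integral_finsetSum _ fun j _ => hbi j]
    simp only [integral_const_mul,
      FeynmanKac.integral_mul_backWeight_mixture hg hpos hN (s + n) z _ hh hC]
    rw [FeynmanKac.backSum, FeynmanKac.normConst_succ]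
    simp only [FeynmanKac.normWeight, FeynmanKac.opQ, Finset.mul_sum]
    refine Finset.sum_congr rfl fun j _ => ?_
    field_simp
  have hl : ∀ l, ∫ ω, (F.backSum (path ξ ω) s (n + 1) h l -
        F.normConst (path ξ ω) s * F.opQs s (n + 1) h (path ξ ω s l)) ^ 2 ∂P ≤
      ∫ ω, (F.backSum (path ξ ω) s n (F.opQ (s + n) h) l -
        F.normConst (path ξ ω) s * F.opQs s n (F.opQ (s + n) h) (path ξ ω s l)) ^ 2 ∂P +
      ∑ k, ∫ ω, φ l (path ξ ω) (ξ (s + n + 1) k ω) ^ 2 ∂P := fun l => by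
    have h1 := hF.integral_sq_sum_sub_le hg hN (s + n) (hφm l) (hφb l)
      (fun z y => by
        simp only [hφ, F.normConst_stopAt le_rfl, F.backWeight_stopAt le_rfl,
          F.backMat_stopAt le_rfl])
      (a := fun z => F.normConst z s * F.opQs s (n + 1) h (z s l))
      ((F.measurable_normConst s).mul ((F.measurable_opQs s (n + 1) hh).comp
        (FeynmanKac.measurable_eval s l)))
      (C' := G ^ s * (G ^ (n + 1) * C))
      (fun z => by
        rw [abs_mul, abs_of_nonneg (F.normConst_nonneg z s)]
        exact mul_le_mul (FeynmanKac.normConst_le hG0 hG z s)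
          (FeynmanKac.abs_opQs_le hG s (n + 1) hC _) (abs_nonneg _) (by positivity))
      (fun z => by
        rw [F.normConst_stopAt (by omega)]
        simp [stopAt])
    simp only [hmean] at h1
    have h2 : ∀ ω, F.backSum (path ξ ω) s (n + 1) h l =
        ∑ k, φ l (path ξ ω) (ξ (s + n + 1) k ω) := fun ω => by
      simp only [hφT, ← Finset.mul_sum]
      rfl
    simp only [h2]
    exact h1
  have hbi : ∀ (n' : ℕ) {f : X → ℝ} {K : ℝ}, Measurable f → (∀ x, |f x| ≤ K) → ∀ l,
      Integrable (fun ω => (F.backSum (path ξ ω) s n' f l -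
        F.normConst (path ξ ω) s * F.opQs s n' f (path ξ ω s l)) ^ 2) P :=
    fun n' f K hf hK l => integrable_of_abs_le
      (((((F.measurable_backSum s n' hf l).sub ((F.measurable_normConst s).mul
        ((F.measurable_opQs s n' hf).comp (FeynmanKac.measurable_eval s l)))).pow_const 2)).comp
          hF.measurable_path)
      (C := (G ^ (s + n') * (N * K) + G ^ s * (G ^ n' * K)) ^ 2) fun ω => by
        have h1 := FeynmanKac.abs_backSum_sub_le hG0 hG hpos hN (path ξ ω) s n' hK l
        rw [abs_of_nonneg (sq_nonneg _)]
        exact sq_le_sq' (neg_le_of_abs_le h1) (le_of_abs_le h1)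
  have hsq : ∀ l k, Integrable (fun ω => φ l (path ξ ω) (ξ (s + n + 1) k ω) ^ 2) P := fun l k =>
    integrable_of_abs_le (((hφm l).comp
      (hF.measurable_path.prodMk (hF.measurable_particle (s + n + 1) k))).pow_const 2)
      (C := (G ^ (s + n + 1) * C) ^ 2) fun ω => by
        have h1 := hφb l (path ξ ω) (ξ (s + n + 1) k ω)
        rw [abs_of_nonneg (sq_nonneg _)]
        exact sq_le_sq' (neg_le_of_abs_le h1) (le_of_abs_le h1)
  -- Of the two factors `normConst` only one is bounded by a power of `G`. The other is kept because
  -- `coal` is controlled only when multiplied by it.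
  have hvar : (N : ℝ)⁻¹ * ∑ l, ∑ k, ∫ ω, φ l (path ξ ω) (ξ (s + n + 1) k ω) ^ 2 ∂P ≤
      C ^ 2 * G ^ (s + n + 1) *
        ∫ ω, F.normConst (path ξ ω) (s + n + 1) * F.coal (path ξ ω) s (n + 1) ∂P := by
    have h1 : ∀ l, Integrable (fun ω => ∑ k, φ l (path ξ ω) (ξ (s + n + 1) k ω) ^ 2) P := fun l =>
      integrable_finsetSum _ fun k _ => hsq l k
    simp only [← integral_finsetSum _ fun k (_ : k ∈ Finset.univ) => hsq _ k]
    rw [← integral_finsetSum _ fun l _ => h1 l, ← integral_const_mul, ← integral_const_mul]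
    refine integral_mono ((integrable_finsetSum _ fun l _ => h1 l).const_mul _)
      ((integrable_normConst_mul_coal hG0 hG hpos hN hF _ _ _).const_mul _) fun ω => ?_
    simp only [hφT]
    have hc0 := F.normConst_nonneg (path ξ ω) (s + n + 1)
    have hc1 := FeynmanKac.normConst_le hG0 hG (path ξ ω) (s + n + 1)
    have h2 : ∀ l k, (F.normConst (path ξ ω) (s + n + 1) *
        (h (ξ (s + n + 1) k ω) * F.backMat (path ξ ω) s (n + 1) k l)) ^ 2 ≤
        C ^ 2 * G ^ (s + n + 1) * F.normConst (path ξ ω) (s + n + 1) *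
          F.backMat (path ξ ω) s (n + 1) k l ^ 2 := fun l k => by
      have h3 : h (ξ (s + n + 1) k ω) ^ 2 ≤ C ^ 2 :=
        sq_le_sq' (neg_le_of_abs_le (hC _)) (le_of_abs_le (hC _))
      have h4 : F.normConst (path ξ ω) (s + n + 1) ^ 2 ≤
          G ^ (s + n + 1) * F.normConst (path ξ ω) (s + n + 1) := by
        rw [sq]; exact mul_le_mul_of_nonneg_right hc1 hc0
      calc _ = h (ξ (s + n + 1) k ω) ^ 2 * F.normConst (path ξ ω) (s + n + 1) ^ 2 *
            F.backMat (path ξ ω) s (n + 1) k l ^ 2 := by ring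
        _ ≤ C ^ 2 * (G ^ (s + n + 1) * F.normConst (path ξ ω) (s + n + 1)) *
            F.backMat (path ξ ω) s (n + 1) k l ^ 2 := by gcongr
        _ = _ := by ring
    refine (mul_le_mul_of_nonneg_left (Finset.sum_le_sum fun l _ => Finset.sum_le_sum fun k _ =>
      h2 l k) (inv_pos.2 hN').le).trans (le_of_eq ?_)
    simp only [← Finset.mul_sum]
    rw [FeynmanKac.coal, Finset.sum_comm]
    ring
  simp only [FeynmanKac.backErr]
  rw [integral_const_mul, integral_const_mul, integral_finsetSum _ fun l _ => hbi (n + 1) hh hC l,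
    integral_finsetSum _ fun l _ =>
      hbi n (F.measurable_opQ _ hh) (FeynmanKac.abs_opQ_le hG _ hC) l]
  refine le_trans ?_ (add_le_add le_rfl hvar)
  rw [← mul_add, ← Finset.sum_add_distrib]
  exact mul_le_mul_of_nonneg_left (Finset.sum_le_sum fun l _ => hl l) (inv_pos.2 hN').le

end FixedN

/-- Convergence in mean square implies convergence in mean. -/
lemma sq_integral_abs_le {f : Ω → ℝ} (hf : Measurable f) {C : ℝ} (hC : ∀ ω, |f ω| ≤ C) :
    (∫ ω, |f ω| ∂P) ^ 2 ≤ ∫ ω, f ω ^ 2 ∂P := by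
  have hi1 : Integrable (fun ω => |f ω|) P := (integrable_of_abs_le hf hC).abs
  have hi2 : Integrable (fun ω => f ω ^ 2) P :=
    integrable_of_abs_le (hf.pow_const 2) (C := C ^ 2) fun ω => by
      rw [abs_of_nonneg (sq_nonneg _)]
      exact sq_le_sq' (neg_le_of_abs_le (hC ω)) (le_of_abs_le (hC ω))
  set c := ∫ ω, |f ω| ∂P with hc
  -- The inequality is the nonnegativity of the variance of `|f|`.
  have h1 : 0 ≤ ∫ ω, (|f ω| - c) ^ 2 ∂P := integral_nonneg fun ω => sq_nonneg _
  have h2 : ∀ ω, (|f ω| - c) ^ 2 = f ω ^ 2 - 2 * c * |f ω| + c ^ 2 := fun ω => by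
    rw [sub_sq, sq_abs]; ring
  simp only [h2] at h1
  have hi3 : Integrable (fun ω => f ω ^ 2 - 2 * c * |f ω|) P := hi2.sub (hi1.const_mul _)
  rw [integral_add hi3 (integrable_const _), integral_sub hi2 (hi1.const_mul _),
    integral_const_mul, ← hc] at h1
  simp at h1
  nlinarith

variable {ξ : (N : ℕ) → ℕ → Fin N → Ω → X} {A : (N : ℕ) → ℕ → Fin N → Ω → Fin N}

lemma tendsto_of_sq_le {a b : ℕ → ℝ} (ha : ∀ N, 0 ≤ a N) (hab : ∀ᶠ N in atTop, a N ^ 2 ≤ b N)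
    (hb : Tendsto b atTop (nhds 0)) : Tendsto a atTop (nhds 0) := by
  have h1 : Tendsto (fun N => Real.sqrt (b N)) atTop (nhds 0) := by
    have h2 := (Real.continuous_sqrt.tendsto 0).comp hb
    rwa [Real.sqrt_zero] at h2
  refine squeeze_zero' (Eventually.of_forall ha) ?_ h1
  filter_upwards [hab] with N hN
  exact Real.le_sqrt_of_sq_le hN

lemma tendsto_integral_sq_γN_sub (hG0 : 0 < G) (hG : ∀ t x, 0 < F.g t x ∧ F.g t x ≤ G)
    (hξ : ∀ N, 0 < N → IsBootstrapFilter F P (ξ N) (A N)) (t : ℕ) {f : X → ℝ}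
    (hf : Measurable f) {C : ℝ} (hC : ∀ x, |f x| ≤ C) :
    Tendsto (fun N => ∫ ω, (F.γN (path (ξ N) ω) t f - ∫ x, f x ∂(F.γ t)) ^ 2 ∂P) atTop
      (nhds 0) := by
  have hC' : ∀ x, |f x| ≤ |C| := fun x => (hC x).trans (le_abs_self C)
  obtain ⟨K, hK⟩ := exists_integral_sq_γN_sub_le (P := P) hG0 hG t |C| (abs_nonneg _)
  have h1 : Tendsto (fun N : ℕ => K * (N : ℝ)⁻¹) atTop (nhds 0) := by
    simpa using tendsto_inv_atTop_nhds_zero_nat.const_mul K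
  refine squeeze_zero' (Eventually.of_forall fun N => integral_nonneg fun ω => sq_nonneg _) ?_ h1
  filter_upwards [eventually_gt_atTop 0] with N hN
  exact hK f hf hC' (ξ N) (A N) hN (hξ N hN)

lemma tendsto_integral_abs_γN_sub (hG0 : 0 < G) (hG : ∀ t x, 0 < F.g t x ∧ F.g t x ≤ G)
    (hξ : ∀ N, 0 < N → IsBootstrapFilter F P (ξ N) (A N)) (t : ℕ) {f : X → ℝ}
    (hf : Measurable f) {C : ℝ} (hC : ∀ x, |f x| ≤ C) :
    Tendsto (fun N => ∫ ω, |F.γN (path (ξ N) ω) t f - ∫ x, f x ∂(F.γ t)| ∂P) atTop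
      (nhds 0) := by
  refine tendsto_of_sq_le (fun N => integral_nonneg fun ω => abs_nonneg _) ?_
    (tendsto_integral_sq_γN_sub hG0 hG hξ t hf hC)
  filter_upwards [eventually_gt_atTop 0] with N hN
  refine sq_integral_abs_le (((F.measurable_γN t hf).comp (hξ N hN).measurable_path).sub
    measurable_const) (C := G ^ t * |C| + |∫ x, f x ∂(F.γ t)|) fun ω => ?_
  exact (abs_sub _ _).trans (add_le_add (FeynmanKac.abs_γN_le hG0 hG _ t (abs_nonneg _)
    fun x => (hC x).trans (le_abs_self C)) le_rfl)

/-- The transition densities are positive, so `X` is exhausted up to a small mass by sets of finite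
reference measure. -/
lemma exists_set_of_finite_measure
    (hpos : F.DensitiesPositive) (μ : Measure X) [IsFiniteMeasure μ] {ε : ℝ} (hε : 0 < ε) :
    ∃ B : Set X, MeasurableSet B ∧ F.ν B ≠ ⊤ ∧ ∫ x, Bᶜ.indicator (fun _ => (1 : ℝ)) x ∂μ < ε := by
  obtain ⟨x₀⟩ : Nonempty X := F.M₀.nonempty_of_neZero
  have hm : Measurable fun y => F.m 0 x₀ y := (F.measurable_m 0).of_uncurry_left
  -- Superlevel sets of one probability density have finite `ν` measure by Markov's inequality, and
  -- they exhaust `X` because the density is positive everywhere. Thus `ν` need not be assumed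
  -- σ-finite.
  set B : ℕ → Set X := fun i => {y | 1 / ((i : ℝ) + 1) ≤ F.m 0 x₀ y} with hB
  have hBm : ∀ i, MeasurableSet (B i) := fun i => measurableSet_le measurable_const hm
  have hBf : ∀ i, F.ν (B i) ≠ ⊤ := fun i => by
    have h1 : ENNReal.ofReal (1 / ((i : ℝ) + 1)) * F.ν (B i) ≤ 1 := by
      calc ENNReal.ofReal (1 / ((i : ℝ) + 1)) * F.ν (B i)
          ≤ ENNReal.ofReal (1 / ((i : ℝ) + 1)) *
            F.ν {y | ENNReal.ofReal (1 / ((i : ℝ) + 1)) ≤ ENNReal.ofReal (F.m 0 x₀ y)} := by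
            gcongr
            exact fun y hy => ENNReal.ofReal_le_ofReal hy
        _ ≤ ∫⁻ y, ENNReal.ofReal (F.m 0 x₀ y) ∂F.ν :=
            mul_meas_ge_le_lintegral hm.ennreal_ofReal _
        _ = F.M 0 x₀ Set.univ := by rw [F.M_eq, withDensity_apply _ MeasurableSet.univ]; simp
        _ = 1 := measure_univ
    intro htop
    rw [htop, ENNReal.mul_top (by simp; positivity)] at h1
    simp at h1
  have hlim : Tendsto (fun i => ∫ x, (B i)ᶜ.indicator (fun _ => (1 : ℝ)) x ∂μ) atTop (nhds 0) := by
    have h1 := tendsto_integral_of_dominated_convergence (μ := μ) (f := fun _ => (0 : ℝ))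
      (F := fun i => (B i)ᶜ.indicator (fun _ => (1 : ℝ))) (fun _ => (1 : ℝ))
      (fun i => (measurable_const.indicator (hBm i).compl).aestronglyMeasurable)
      (integrable_const _) (fun i => ae_of_all _ fun x => by
        by_cases hx : x ∈ B i <;> simp [hx])
      (ae_of_all _ fun x => by
        refine tendsto_const_nhds.congr' ?_
        have h2 := (tendsto_one_div_add_atTop_nhds_zero_nat (𝕜 := ℝ)).eventually
          (gt_mem_nhds (hpos 0 x₀ x))
        filter_upwards [h2] with i hi
        have : x ∈ B i := hi.le
        simp [this])
    simpa using h1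
  obtain ⟨i, hi⟩ := (hlim.eventually (gt_mem_nhds hε)).exists
  exact ⟨B i, hBm i, hBf i, hi⟩

lemma tendsto_integral_coal_one (hG0 : 0 < G) (hG : ∀ t x, 0 < F.g t x ∧ F.g t x ≤ G)
    (hpos : F.DensitiesPositive) {σ : ℝ} (hσ0 : 0 < σ) (hσ : ∀ t x y, F.m t x y ≤ σ)
    (hξ : ∀ N, 0 < N → IsBootstrapFilter F P (ξ N) (A N)) (s : ℕ) :
    Tendsto (fun N => ∫ ω, F.normConst (path (ξ N) ω) (s + 1) * F.coal (path (ξ N) ω) s 1 ∂P)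
      atTop (nhds 0) := by
  -- The form with a strict inequality `N > N₀` also provides `0 < N`.
  rw [Metric.tendsto_atTop']
  intro ε hε
  have := FeynmanKac.isFiniteMeasure_γ hG (s + 1)
  -- `B` is fixed before `N`. The other half of `ε` pays for the term in `1 / N` and for the error
  -- of `γ_s^N` at `Q` of the indicator of the complement.
  obtain ⟨B, hB, hνB, hBε⟩ := exists_set_of_finite_measure hpos (F.γ (s + 1)) (half_pos hε)
  have hind : ∀ y, |Bᶜ.indicator (fun _ => (1 : ℝ)) y| ≤ 1 := fun y => by
    by_cases hy : y ∈ B <;> simp [hy]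
  have him : Measurable (Bᶜ.indicator fun _ => (1 : ℝ)) := measurable_const.indicator hB.compl
  rw [FeynmanKac.integral_γ_succ hG s him hind] at hBε
  set f := F.opQ s (Bᶜ.indicator fun _ => (1 : ℝ)) with hf
  have hfm : Measurable f := F.measurable_opQ s him
  have hfb : ∀ x, |f x| ≤ G * 1 := FeynmanKac.abs_opQ_le hG s hind
  have h1 := tendsto_integral_abs_γN_sub hG0 hG hξ s hfm hfb
  have h2 : Tendsto (fun N : ℕ => G ^ (s + 1) * (σ * F.ν.real B) * (N : ℝ)⁻¹) atTop (nhds 0) := by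
    simpa using tendsto_inv_atTop_nhds_zero_nat.const_mul (G ^ (s + 1) * (σ * F.ν.real B))
  have h3 := (h2.add h1).eventually (gt_mem_nhds (show (0 : ℝ) + 0 < ε / 2 by linarith))
  obtain ⟨N₀, hN₀⟩ := eventually_atTop.1 h3
  refine ⟨N₀, fun N hN => ?_⟩
  have hNpos : 0 < N := by omega
  have hF := hξ N hNpos
  have h4 := integral_coal_one_le hG0 hG hpos hσ0 hσ hNpos hF s hB hνB
  have hγm : Measurable fun ω => F.γN (path (ξ N) ω) s f :=
    (F.measurable_γN s hfm).comp hF.measurable_path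
  have hγi : Integrable (fun ω => F.γN (path (ξ N) ω) s f) P :=
    integrable_of_abs_le hγm fun ω =>
      FeynmanKac.abs_γN_le hG0 hG _ s (by positivity : 0 ≤ G * 1) hfb
  have h5 : ∫ ω, F.γN (path (ξ N) ω) s f ∂P ≤
      ∫ ω, |F.γN (path (ξ N) ω) s f - ∫ x, f x ∂(F.γ s)| ∂P + ∫ x, f x ∂(F.γ s) := by
    have hi : Integrable (fun ω => |F.γN (path (ξ N) ω) s f - ∫ x, f x ∂(F.γ s)|) P :=
      (hγi.sub (integrable_const _)).abs
    have hi' : Integrable (fun ω => |F.γN (path (ξ N) ω) s f - ∫ x, f x ∂(F.γ s)| +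
        ∫ x, f x ∂(F.γ s)) P := hi.add (integrable_const _)
    have h6 := integral_mono hγi hi' fun ω => by
      have := le_abs_self (F.γN (path (ξ N) ω) s f - ∫ x, f x ∂(F.γ s))
      simp only
      linarith
    rw [integral_add hi (integrable_const _)] at h6
    simpa using h6
  have h7 := hN₀ N hN.le
  rw [Real.dist_eq, sub_zero, abs_of_nonneg (integral_nonneg fun ω =>
    mul_nonneg (F.normConst_nonneg _ _) (F.coal_nonneg _ _ _))]
  linarith

/-- The lag must be positive: at lag zero both chains sit at their common starting index and `coal`
equals one. -/
lemma tendsto_integral_coal (hG0 : 0 < G) (hG : ∀ t x, 0 < F.g t x ∧ F.g t x ≤ G)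
    (hpos : F.DensitiesPositive) {σ : ℝ} (hσ0 : 0 < σ) (hσ : ∀ t x y, F.m t x y ≤ σ)
    (hξ : ∀ N, 0 < N → IsBootstrapFilter F P (ξ N) (A N)) (s n : ℕ) :
    Tendsto (fun N => ∫ ω, F.normConst (path (ξ N) ω) (s + (n + 1)) *
      F.coal (path (ξ N) ω) s (n + 1) ∂P) atTop (nhds 0) := by
  induction n with
  | zero => exact tendsto_integral_coal_one hG0 hG hpos hσ0 hσ hξ s
  | succ n ih =>
    have h1 : Tendsto (fun N => G * ∫ ω, F.normConst (path (ξ N) ω) (s + (n + 1)) *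
      F.coal (path (ξ N) ω) s (n + 1) ∂P) atTop (nhds 0) := by simpa using ih.const_mul G
    refine squeeze_zero' (Eventually.of_forall fun N => integral_nonneg fun ω =>
      mul_nonneg (F.normConst_nonneg _ _) (F.coal_nonneg _ _ _)) ?_ h1
    filter_upwards [eventually_gt_atTop 0] with N hN
    exact integral_coal_succ_le hG0 hG hpos hN (hξ N hN) s (n + 1)

/-- The error is exactly zero at lag zero, and each further step adds a multiple of a vanishing
collision probability while replacing `h` by `Q h`. -/
lemma tendsto_integral_backErr (hG0 : 0 < G) (hG : ∀ t x, 0 < F.g t x ∧ F.g t x ≤ G)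
    (hpos : F.DensitiesPositive) {σ : ℝ} (hσ0 : 0 < σ) (hσ : ∀ t x y, F.m t x y ≤ σ)
    (hξ : ∀ N, 0 < N → IsBootstrapFilter F P (ξ N) (A N)) (s n : ℕ) :
    ∀ {h : X → ℝ} {C : ℝ}, Measurable h → (∀ x, |h x| ≤ C) →
      Tendsto (fun N => ∫ ω, F.backErr (path (ξ N) ω) s n h ∂P) atTop (nhds 0) := by
  induction n with
  | zero =>
    intro h C hh hC
    have h1 : ∀ N (z : ℕ → Fin N → X), F.backErr z s 0 h = 0 := fun N z => by
      simp [FeynmanKac.backErr, FeynmanKac.backSum, FeynmanKac.backMat, FeynmanKac.opQs]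
    simp [h1]
  | succ n ih =>
    intro h C hh hC
    have h1 := (ih (F.measurable_opQ (s + n) hh) (FeynmanKac.abs_opQ_le hG (s + n) hC)).add
      ((tendsto_integral_coal hG0 hG hpos hσ0 hσ hξ s n).const_mul (C ^ 2 * G ^ (s + n + 1)))
    rw [mul_zero, add_zero] at h1
    refine squeeze_zero' (Eventually.of_forall fun N => integral_nonneg fun ω =>
      F.backErr_nonneg _ _ _ _) ?_ h1
    filter_upwards [eventually_gt_atTop 0] with N hN
    exact integral_backErr_succ_le hG0 hG hpos hN (hξ N hN) s n hh hC

end Filter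

end SMC

end

/-! ### Sums over index paths in terms of the backward transition matrices. -/

noncomputable section

namespace SMC

/-- Pairs with equal images are grouped by the common image. This turns meetings of two independent
paths into squares of one-path sums. -/
lemma sum_sum_ite_eq {K L : Type*} [Fintype K] [Fintype L] [DecidableEq L] (φ : K → L)
    (a : K → ℝ) :
    ∑ k, ∑ k', a k * a k' * (if φ k = φ k' then 1 else 0) =
      ∑ l, (∑ k, a k * if φ k = l then 1 else 0) ^ 2 := by
  simp only [sq, Finset.sum_mul_sum]
  conv_rhs => rw [Finset.sum_comm]
  refine Finset.sum_congr rfl fun k _ => ?_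
  conv_rhs => rw [Finset.sum_comm]
  refine Finset.sum_congr rfl fun k' _ => ?_
  rw [Finset.sum_eq_single (φ k)]
  · simp [eq_comm]
  · intro l _ hl
    simp [hl.symm]
  · simp

namespace FeynmanKac

variable {X : Type*} [MeasurableSpace X] (F : FeynmanKac X) {N : ℕ}

/-- The product of the backward weights along an index path. -/
def pathWeight (z : ℕ → Fin N → X) (t : ℕ) (k : Fin (t + 1) → Fin N) : ℝ :=
  ∏ s : Fin t, F.β z s (k s.succ) (k s.castSucc)

lemma pathWeight_nonneg (z : ℕ → Fin N → X) (t : ℕ) (k : Fin (t + 1) → Fin N) :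
    0 ≤ F.pathWeight z t k := Finset.prod_nonneg fun _ _ => F.β_nonneg z _ _ _

lemma Λ₁_eq (z : ℕ → Fin N → X) (t : ℕ) (k : Fin (t + 1) → Fin N) :
    F.Λ₁ z t k = (N : ℝ)⁻¹ * F.pathWeight z t k := rfl

lemma pathWeight_snoc (z : ℕ → Fin N → X) (t : ℕ) (k : Fin (t + 1) → Fin N) (j : Fin N) :
    F.pathWeight z (t + 1) (Fin.snoc (α := fun _ => Fin N) k j) =
      F.pathWeight z t k * F.β z t j (k (Fin.last t)) := by
  rw [pathWeight, Fin.prod_univ_castSucc, pathWeight]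
  congr 1
  · refine Finset.prod_congr rfl fun s _ => ?_
    rw [Fin.succ_castSucc, Fin.snoc_castSucc, Fin.snoc_castSucc, Fin.val_castSucc]
  · rw [Fin.succ_last, Fin.snoc_last, Fin.snoc_castSucc, Fin.val_last]

lemma sum_snoc {t : ℕ} (f : (Fin (t + 1) → Fin N) → ℝ) :
    ∑ k, f k = ∑ k : Fin t → Fin N, ∑ j, f (Fin.snoc (α := fun _ => Fin N) k j) := by
  rw [← (Fin.snocEquiv fun _ : Fin (t + 1) => Fin N).sum_comp, Fintype.sum_prod_type,
    Finset.sum_comm]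
  rfl

/-- Summation over the part of an index path after time `s`. -/
lemma sum_pathWeight_castLE (z : ℕ → Fin N → X) (s m : ℕ) (f : (Fin (s + 1) → Fin N) → ℝ)
    (H : Fin N → ℝ) :
    ∑ k : Fin (s + m + 1) → Fin N, F.pathWeight z (s + m) k *
        (f fun i => k (Fin.castLE (by omega) i)) * H (k (Fin.last _)) =
      ∑ k : Fin (s + 1) → Fin N, F.pathWeight z s k * f k *
        ∑ j, H j * F.backMat z s m j (k (Fin.last s)) := by
  induction m generalizing H with
  | zero => simp [backMat]
  | succ m ih =>
    -- Summing out the last index replaces the terminal function by its image under the transposed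
    -- backward kernel.
    have h1 := ih fun i => ∑ j, F.β z (s + m) j i * H j
    have h2 : ∀ k : Fin (s + 1) → Fin N,
        ∑ j, H j * F.backMat z s (m + 1) j (k (Fin.last s)) =
          ∑ i, (∑ j, F.β z (s + m) j i * H j) * F.backMat z s m i (k (Fin.last s)) := fun k => by
      simp only [backMat, Finset.mul_sum, Finset.sum_mul]
      rw [Finset.sum_comm]
      exact Finset.sum_congr rfl fun i _ => Finset.sum_congr rfl fun j _ => by ring
    simp only [h2]
    rw [← h1]
    change ∑ k : Fin (s + m + 1 + 1) → Fin N, F.pathWeight z (s + m + 1) k *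
        (f fun i => k (Fin.castLE _ i)) * H (k (Fin.last _)) = _
    rw [sum_snoc]
    refine Finset.sum_congr rfl fun k _ => ?_
    rw [Finset.mul_sum]
    refine Finset.sum_congr rfl fun j _ => ?_
    have h3 : (fun i : Fin (s + 1) => (Fin.snoc (α := fun _ => Fin N) k j : Fin (s + m + 1 + 1) →
        Fin N) (Fin.castLE (by omega) i)) = fun i => k (Fin.castLE (by omega) i) := by
      ext i
      have : (Fin.castLE (by omega) i : Fin (s + m + 1 + 1)) =
          Fin.castSucc (Fin.castLE (by omega) i) := rfl
      rw [this, Fin.snoc_castSucc]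
    rw [pathWeight_snoc, h3, Fin.snoc_last]
    ring

variable {F}

/-- The rows of `β` sum to one, so every index but the last sums out. Under `Λ₁` the last index is
therefore uniform. -/
lemma sum_pathWeight (hg : F.PotentialsBounded) (hpos : F.DensitiesPositive) (hN : 0 < N)
    (z : ℕ → Fin N → X) (t : ℕ) (H : Fin N → ℝ) :
    ∑ k : Fin (t + 1) → Fin N, F.pathWeight z t k * H (k (Fin.last t)) = ∑ j, H j := by
  induction t generalizing H with
  | zero =>
    rw [← (Equiv.funUnique (Fin 1) (Fin N)).symm.sum_comp]
    simp [pathWeight]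
  | succ t ih =>
    rw [sum_snoc]
    simp only [pathWeight_snoc, Fin.snoc_last]
    have h1 := ih fun i => ∑ j, F.β z t j i * H j
    simp only [Finset.mul_sum] at h1
    simp only [mul_assoc]
    rw [h1, Finset.sum_comm]
    simp only [← Finset.sum_mul, sum_β hg hpos hN, one_mul]

/-- The path is cut at time `s`: the later part gives the transition matrix, the earlier part sums
to one. -/
lemma sum_pathWeight_at (hg : F.PotentialsBounded) (hpos : F.DensitiesPositive) (hN : 0 < N)
    (z : ℕ → Fin N → X) (s m : ℕ) (H : Fin N → ℝ) (l : Fin N) :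
    ∑ k : Fin (s + m + 1) → Fin N, F.pathWeight z (s + m) k * H (k (Fin.last _)) *
        (if k ⟨s, by omega⟩ = l then 1 else 0) = ∑ j, H j * F.backMat z s m j l := by
  have h1 := F.sum_pathWeight_castLE z s m (fun k => if k (Fin.last s) = l then 1 else 0) H
  have h2 := sum_pathWeight hg hpos hN z s fun i =>
    (if i = l then 1 else 0) * ∑ j, H j * F.backMat z s m j i
  simp only [← mul_assoc] at h2
  rw [h2] at h1
  simp only [ite_mul, one_mul, zero_mul, Finset.sum_ite_eq', Finset.mem_univ, if_true] at h1
  rw [← h1]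
  exact Finset.sum_congr rfl fun k _ => mul_right_comm _ _ _

/-- This is the Markov property of the backward chain at time `s + n`. The two conditions are
written as one equality of pairs to fit `sum_sum_ite_eq`. -/
lemma sum_pathWeight_at_at (hg : F.PotentialsBounded) (hpos : F.DensitiesPositive) (hN : 0 < N)
    (z : ℕ → Fin N → X) (s n m : ℕ) (H : Fin N → ℝ) (l i : Fin N) :
    ∑ k : Fin (s + n + m + 1) → Fin N, F.pathWeight z (s + n + m) k * H (k (Fin.last _)) *
        (if (k ⟨s, by omega⟩, k ⟨s + n, by omega⟩) = (l, i) then 1 else 0) =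
      (∑ j, H j * F.backMat z (s + n) m j i) * F.backMat z s n i l := by
  have h1 := F.sum_pathWeight_castLE z (s + n) m
    (fun k => (if k ⟨s, by omega⟩ = l then 1 else 0) * if k (Fin.last _) = i then 1 else 0) H
  have h2 := sum_pathWeight_at hg hpos hN z s n (fun i' => (if i' = i then 1 else 0) *
    ∑ j, H j * F.backMat z (s + n) m j i') l
  simp only [ite_mul, one_mul, zero_mul, Finset.sum_ite_eq', Finset.mem_univ, if_true] at h2
  rw [← h2]
  have h3 : ∀ k : Fin (s + n + m + 1) → Fin N,
      F.pathWeight z (s + n + m) k * H (k (Fin.last _)) *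
        (if (k ⟨s, by omega⟩, k ⟨s + n, by omega⟩) = (l, i) then 1 else 0) =
      F.pathWeight z (s + n + m) k * ((if k ⟨s, by omega⟩ = l then 1 else 0) *
        if k ⟨s + n, by omega⟩ = i then 1 else 0) * H (k (Fin.last _)) := fun k => by
    rw [mul_right_comm]
    by_cases h4 : k ⟨s, by omega⟩ = l <;> by_cases h5 : k ⟨s + n, by omega⟩ = i <;>
      simp [h4, h5]
  simp only [h3]
  refine h1.trans (Finset.sum_congr rfl fun k _ => ?_)
  by_cases h4 : k ⟨s, by omega⟩ = l <;> by_cases h5 : k (Fin.last _) = i <;> simp [h4, h5]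

/-- The part of the second moment due to pairs of index paths that meet at time `s`. -/
lemma sum_sum_meet (hg : F.PotentialsBounded) (hpos : F.DensitiesPositive) (hN : 0 < N)
    (z : ℕ → Fin N → X) (s m : ℕ) (h : X → ℝ) :
    N * (F.normConst z (s + m) ^ 2 * ∑ k, ∑ k', F.Λ₁ z (s + m) k * F.Λ₁ z (s + m) k' *
      (if k ⟨s, by omega⟩ = k' ⟨s, by omega⟩ then 1 else 0) *
      (h (z (s + m) (k (Fin.last _))) * h (z (s + m) (k' (Fin.last _))))) =
    (N : ℝ)⁻¹ * ∑ l, F.backSum z s m h l ^ 2 := by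
  have hN' : (N : ℝ) ≠ 0 := Nat.cast_ne_zero.2 hN.ne'
  have h1 := sum_sum_ite_eq (fun k : Fin (s + m + 1) → Fin N => k ⟨s, by omega⟩)
    (fun k => F.pathWeight z (s + m) k * h (z (s + m) (k (Fin.last _))))
  have h2 := fun l => sum_pathWeight_at hg hpos hN z s m (fun j => h (z (s + m) j)) l
  simp only [h2] at h1
  have h3 : ∑ k, ∑ k', F.Λ₁ z (s + m) k * F.Λ₁ z (s + m) k' *
      (if k ⟨s, by omega⟩ = k' ⟨s, by omega⟩ then 1 else 0) *
      (h (z (s + m) (k (Fin.last _))) * h (z (s + m) (k' (Fin.last _)))) =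
      (N : ℝ)⁻¹ ^ 2 * ∑ l, (∑ j, h (z (s + m) j) * F.backMat z s m j l) ^ 2 := by
    rw [← h1]
    simp only [Finset.mul_sum]
    refine Finset.sum_congr rfl fun k _ => Finset.sum_congr rfl fun k' _ => ?_
    rw [Λ₁_eq, Λ₁_eq]
    ring
  rw [h3]
  simp only [backSum, mul_pow, ← Finset.mul_sum]
  field_simp

/-- The part of the second moment due to pairs of index paths that meet at two given times. -/
lemma sum_sum_meet_twice (hg : F.PotentialsBounded) (hpos : F.DensitiesPositive) (hN : 0 < N)
    (z : ℕ → Fin N → X) (s n m : ℕ) :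
    N * (F.normConst z (s + n + m) ^ 2 * ∑ k, ∑ k', F.Λ₁ z (s + n + m) k * F.Λ₁ z (s + n + m) k' *
      ((if k ⟨s, by omega⟩ = k' ⟨s, by omega⟩ then 1 else 0) *
        if k ⟨s + n, by omega⟩ = k' ⟨s + n, by omega⟩ then 1 else 0)) =
    (N : ℝ)⁻¹ * ∑ i, F.backSum z (s + n) m (fun _ => 1) i ^ 2 * ∑ l, F.backMat z s n i l ^ 2 := by
  have hN' : (N : ℝ) ≠ 0 := Nat.cast_ne_zero.2 hN.ne'
  have h1 := sum_sum_ite_eq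
    (fun k : Fin (s + n + m + 1) → Fin N => (k ⟨s, by omega⟩, k ⟨s + n, by omega⟩))
    (fun k => F.pathWeight z (s + n + m) k * 1)
  rw [Fintype.sum_prod_type] at h1
  have h2 := fun l i => sum_pathWeight_at_at hg hpos hN z s n m (fun _ => 1) l i
  simp only [h2] at h1
  have h3 : ∑ k, ∑ k', F.Λ₁ z (s + n + m) k * F.Λ₁ z (s + n + m) k' *
      ((if k ⟨s, by omega⟩ = k' ⟨s, by omega⟩ then 1 else 0) *
        if k ⟨s + n, by omega⟩ = k' ⟨s + n, by omega⟩ then 1 else 0) =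
      (N : ℝ)⁻¹ ^ 2 * ∑ l, ∑ i, ((∑ j, 1 * F.backMat z (s + n) m j i) * F.backMat z s n i l) ^ 2 := by
    rw [← h1]
    simp only [Finset.mul_sum]
    refine Finset.sum_congr rfl fun k _ => Finset.sum_congr rfl fun k' _ => ?_
    rw [Λ₁_eq, Λ₁_eq]
    by_cases h4 : k ⟨s, by omega⟩ = k' ⟨s, by omega⟩ <;>
      by_cases h5 : k ⟨s + n, by omega⟩ = k' ⟨s + n, by omega⟩ <;> simp [h4, h5]
    ring
  rw [h3, Finset.sum_comm]
  simp only [backSum, mul_pow, ← Finset.mul_sum, mul_assoc]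
  field_simp

end FeynmanKac

end SMC

end

/-! ### Decomposition of the estimator by the number of meetings. -/

noncomputable section

namespace SMC

lemma sum_sum_comm {α β : Type*} [Fintype α] [Fintype β] (f : α → α → β → β → ℝ) :
    ∑ a, ∑ a', ∑ b, ∑ b', f a a' b b' = ∑ b, ∑ b', ∑ a, ∑ a', f a a' b b' := by
  rw [Finset.sum_congr rfl fun a _ => Finset.sum_comm, Finset.sum_comm]
  refine Finset.sum_congr rfl fun b _ => ?_
  rw [Finset.sum_congr rfl fun a _ => Finset.sum_comm, Finset.sum_comm]

namespace FeynmanKac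

variable {X : Type*} [MeasurableSpace X] (F : FeynmanKac X) {N : ℕ} {G : ℝ}

/-- The indicator that two index paths meet at time `s`. -/
def meet {t : ℕ} (k k' : Fin (t + 1) → Fin N) (s : Fin (t + 1)) : ℝ :=
  if k s = k' s then 1 else 0

/-- Twice the second factorial moment of the number of meeting times. -/
def meetTwice {t : ℕ} (k k' : Fin (t + 1) → Fin N) : ℝ :=
  ∑ s, ∑ s', if s ≠ s' then meet k k' s * meet k k' s' else 0

lemma coalescence_zero {t : ℕ} (k k' : Fin (t + 1) → Fin N) :
    coalescence (fun _ => 0) k k' = if ∀ s, k s ≠ k' s then 1 else 0 := by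
  have h1 : ¬ (0 : Fin 2) = 1 := by decide
  simp only [coalescence, h1, iff_false, Finset.prod_boole, Finset.mem_univ, true_implies, ne_eq]

/-- If the paths meet `n` times, the left side is zero for `n = 0` and `n - 1` otherwise, while the
right side is `n (n - 1)`. -/
lemma abs_one_sub_coalescence_sub_le {t : ℕ} (k k' : Fin (t + 1) → Fin N) :
    |1 - coalescence (fun _ => 0) k k' - ∑ s, meet k k' s| ≤ meetTwice k k' := by
  have h1 : ∑ s, meet k k' s = ((Finset.univ.filter fun s => k s = k' s).card : ℝ) := by
    simp [meet]
  have h2 : meetTwice k k' = (∑ s, meet k k' s) * (∑ s, meet k k' s) - ∑ s, meet k k' s := by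
    rw [Finset.sum_mul_sum, ← Finset.sum_sub_distrib]
    refine Finset.sum_congr rfl fun s _ => ?_
    have h3 : meet k k' s = ∑ s', if s = s' then meet k k' s * meet k k' s' else 0 := by
      simp [meet]
    rw [eq_sub_iff_add_eq]
    nth_rewrite 2 [h3]
    rw [← Finset.sum_add_distrib]
    refine Finset.sum_congr rfl fun s' _ => ?_
    by_cases h4 : s = s' <;> simp [h4]
  rw [h2, h1, coalescence_zero]
  set n := (Finset.univ.filter fun s => k s = k' s).card with hn
  by_cases h5 : ∀ s, k s ≠ k' s
  · have h6 : n = 0 := by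
      rw [hn, Finset.card_eq_zero, Finset.filter_eq_empty_iff]
      exact fun s _ => h5 s
    simp [h5, h6]
  · have h6 : 1 ≤ n := by
      push Not at h5
      obtain ⟨s, hs⟩ := h5
      exact Finset.card_pos.2 ⟨s, by simpa using hs⟩
    have h7 : (1 : ℝ) ≤ n := by exact_mod_cast h6
    rw [if_neg h5, sub_zero, abs_sub_comm, abs_of_nonneg (by linarith)]
    nlinarith

lemma Λ₁_nonneg (z : ℕ → Fin N → X) (t : ℕ) (k : Fin (t + 1) → Fin N) : 0 ≤ F.Λ₁ z t k :=
  mul_nonneg (by positivity) (F.pathWeight_nonneg z t k)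

lemma measurable_Λ₁ (t : ℕ) (k : Fin (t + 1) → Fin N) :
    Measurable fun z : ℕ → Fin N → X => F.Λ₁ z t k :=
  (Finset.measurable_prod _ fun _ _ => F.measurable_β _ _ _).const_mul _

/-- Disjoint paths never use the branch of `Λ₂` with the normalized weights, so under the
coalescence indicator the two paths may be treated as independent. -/
lemma Λ₂_eq_of_forall_ne (z : ℕ → Fin N → X) (t : ℕ) {k k' : Fin (t + 1) → Fin N}
    (h : ∀ s, k s ≠ k' s) : F.Λ₂ z t k k' = F.Λ₁ z t k' := by
  rw [Λ₂, Λ₁]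
  congr 1
  exact Finset.prod_congr rfl fun s _ => by rw [if_neg (h _).symm]

/-- The second moment of a function of the last indices of two independent backward paths, weighted
by a function of the paths. -/
def pairSum (z : ℕ → Fin N → X) (t : ℕ) (w : (Fin (t + 1) → Fin N) → (Fin (t + 1) → Fin N) → ℝ)
    (h : X → ℝ) : ℝ :=
  F.normConst z t ^ 2 * ∑ k, ∑ k', F.Λ₁ z t k * F.Λ₁ z t k' * w k k' *
    (h (z t (k (Fin.last t))) * h (z t (k' (Fin.last t))))

lemma measurable_pairSum (t : ℕ) (w : (Fin (t + 1) → Fin N) → (Fin (t + 1) → Fin N) → ℝ)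
    {h : X → ℝ} (hh : Measurable h) :
    Measurable fun z : ℕ → Fin N → X => F.pairSum z t w h :=
  ((F.measurable_normConst t).pow_const 2).mul (Finset.measurable_sum _ fun k _ =>
    Finset.measurable_sum _ fun k' _ =>
      (((F.measurable_Λ₁ t k).mul (F.measurable_Λ₁ t k')).mul_const _).mul
        ((hh.comp (measurable_eval t _)).mul (hh.comp (measurable_eval t _))))

lemma μBS_zero_eq (hN : 0 < N) (z : ℕ → Fin N → X) (t : ℕ) (h : X → ℝ) :
    F.μBS z t (fun _ => 0) (fun x x' => h (x (Fin.last t)) * h (x' (Fin.last t))) =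
      ((N : ℝ) / ((N : ℝ) - 1)) ^ (t + 1) * F.pairSum z t (coalescence fun _ => 0) h := by
  rw [μBS, γN_one F hN, pairSum, expectBS, mul_assoc]
  congr 1
  · simp [div_pow]
  · congr 1
    refine Finset.sum_congr rfl fun k _ => Finset.sum_congr rfl fun k' _ => ?_
    rw [coalescence_zero]
    by_cases h1 : ∀ s, k s ≠ k' s
    · rw [if_pos h1, Λ₂_eq_of_forall_ne F z t h1]
      simp only [Fin.val_last]
      ring
    · rw [if_neg h1]
      ring

/-- With `c` the power of `N / (N - 1)`, this is `γ² - c p = c (γ² - p) - (c - 1) γ²`. The first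
term carries the meetings and the second the centring by `γ_t(h)²`. -/
lemma varEstimator_eq (hN : 0 < N) (z : ℕ → Fin N → X) (t : ℕ) (h : X → ℝ) :
    F.varEstimator z t h =
      ((N : ℝ) / ((N : ℝ) - 1)) ^ (t + 1) *
          (N * (F.γN z t h * F.γN z t h - F.pairSum z t (coalescence fun _ => 0) h)) -
        N * (((N : ℝ) / ((N : ℝ) - 1)) ^ (t + 1) - 1) * (F.γN z t h * F.γN z t h) := by
  rw [varEstimator, μBS_zero_eq F hN]
  ring

variable {F}

lemma γN_mul_self_eq_pairSum (hg : F.PotentialsBounded) (hpos : F.DensitiesPositive) (hN : 0 < N)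
    (z : ℕ → Fin N → X) (t : ℕ) (h : X → ℝ) :
    F.γN z t h * F.γN z t h = F.pairSum z t (fun _ _ => 1) h := by
  have h1 : (N : ℝ)⁻¹ * ∑ i, h (z t i) = ∑ k, F.Λ₁ z t k * h (z t (k (Fin.last t))) := by
    rw [← sum_pathWeight hg hpos hN z t fun i => h (z t i), Finset.mul_sum]
    exact Finset.sum_congr rfl fun k _ => by rw [Λ₁_eq, mul_assoc]
  rw [γN_eq, h1, pairSum, mul_mul_mul_comm, ← sq, Finset.sum_mul_sum]
  congr 1
  exact Finset.sum_congr rfl fun k _ => Finset.sum_congr rfl fun k' _ => by ring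

/-- The Bonferroni bound holds for each pair of paths and is summed against the nonnegative weights
`Λ₁ Λ₁`. In the remainder `h` enters only through its bound, so double meetings need to be treated
only for the constant function. -/
lemma abs_mul_sub_pairSum_le (hg : F.PotentialsBounded) (hpos : F.DensitiesPositive) (hN : 0 < N)
    (z : ℕ → Fin N → X) (t : ℕ) {h : X → ℝ} {C : ℝ} (hC : ∀ x, |h x| ≤ C) :
    |N * (F.γN z t h * F.γN z t h - F.pairSum z t (coalescence fun _ => 0) h) -
        ∑ s, N * F.pairSum z t (fun k k' => meet k k' s) h| ≤
      C ^ 2 * (∑ s, ∑ s', if s ≠ s' then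
        N * F.pairSum z t (fun k k' => meet k k' s * meet k k' s') (fun _ => 1) else 0) := by
  have h1 : N * (F.γN z t h * F.γN z t h - F.pairSum z t (coalescence fun _ => 0) h) -
        ∑ s, N * F.pairSum z t (fun k k' => meet k k' s) h =
      N * F.pairSum z t (fun k k' => 1 - coalescence (fun _ => 0) k k' - ∑ s, meet k k' s) h := by
    rw [γN_mul_self_eq_pairSum hg hpos hN]
    simp only [pairSum, ← Finset.mul_sum]
    rw [← mul_sub, ← mul_sub, ← mul_sub]
    congr 2
    rw [Finset.sum_comm (s := (Finset.univ : Finset (Fin (t + 1)))),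
      ← Finset.sum_sub_distrib, ← Finset.sum_sub_distrib]
    refine Finset.sum_congr rfl fun k _ => ?_
    rw [Finset.sum_comm (s := (Finset.univ : Finset (Fin (t + 1)))),
      ← Finset.sum_sub_distrib, ← Finset.sum_sub_distrib]
    refine Finset.sum_congr rfl fun k' _ => ?_
    rw [← Finset.sum_mul, ← Finset.mul_sum]
    ring
  have h2 : (∑ s, ∑ s', if s ≠ s' then
        N * F.pairSum z t (fun k k' => meet k k' s * meet k k' s') (fun _ => 1) else 0) =
      N * (F.normConst z t ^ 2 * ∑ k, ∑ k', F.Λ₁ z t k * F.Λ₁ z t k' * meetTwice k k') := by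
    have h3 : ∀ s s' : Fin (t + 1), (if s ≠ s' then
        N * F.pairSum z t (fun k k' => meet k k' s * meet k k' s') (fun _ => 1) else 0) =
        N * (F.normConst z t ^ 2 * ∑ k, ∑ k', F.Λ₁ z t k * F.Λ₁ z t k' *
          if s ≠ s' then meet k k' s * meet k k' s' else 0) := fun s s' => by
      by_cases h4 : s = s' <;> simp [h4, pairSum]
    simp only [h3, ← Finset.mul_sum]
    congr 2
    simp only [meetTwice, Finset.mul_sum]
    exact sum_sum_comm _
  rw [h1, h2, pairSum, abs_mul, abs_mul, Nat.abs_cast, abs_of_nonneg (sq_nonneg _),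
    mul_left_comm (C ^ 2), mul_left_comm (C ^ 2)]
  refine mul_le_mul_of_nonneg_left (mul_le_mul_of_nonneg_left ?_ (sq_nonneg _)) (Nat.cast_nonneg _)
  rw [Finset.mul_sum]
  refine (Finset.abs_sum_le_sum_abs _ _).trans (Finset.sum_le_sum fun k _ => ?_)
  rw [Finset.mul_sum]
  refine (Finset.abs_sum_le_sum_abs _ _).trans (Finset.sum_le_sum fun k' _ => ?_)
  have hΛ := mul_nonneg (F.Λ₁_nonneg z t k) (F.Λ₁_nonneg z t k')
  have hm := abs_one_sub_coalescence_sub_le k k'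
  have hhh : |h (z t (k (Fin.last t))) * h (z t (k' (Fin.last t)))| ≤ C * C := by
    rw [abs_mul]
    exact mul_le_mul (hC _) (hC _) (abs_nonneg _) ((abs_nonneg _).trans (hC (z t (k (Fin.last t)))))
  rw [abs_mul, abs_mul, abs_of_nonneg hΛ]
  calc _ ≤ F.Λ₁ z t k * F.Λ₁ z t k' * meetTwice k k' * (C * C) :=
        mul_le_mul (mul_le_mul_of_nonneg_left hm hΛ) hhh (abs_nonneg _)
          (mul_nonneg hΛ ((abs_nonneg _).trans hm))
    _ = _ := by ring

lemma mul_pairSum_meet (hg : F.PotentialsBounded) (hpos : F.DensitiesPositive) (hN : 0 < N)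
    (z : ℕ → Fin N → X) (s m : ℕ) (h : X → ℝ) :
    N * F.pairSum z (s + m) (fun k k' => meet k k' ⟨s, by omega⟩) h =
      (N : ℝ)⁻¹ * ∑ l, F.backSum z s m h l ^ 2 :=
  sum_sum_meet hg hpos hN z s m h

lemma mul_pairSum_meet_twice (hg : F.PotentialsBounded) (hpos : F.DensitiesPositive) (hN : 0 < N)
    (z : ℕ → Fin N → X) (s n m : ℕ) :
    N * F.pairSum z (s + n + m)
        (fun k k' => meet k k' ⟨s, by omega⟩ * meet k k' ⟨s + n, by omega⟩) (fun _ => 1) =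
      (N : ℝ)⁻¹ * ∑ i, F.backSum z (s + n) m (fun _ => 1) i ^ 2 *
        ∑ l, F.backMat z s n i l ^ 2 := by
  rw [← sum_sum_meet_twice hg hpos hN]
  simp only [pairSum, meet, mul_one]

/-- Two meetings are negligible. -/
lemma mul_pairSum_meet_twice_le (hG0 : 0 < G) (hG : ∀ t x, 0 < F.g t x ∧ F.g t x ≤ G)
    (hpos : F.DensitiesPositive) (hN : 0 < N) (z : ℕ → Fin N → X) (s n m : ℕ) :
    N * F.pairSum z (s + n + m)
        (fun k k' => meet k k' ⟨s, by omega⟩ * meet k k' ⟨s + n, by omega⟩) (fun _ => 1) ≤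
      2 * F.backErr z (s + n) m (fun _ => 1) +
        2 * (G ^ (s + n) * (G ^ m) ^ 2) * (F.normConst z (s + n) * F.coal z s n) := by
  have hg : F.PotentialsBounded := ⟨G, hG0, hG⟩
  rw [mul_pairSum_meet_twice hg hpos hN, backErr, coal]
  have h1 : 2 * ((N : ℝ)⁻¹ * ∑ l, (F.backSum z (s + n) m (fun _ => 1) l -
        F.normConst z (s + n) * F.opQs (s + n) m (fun _ => 1) (z (s + n) l)) ^ 2) +
      2 * (G ^ (s + n) * (G ^ m) ^ 2) * (F.normConst z (s + n) *
        ((N : ℝ)⁻¹ * ∑ k, ∑ l, F.backMat z s n k l ^ 2)) =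
      (N : ℝ)⁻¹ * ∑ i, (2 * (F.backSum z (s + n) m (fun _ => 1) i -
        F.normConst z (s + n) * F.opQs (s + n) m (fun _ => 1) (z (s + n) i)) ^ 2 +
        2 * (G ^ (s + n) * (G ^ m) ^ 2) * F.normConst z (s + n) *
          ∑ l, F.backMat z s n i l ^ 2) := by
    rw [Finset.sum_add_distrib, ← Finset.mul_sum, ← Finset.mul_sum]
    ring
  rw [h1]
  refine mul_le_mul_of_nonneg_left (Finset.sum_le_sum fun i _ => ?_) (by positivity)
  set u := F.backSum z (s + n) m (fun _ => 1) i
  set b := F.normConst z (s + n) * F.opQs (s + n) m (fun _ => 1) (z (s + n) i) with hb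
  set T := ∑ l, F.backMat z s n i l ^ 2
  have hT0 : 0 ≤ T := Finset.sum_nonneg fun _ _ => sq_nonneg _
  have hT1 : T ≤ 1 := sum_backMat_sq_le_one hg hpos hN z s n i
  have hc0 := F.normConst_nonneg z (s + n)
  have hc1 := normConst_le hG0 hG z (s + n)
  -- One factor `normConst` is retained, to be paired with the collision probability.
  have hb2 : b ^ 2 ≤ G ^ (s + n) * (G ^ m) ^ 2 * F.normConst z (s + n) := by
    have hq := abs_opQs_le hG (s + n) m (h := fun _ => 1) (C := 1) (by simp) (z (s + n) i)
    rw [mul_one] at hq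
    have hq2 := sq_le_sq' (neg_le_of_abs_le hq) (le_of_abs_le hq)
    calc b ^ 2 = F.normConst z (s + n) * F.normConst z (s + n) *
          F.opQs (s + n) m (fun _ => 1) (z (s + n) i) ^ 2 := by rw [hb]; ring
      _ ≤ G ^ (s + n) * F.normConst z (s + n) * (G ^ m) ^ 2 := by gcongr
      _ = _ := by ring
  -- `abs_backSum_le` bounds `u` only by a multiple of `N`, so `u` is compared with `b`. The
  -- deviation is multiplied by `T ≤ 1` and goes into `backErr`; the bounded part keeps `T` and goes
  -- into `coal`.
  have hu2 : u ^ 2 ≤ 2 * (u - b) ^ 2 + 2 * b ^ 2 := by nlinarith [sq_nonneg (u - 2 * b)]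
  calc u ^ 2 * T ≤ (2 * (u - b) ^ 2 + 2 * b ^ 2) * T := mul_le_mul_of_nonneg_right hu2 hT0
    _ = 2 * (u - b) ^ 2 * T + 2 * b ^ 2 * T := by ring
    _ ≤ 2 * (u - b) ^ 2 * 1 + 2 * (G ^ (s + n) * (G ^ m) ^ 2 * F.normConst z (s + n)) * T := by
        gcongr
    _ = _ := by ring

lemma pairSum_nonneg (z : ℕ → Fin N → X) (t : ℕ)
    {w : (Fin (t + 1) → Fin N) → (Fin (t + 1) → Fin N) → ℝ} (hw : ∀ k k', 0 ≤ w k k') :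
    0 ≤ F.pairSum z t w (fun _ => 1) :=
  mul_nonneg (sq_nonneg _) (Finset.sum_nonneg fun k _ => Finset.sum_nonneg fun k' _ =>
    mul_nonneg (mul_nonneg (mul_nonneg (F.Λ₁_nonneg z t k) (F.Λ₁_nonneg z t k')) (hw k k'))
      (by norm_num))

lemma meet_nonneg {t : ℕ} (k k' : Fin (t + 1) → Fin N) (s : Fin (t + 1)) : 0 ≤ meet k k' s := by
  rw [meet]; split_ifs <;> norm_num

end FeynmanKac

end SMC

end

/-! ### Convergence in mean to a constant. -/

noncomputable section

namespace SMC

section TendstoL1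

variable {Ω : Type*} [MeasurableSpace Ω] {P : Measure Ω}

/-- Convergence in mean to a constant. -/
def TendstoL1 (P : Measure Ω) (Y : ℕ → Ω → ℝ) (y : ℝ) : Prop :=
  (∀ᶠ N in atTop, Integrable (Y N) P) ∧ Tendsto (fun N => ∫ ω, |Y N ω - y| ∂P) atTop (nhds 0)

lemma TendstoL1.of_dist [IsProbabilityMeasure P] {Y Y' : ℕ → Ω → ℝ} {y : ℝ} (hY : TendstoL1 P Y y)
    (hi : ∀ᶠ N in atTop, Integrable (Y' N) P)
    (hd : Tendsto (fun N => ∫ ω, |Y' N ω - Y N ω| ∂P) atTop (nhds 0)) : TendstoL1 P Y' y := by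
  refine ⟨hi, squeeze_zero' (Eventually.of_forall fun N => integral_nonneg fun ω => abs_nonneg _)
    ?_ (by simpa using hd.add hY.2)⟩
  filter_upwards [hi, hY.1] with N h1 h2
  have hi1 : Integrable (fun ω => |Y' N ω - Y N ω|) P := (h1.sub h2).abs
  have hi2 : Integrable (fun ω => |Y N ω - y|) P := (h2.sub (integrable_const y)).abs
  rw [← integral_add hi1 hi2]
  exact integral_mono (h1.sub (integrable_const y)).abs (hi1.add hi2) fun ω => abs_sub_le _ _ _

lemma TendstoL1.congr {Y Y' : ℕ → Ω → ℝ} {y : ℝ} (hY : TendstoL1 P Y y)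
    (h : ∀ᶠ N in atTop, ∀ ω, Y' N ω = Y N ω) : TendstoL1 P Y' y := by
  refine ⟨?_, hY.2.congr' ?_⟩
  · filter_upwards [h, hY.1] with N h1 h2
    exact h2.congr (ae_of_all _ fun ω => (h1 ω).symm)
  · filter_upwards [h] with N h1
    simp only [h1]

lemma TendstoL1.add [IsProbabilityMeasure P] {Y Y' : ℕ → Ω → ℝ} {y y' : ℝ} (hY : TendstoL1 P Y y)
    (hY' : TendstoL1 P Y' y') : TendstoL1 P (fun N ω => Y N ω + Y' N ω) (y + y') := by
  refine ⟨by filter_upwards [hY.1, hY'.1] with N h1 h2 using h1.add h2,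
    squeeze_zero' (Eventually.of_forall fun N => integral_nonneg fun ω => abs_nonneg _)
    ?_ (by simpa using hY.2.add hY'.2)⟩
  filter_upwards [hY.1, hY'.1] with N h1 h2
  have hi1 : Integrable (fun ω => |Y N ω - y|) P := (h1.sub (integrable_const y)).abs
  have hi2 : Integrable (fun ω => |Y' N ω - y'|) P := (h2.sub (integrable_const y')).abs
  rw [← integral_add hi1 hi2]
  refine integral_mono ((h1.add h2).sub (integrable_const _)).abs (hi1.add hi2) fun ω => ?_
  change |Y N ω + Y' N ω - (y + y')| ≤ |Y N ω - y| + |Y' N ω - y'|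
  rw [add_sub_add_comm]
  exact abs_add_le _ _

lemma TendstoL1.zero : TendstoL1 P (fun _ _ => 0) 0 :=
  ⟨Eventually.of_forall fun _ => integrable_zero _ _ _, by simp⟩

lemma TendstoL1.sum [IsProbabilityMeasure P] {ι : Type*} (I : Finset ι) {Y : ι → ℕ → Ω → ℝ} {y : ι → ℝ}
    (hY : ∀ i ∈ I, TendstoL1 P (Y i) (y i)) :
    TendstoL1 P (fun N ω => ∑ i ∈ I, Y i N ω) (∑ i ∈ I, y i) := by
  classical
  induction I using Finset.induction_on with
  | empty => simpa using TendstoL1.zero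
  | insert i I hi ih =>
    simp only [Finset.sum_insert hi]
    exact (hY i (Finset.mem_insert_self i I)).add
      (ih fun j hj => hY j (Finset.mem_insert_of_mem hj))

lemma TendstoL1.seq_mul [IsProbabilityMeasure P] {Y : ℕ → Ω → ℝ} {y : ℝ} (hY : TendstoL1 P Y y) {a : ℕ → ℝ} {b : ℝ}
    (ha : Tendsto a atTop (nhds b)) : TendstoL1 P (fun N ω => a N * Y N ω) (b * y) := by
  have h0 : Tendsto (fun N => |a N| * ∫ ω, |Y N ω - y| ∂P + |a N - b| * |y|) atTop (nhds 0) := by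
    have h1 := (ha.abs.mul hY.2).add (((ha.sub_const b).abs).mul_const |y|)
    simpa using h1
  refine ⟨by filter_upwards [hY.1] with N h1 using h1.const_mul _,
    squeeze_zero' (Eventually.of_forall fun N => integral_nonneg fun ω => abs_nonneg _) ?_ h0⟩
  filter_upwards [hY.1] with N h1
  have hi1 : Integrable (fun ω => |a N| * |Y N ω - y|) P :=
    (h1.sub (integrable_const y)).abs.const_mul _
  have hi2 : Integrable (fun ω => |a N| * |Y N ω - y| + |a N - b| * |y|) P :=
    hi1.add (integrable_const _)
  have h2 : ∫ ω, (|a N| * |Y N ω - y| + |a N - b| * |y|) ∂P =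
      |a N| * ∫ ω, |Y N ω - y| ∂P + |a N - b| * |y| := by
    rw [integral_add hi1 (integrable_const _), integral_const_mul]
    simp
  rw [← h2]
  refine integral_mono ((h1.const_mul (a N)).sub (integrable_const _)).abs hi2 fun ω => ?_
  change |a N * Y N ω - b * y| ≤ |a N| * |Y N ω - y| + |a N - b| * |y|
  rw [← abs_mul, ← abs_mul]
  refine le_trans (le_of_eq ?_) (abs_add_le _ _)
  congr 1
  ring

lemma TendstoL1.tendstoInMeasure [IsProbabilityMeasure P] {Y : ℕ → Ω → ℝ} {y : ℝ} (hY : TendstoL1 P Y y) :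
    TendstoInMeasure P Y atTop (fun _ => y) := by
  rw [tendstoInMeasure_iff_measureReal_dist]
  intro ε hε
  have h0 : Tendsto (fun N => ε⁻¹ * ∫ ω, |Y N ω - y| ∂P) atTop (nhds 0) := by
    simpa using hY.2.const_mul ε⁻¹
  refine squeeze_zero' (Eventually.of_forall fun N => measureReal_nonneg) ?_ h0
  filter_upwards [hY.1] with N h1
  have h2 := mul_meas_ge_le_integral_of_nonneg (μ := P) (f := fun ω => |Y N ω - y|)
    (ae_of_all _ fun ω => abs_nonneg _) (h1.sub (integrable_const y)).abs ε
  rw [← div_eq_inv_mul, le_div_iff₀ hε, mul_comm]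
  exact h2

end TendstoL1

/-! ### Limits of the contributions of single and double meetings. -/

section Filter

variable {X Ω : Type*} [MeasurableSpace X] [MeasurableSpace Ω] {F : FeynmanKac X} {P : Measure Ω}
  [IsProbabilityMeasure P] {G : ℝ} {ξ : (N : ℕ) → ℕ → Fin N → Ω → X}
  {A : (N : ℕ) → ℕ → Fin N → Ω → Fin N}

/-- One factor is bounded uniformly in `N` and the other converges in mean. The pair `1`, `Q[h]²`
serves the single meetings, the pair `h`, `h` the centring. -/
lemma tendstoL1_γN_mul_γN (hG0 : 0 < G) (hG : ∀ t x, 0 < F.g t x ∧ F.g t x ≤ G)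
    (hξ : ∀ N, 0 < N → IsBootstrapFilter F P (ξ N) (A N)) (t : ℕ) {f f' : X → ℝ}
    (hf : Measurable f) {C : ℝ} (hC : ∀ x, |f x| ≤ C) (hf' : Measurable f') {C' : ℝ}
    (hC' : ∀ x, |f' x| ≤ C') :
    TendstoL1 P (fun N ω => F.γN (path (ξ N) ω) t f * F.γN (path (ξ N) ω) t f')
      ((∫ x, f x ∂(F.γ t)) * ∫ x, f' x ∂(F.γ t)) := by
  have hb : ∀ N ω, |F.γN (path (ξ N) ω) t f| ≤ G ^ t * |C| := fun N ω =>
    FeynmanKac.abs_γN_le hG0 hG _ t (abs_nonneg _) fun x => (hC x).trans (le_abs_self _)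
  have hb' : ∀ N ω, |F.γN (path (ξ N) ω) t f'| ≤ G ^ t * |C'| := fun N ω =>
    FeynmanKac.abs_γN_le hG0 hG _ t (abs_nonneg _) fun x => (hC' x).trans (le_abs_self _)
  have hm : ∀ N, 0 < N → Measurable fun ω => F.γN (path (ξ N) ω) t f := fun N hN =>
    (F.measurable_γN t hf).comp (hξ N hN).measurable_path
  have hm' : ∀ N, 0 < N → Measurable fun ω => F.γN (path (ξ N) ω) t f' := fun N hN =>
    (F.measurable_γN t hf').comp (hξ N hN).measurable_path
  have hi : ∀ N : ℕ, 0 < N → Integrable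
      (fun ω => F.γN (path (ξ N) ω) t f * F.γN (path (ξ N) ω) t f') P := fun N hN =>
    integrable_of_abs_le ((hm N hN).mul (hm' N hN)) fun ω => by
      rw [abs_mul]
      exact mul_le_mul (hb N ω) (hb' N ω) (abs_nonneg _) (by positivity)
  set c := ∫ x, f x ∂(F.γ t)
  set c' := ∫ x, f' x ∂(F.γ t)
  have h0 : Tendsto (fun N => G ^ t * |C| * ∫ ω, |F.γN (path (ξ N) ω) t f' - c'| ∂P +
      |c'| * ∫ ω, |F.γN (path (ξ N) ω) t f - c| ∂P) atTop (nhds 0) := by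
    have h1 := ((tendsto_integral_abs_γN_sub hG0 hG hξ t hf' hC').const_mul (G ^ t * |C|)).add
      ((tendsto_integral_abs_γN_sub hG0 hG hξ t hf hC).const_mul |c'|)
    simpa using h1
  clear_value c c'
  refine ⟨by filter_upwards [eventually_gt_atTop 0] with N hN using hi N hN,
    squeeze_zero' (Eventually.of_forall fun N => integral_nonneg fun ω => abs_nonneg _) ?_ h0⟩
  filter_upwards [eventually_gt_atTop 0] with N hN
  have hi1 : Integrable (fun ω => G ^ t * |C| * |F.γN (path (ξ N) ω) t f' - c'|) P :=
    ((integrable_of_abs_le (hm' N hN) (hb' N)).sub (integrable_const c')).abs.const_mul _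
  have hi2 : Integrable (fun ω => |c'| * |F.γN (path (ξ N) ω) t f - c|) P :=
    ((integrable_of_abs_le (hm N hN) (hb N)).sub (integrable_const c)).abs.const_mul _
  rw [← integral_const_mul, ← integral_const_mul, ← integral_add hi1 hi2]
  refine integral_mono ((hi N hN).sub (integrable_const _)).abs (hi1.add hi2) fun ω => ?_
  change |F.γN (path (ξ N) ω) t f * F.γN (path (ξ N) ω) t f' - c * c'| ≤
    G ^ t * |C| * |F.γN (path (ξ N) ω) t f' - c'| + |c'| * |F.γN (path (ξ N) ω) t f - c|
  have h1 : F.γN (path (ξ N) ω) t f * F.γN (path (ξ N) ω) t f' - c * c' =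
      F.γN (path (ξ N) ω) t f * (F.γN (path (ξ N) ω) t f' - c') +
        c' * (F.γN (path (ξ N) ω) t f - c) := by ring
  rw [h1]
  refine (abs_add_le _ _).trans ?_
  rw [abs_mul, abs_mul]
  exact add_le_add (mul_le_mul_of_nonneg_right (hb N ω) (abs_nonneg _)) le_rfl

/-- Only `b` is assumed bounded: `u` will be the backward sum, for which no bound uniform in `N` is
at hand. -/
lemma abs_mean_sq_sub_le {N : ℕ} (u b : Fin N → ℝ) {K : ℝ} (hb : ∀ l, |b l| ≤ K) :
    |(N : ℝ)⁻¹ * ∑ l, u l ^ 2 - (N : ℝ)⁻¹ * ∑ l, b l ^ 2| ≤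
      (N : ℝ)⁻¹ * ∑ l, (u l - b l) ^ 2 + 2 * K * ((N : ℝ)⁻¹ * ∑ l, |u l - b l|) := by
  have h1 : (N : ℝ)⁻¹ * ∑ l, (u l - b l) ^ 2 + 2 * K * ((N : ℝ)⁻¹ * ∑ l, |u l - b l|) =
      (N : ℝ)⁻¹ * ∑ l, ((u l - b l) ^ 2 + 2 * K * |u l - b l|) := by
    rw [Finset.sum_add_distrib, ← Finset.mul_sum]; ring
  rw [h1, ← mul_sub, ← Finset.sum_sub_distrib, abs_mul, abs_of_nonneg (by positivity : (0 : ℝ) ≤ (N : ℝ)⁻¹)]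
  refine mul_le_mul_of_nonneg_left ((Finset.abs_sum_le_sum_abs _ _).trans
    (Finset.sum_le_sum fun l _ => ?_)) (by positivity)
  have h2 : u l ^ 2 - b l ^ 2 = (u l - b l) ^ 2 + 2 * b l * (u l - b l) := by ring
  rw [h2]
  refine (abs_add_le _ _).trans (add_le_add (abs_of_nonneg (sq_nonneg _)).le ?_)
  rw [abs_mul, abs_mul, abs_two]
  have := hb l
  gcongr

lemma sq_mean_abs_le {N : ℕ} (hN : 0 < N) (x : Fin N → ℝ) :
    ((N : ℝ)⁻¹ * ∑ l, |x l|) ^ 2 ≤ (N : ℝ)⁻¹ * ∑ l, x l ^ 2 := by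
  have hN' : (N : ℝ) ≠ 0 := Nat.cast_ne_zero.2 hN.ne'
  have h1 := Real.pow_arith_mean_le_arith_mean_pow_of_even Finset.univ (fun _ : Fin N => (N : ℝ)⁻¹)
    (fun l => |x l|) (fun _ _ => by positivity) (by simp [hN']) even_two
  simpa only [← Finset.mul_sum, sq_abs] using h1

/-- The rescaled part of the second moment due to the pairs of backward paths that meet at
time `s`. -/
lemma tendstoL1_backSum_sq (hG0 : 0 < G) (hG : ∀ t x, 0 < F.g t x ∧ F.g t x ≤ G)
    (hpos : F.DensitiesPositive) {σ : ℝ} (hσ0 : 0 < σ) (hσ : ∀ t x y, F.m t x y ≤ σ)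
    (hξ : ∀ N, 0 < N → IsBootstrapFilter F P (ξ N) (A N)) (s n : ℕ)
    {h : X → ℝ} (hh : Measurable h) {C : ℝ} (hC0 : 0 ≤ C) (hC : ∀ x, |h x| ≤ C) :
    TendstoL1 P (fun N ω => (N : ℝ)⁻¹ * ∑ l, F.backSum (path (ξ N) ω) s n h l ^ 2)
      ((F.γ s).real Set.univ * ∫ x, F.opQs s n h x ^ 2 ∂(F.γ s)) := by
  have hqm := F.measurable_opQs s n hh
  have hqb := FeynmanKac.abs_opQs_le hG s n hC
  have hq2 : ∀ x, |F.opQs s n h x ^ 2| ≤ (G ^ n * C) ^ 2 := fun x => by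
    rw [abs_of_nonneg (sq_nonneg _)]
    exact sq_le_sq' (neg_le_of_abs_le (hqb x)) (le_of_abs_le (hqb x))
  -- With the backward sums replaced by their approximations, the mean of squares is exactly
  -- `γ_s^N(1) γ_s^N(Q[h]²)`.
  have h1 := tendstoL1_γN_mul_γN hG0 hG hξ s (f := fun _ => 1) measurable_const (C := 1)
    (by simp) (hqm.pow_const 2) hq2
  have h2 : ∫ _x, (1 : ℝ) ∂(F.γ s) = (F.γ s).real Set.univ := by simp
  rw [h2] at h1
  have hlim : TendstoL1 P (fun N ω => (N : ℝ)⁻¹ * ∑ l : Fin N,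
      (F.normConst (path (ξ N) ω) s * F.opQs s n h (path (ξ N) ω s l)) ^ 2)
      ((F.γ s).real Set.univ * ∫ x, F.opQs s n h x ^ 2 ∂(F.γ s)) := by
    refine h1.congr ?_
    filter_upwards [eventually_gt_atTop 0] with N hN ω
    rw [F.γN_one hN, FeynmanKac.γN_eq]
    simp only [mul_pow, ← Finset.mul_sum]
    ring
  have hui : ∀ N : ℕ, 0 < N → Integrable (fun ω =>
      (N : ℝ)⁻¹ * ∑ l, F.backSum (path (ξ N) ω) s n h l ^ 2) P := fun N hN =>
    (integrable_finsetSum _ fun l _ => integrable_of_abs_le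
      (((F.measurable_backSum s n hh l).pow_const 2).comp (hξ N hN).measurable_path)
      (C := (G ^ (s + n) * (N * C)) ^ 2) fun ω => by
        have h3 := FeynmanKac.abs_backSum_le hG0 hG hpos hN (path (ξ N) ω) s n hC l
        change |F.backSum (path (ξ N) ω) s n h l ^ 2| ≤ _
        rw [abs_of_nonneg (sq_nonneg _)]
        exact sq_le_sq' (neg_le_of_abs_le h3) (le_of_abs_le h3)).const_mul _
  obtain ⟨D, hD⟩ : ∃ D : (N : ℕ) → Fin N → (ℕ → Fin N → X) → ℝ, D = fun N l z =>
    F.backSum z s n h l - F.normConst z s * F.opQs s n h (z s l) := ⟨_, rfl⟩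
  have hDm : ∀ N l, Measurable (D N l) := fun N l => by
    rw [hD]
    exact (F.measurable_backSum s n hh l).sub ((F.measurable_normConst s).mul
      (hqm.comp (FeynmanKac.measurable_eval s l)))
  have hDb : ∀ N : ℕ, 0 < N → ∀ l z, |D N l z| ≤ G ^ (s + n) * (N * C) + G ^ s * (G ^ n * C) :=
    fun N hN l z => by
      rw [hD]; exact FeynmanKac.abs_backSum_sub_le hG0 hG hpos hN z s n hC l
  have hem : ∀ N : ℕ, Measurable fun z : ℕ → Fin N → X => (N : ℝ)⁻¹ * ∑ l, |D N l z| := fun N =>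
    (Finset.measurable_sum _ fun l _ => (hDm N l).abs).const_mul _
  have heb : ∀ N : ℕ, 0 < N → ∀ z, |((N : ℝ)⁻¹ * ∑ l, |D N l z|)| ≤
      (N : ℝ)⁻¹ * ∑ _l : Fin N, (G ^ (s + n) * (N * C) + G ^ s * (G ^ n * C)) := fun N hN z => by
    rw [abs_of_nonneg (mul_nonneg (by positivity) (Finset.sum_nonneg fun _ _ => abs_nonneg _))]
    exact mul_le_mul_of_nonneg_left (Finset.sum_le_sum fun l _ => hDb N hN l z) (by positivity)
  have herr : Tendsto (fun N => ∫ ω, F.backErr (path (ξ N) ω) s n h ∂P) atTop (nhds 0) :=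
    tendsto_integral_backErr hG0 hG hpos hσ0 hσ hξ s n hh hC
  -- Two Cauchy-Schwarz inequalities, over `ω` and over the particle index, bound the squared mean
  -- error by the mean of `backErr`.
  have he : Tendsto (fun N : ℕ => ∫ ω, |((N : ℝ)⁻¹ * ∑ l, |D N l (path (ξ N) ω)|)| ∂P) atTop
      (nhds 0) := by
    refine tendsto_of_sq_le (fun N => integral_nonneg fun ω => abs_nonneg _) ?_ herr
    filter_upwards [eventually_gt_atTop 0] with N hN
    have hmeas := (hem N).comp (hξ N hN).measurable_path
    refine (sq_integral_abs_le hmeas fun ω => heb N hN (path (ξ N) ω)).trans ?_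
    refine integral_mono (integrable_of_abs_le (hmeas.pow_const 2)
      (C := ((N : ℝ)⁻¹ * ∑ _l : Fin N, (G ^ (s + n) * (N * C) + G ^ s * (G ^ n * C))) ^ 2)
      fun ω => ?_) (integrable_backErr hG0 hG hpos hN (hξ N hN) s n hh hC) fun ω => ?_
    · have h3 := heb N hN (path (ξ N) ω)
      rw [abs_of_nonneg (sq_nonneg _)]
      exact sq_le_sq' (neg_le_of_abs_le h3) (le_of_abs_le h3)
    · have h3 := sq_mean_abs_le hN fun l => D N l (path (ξ N) ω)
      rw [FeynmanKac.backErr]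
      simp only [hD] at h3 ⊢
      exact h3
  refine hlim.of_dist (by filter_upwards [eventually_gt_atTop 0] with N hN using hui N hN) ?_
  have h0 : Tendsto (fun N : ℕ => ∫ ω, F.backErr (path (ξ N) ω) s n h ∂P +
      2 * (G ^ s * (G ^ n * C)) * ∫ ω, |((N : ℝ)⁻¹ * ∑ l, |D N l (path (ξ N) ω)|)| ∂P) atTop
      (nhds 0) := by
    simpa using herr.add (he.const_mul (2 * (G ^ s * (G ^ n * C))))
  refine squeeze_zero' (Eventually.of_forall fun N => integral_nonneg fun ω => abs_nonneg _) ?_ h0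
  filter_upwards [eventually_gt_atTop 0, hlim.1] with N hN hbi
  have hi1 := integrable_backErr hG0 hG hpos hN (hξ N hN) s n hh hC
  have hi2 : Integrable (fun ω => |((N : ℝ)⁻¹ * ∑ l, |D N l (path (ξ N) ω)|)|) P :=
    (integrable_of_abs_le ((hem N).comp (hξ N hN).measurable_path) fun ω => heb N hN _).abs
  rw [← integral_const_mul, ← integral_add hi1 (hi2.const_mul _)]
  refine integral_mono ((hui N hN).sub hbi).abs (hi1.add (hi2.const_mul _)) fun ω => ?_
  have h3 := abs_mean_sq_sub_le (fun l => F.backSum (path (ξ N) ω) s n h l)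
    (fun l => F.normConst (path (ξ N) ω) s * F.opQs s n h (path (ξ N) ω s l))
    (K := G ^ s * (G ^ n * C)) fun l => by
      rw [abs_mul, abs_of_nonneg (F.normConst_nonneg _ s)]
      exact mul_le_mul (FeynmanKac.normConst_le hG0 hG _ s) (hqb _) (abs_nonneg _) (by positivity)
  refine h3.trans ?_
  refine add_le_add le_rfl (mul_le_mul_of_nonneg_left ?_ (by positivity))
  rw [hD]
  exact le_abs_self _

/-- Pairs of backward paths that meet twice do not contribute to the limit. -/
lemma tendstoL1_pairSum_meet_twice (hG0 : 0 < G) (hG : ∀ t x, 0 < F.g t x ∧ F.g t x ≤ G)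
    (hpos : F.DensitiesPositive) {σ : ℝ} (hσ0 : 0 < σ) (hσ : ∀ t x y, F.m t x y ≤ σ)
    (hξ : ∀ N, 0 < N → IsBootstrapFilter F P (ξ N) (A N)) (t : ℕ) {s s' : Fin (t + 1)}
    (hss : s < s') :
    TendstoL1 P (fun N ω => N * F.pairSum (path (ξ N) ω) t
      (fun k k' => FeynmanKac.meet k k' s * FeynmanKac.meet k k' s') (fun _ => 1)) 0 := by
  obtain ⟨s, hs⟩ := s
  obtain ⟨s', hs'⟩ := s'
  -- Distinct meeting times make the lag positive, as the decay of `coal` requires.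
  obtain ⟨n, rfl⟩ : ∃ n, s' = s + (n + 1) := Nat.exists_eq_add_of_lt hss
  obtain ⟨m, rfl⟩ : ∃ m, t = s + (n + 1) + m := Nat.exists_eq_add_of_le (Nat.lt_succ_iff.1 hs')
  have h1 : Tendsto (fun N : ℕ => 2 * ∫ ω, F.backErr (path (ξ N) ω) (s + (n + 1)) m (fun _ => 1) ∂P +
      2 * (G ^ (s + (n + 1)) * (G ^ m) ^ 2) * ∫ ω, F.normConst (path (ξ N) ω) (s + (n + 1)) *
        F.coal (path (ξ N) ω) s (n + 1) ∂P) atTop (nhds 0) := by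
    have h2 := ((tendsto_integral_backErr hG0 hG hpos hσ0 hσ hξ (s + (n + 1)) m
      (h := fun _ => 1) (C := 1) measurable_const (by simp)).const_mul 2).add
      ((tendsto_integral_coal hG0 hG hpos hσ0 hσ hξ s n).const_mul
        (2 * (G ^ (s + (n + 1)) * (G ^ m) ^ 2)))
    simpa using h2
  have hnn : ∀ (N : ℕ) ω, 0 ≤ N * F.pairSum (path (ξ N) ω) (s + (n + 1) + m)
      (fun k k' => FeynmanKac.meet k k' ⟨s, hs⟩ * FeynmanKac.meet k k' ⟨s + (n + 1), hs'⟩)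
      (fun _ => 1) := fun N ω => mul_nonneg (Nat.cast_nonneg _) (FeynmanKac.pairSum_nonneg _ _
        fun k k' => mul_nonneg (FeynmanKac.meet_nonneg k k' _) (FeynmanKac.meet_nonneg k k' _))
  have hle := fun (N : ℕ) (hN : 0 < N) ω =>
    FeynmanKac.mul_pairSum_meet_twice_le hG0 hG hpos hN (path (ξ N) ω) s (n + 1) m
  have hri : ∀ N : ℕ, 0 < N → Integrable (fun ω =>
      2 * F.backErr (path (ξ N) ω) (s + (n + 1)) m (fun _ => 1) +
        2 * (G ^ (s + (n + 1)) * (G ^ m) ^ 2) * (F.normConst (path (ξ N) ω) (s + (n + 1)) *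
          F.coal (path (ξ N) ω) s (n + 1))) P := fun N hN =>
    ((integrable_backErr hG0 hG hpos hN (hξ N hN) _ m (h := fun _ => 1) measurable_const (C := 1)
      (by simp)).const_mul 2).add
      ((integrable_normConst_mul_coal hG0 hG hpos hN (hξ N hN) _ _ _).const_mul _)
  have hi : ∀ N : ℕ, 0 < N → Integrable (fun ω => N * F.pairSum (path (ξ N) ω) (s + (n + 1) + m)
      (fun k k' => FeynmanKac.meet k k' ⟨s, hs⟩ * FeynmanKac.meet k k' ⟨s + (n + 1), hs'⟩)
      (fun _ => 1)) P := fun N hN =>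
    (hri N hN).mono' ((((F.measurable_pairSum _ _ measurable_const).const_mul _).comp
      (hξ N hN).measurable_path).aestronglyMeasurable) (ae_of_all _ fun ω => by
        rw [Real.norm_eq_abs, abs_of_nonneg (hnn N ω)]
        exact hle N hN ω)
  refine ⟨by filter_upwards [eventually_gt_atTop 0] with N hN using hi N hN,
    squeeze_zero' (Eventually.of_forall fun N => integral_nonneg fun ω => abs_nonneg _) ?_ h1⟩
  filter_upwards [eventually_gt_atTop 0] with N hN
  simp only [sub_zero, abs_of_nonneg (hnn N _)]
  refine (integral_mono (hi N hN) (hri N hN) (hle N hN)).trans (le_of_eq ?_)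
  rw [integral_add ((integrable_backErr hG0 hG hpos hN (hξ N hN) _ m (h := fun _ => 1)
    measurable_const (C := 1) (by simp)).const_mul 2)
    ((integrable_normConst_mul_coal hG0 hG hpos hN (hξ N hN) _ _ _).const_mul _),
    integral_const_mul, integral_const_mul]

/-- Each time `s` contributes its single-meeting limit, and the Bonferroni remainder tends to zero
in mean. -/
lemma tendstoL1_mul_sub_pairSum (hG0 : 0 < G) (hG : ∀ t x, 0 < F.g t x ∧ F.g t x ≤ G)
    (hpos : F.DensitiesPositive) {σ : ℝ} (hσ0 : 0 < σ) (hσ : ∀ t x y, F.m t x y ≤ σ)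
    (hξ : ∀ N, 0 < N → IsBootstrapFilter F P (ξ N) (A N)) (t : ℕ)
    {h : X → ℝ} (hh : Measurable h) {C : ℝ} (hC0 : 0 ≤ C) (hC : ∀ x, |h x| ≤ C) :
    TendstoL1 P (fun N ω => N * (F.γN (path (ξ N) ω) t h * F.γN (path (ξ N) ω) t h -
        F.pairSum (path (ξ N) ω) t (FeynmanKac.coalescence fun _ => 0) h))
      (∑ s : Fin (t + 1),
        (F.γ s).real Set.univ * ∫ x, F.opQs s (t - s) h x ^ 2 ∂(F.γ s)) := by
  have hg : F.PotentialsBounded := ⟨G, hG0, hG⟩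
  have h1 : TendstoL1 P (fun N ω => ∑ s : Fin (t + 1),
      N * F.pairSum (path (ξ N) ω) t (fun k k' => FeynmanKac.meet k k' s) h)
      (∑ s : Fin (t + 1),
        (F.γ s).real Set.univ * ∫ x, F.opQs s (t - s) h x ^ 2 ∂(F.γ s)) := by
    refine TendstoL1.sum _ fun s _ => ?_
    obtain ⟨s, hs⟩ := s
    obtain ⟨m, rfl⟩ : ∃ m, t = s + m := Nat.exists_eq_add_of_le (Nat.lt_succ_iff.1 hs)
    simp only [Nat.add_sub_cancel_left]
    refine (tendstoL1_backSum_sq hG0 hG hpos hσ0 hσ hξ s m hh hC0 hC).congr ?_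
    filter_upwards [eventually_gt_atTop 0] with N hN ω
    exact FeynmanKac.mul_pairSum_meet hg hpos hN _ s m h
  have h2 : TendstoL1 P (fun N ω => C ^ 2 * (∑ s : Fin (t + 1), ∑ s', if s ≠ s' then
      N * F.pairSum (path (ξ N) ω) t
        (fun k k' => FeynmanKac.meet k k' s * FeynmanKac.meet k k' s') (fun _ => 1) else 0)) 0 := by
    have h3 : ∀ s s' : Fin (t + 1), TendstoL1 P (fun N ω => if s ≠ s' then
      N * F.pairSum (path (ξ N) ω) t
        (fun k k' => FeynmanKac.meet k k' s * FeynmanKac.meet k k' s') (fun _ => 1) else 0) 0 := by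
      intro s s'
      rcases lt_trichotomy s s' with h4 | h4 | h4
      · simp only [if_pos h4.ne]
        exact tendstoL1_pairSum_meet_twice hG0 hG hpos hσ0 hσ hξ t h4
      · simpa [h4] using TendstoL1.zero
      · simp only [if_pos h4.ne', mul_comm (FeynmanKac.meet _ _ s)]
        exact tendstoL1_pairSum_meet_twice hG0 hG hpos hσ0 hσ hξ t h4
    have h4 := TendstoL1.sum Finset.univ fun s _ => TendstoL1.sum Finset.univ fun s' _ => h3 s s'
    have h5 := h4.seq_mul (tendsto_const_nhds (x := C ^ 2))
    simpa using h5
  have hle := fun (N : ℕ) (hN : 0 < N) ω =>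
    FeynmanKac.abs_mul_sub_pairSum_le hg hpos hN (path (ξ N) ω) t hC
  have hmeas : ∀ N : ℕ, 0 < N → Measurable fun ω =>
      N * (F.γN (path (ξ N) ω) t h * F.γN (path (ξ N) ω) t h -
        F.pairSum (path (ξ N) ω) t (FeynmanKac.coalescence fun _ => 0) h) := fun N hN =>
    ((((F.measurable_γN t hh).mul (F.measurable_γN t hh)).sub
      (F.measurable_pairSum t _ hh)).const_mul _).comp (hξ N hN).measurable_path
  have hdi : ∀ᶠ N : ℕ in atTop, Integrable (fun ω =>
      N * (F.γN (path (ξ N) ω) t h * F.γN (path (ξ N) ω) t h -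
        F.pairSum (path (ξ N) ω) t (FeynmanKac.coalescence fun _ => 0) h) -
      ∑ s : Fin (t + 1),
        N * F.pairSum (path (ξ N) ω) t (fun k k' => FeynmanKac.meet k k' s) h) P := by
    filter_upwards [eventually_gt_atTop 0, h1.1, h2.1] with N hN hi1 hi2
    exact hi2.mono' ((hmeas N hN).aestronglyMeasurable.sub hi1.aestronglyMeasurable)
      (ae_of_all _ fun ω => hle N hN ω)
  refine h1.of_dist ?_ ?_
  · filter_upwards [hdi, h1.1] with N hd hi1
    refine (hd.add hi1).congr (ae_of_all _ fun ω => ?_)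
    simp
  · refine squeeze_zero' (Eventually.of_forall fun N => integral_nonneg fun ω => abs_nonneg _) ?_
      h2.2
    filter_upwards [eventually_gt_atTop 0, hdi, h2.1] with N hN hd hi2
    have hi3 : Integrable (fun ω => |C ^ 2 * (∑ s : Fin (t + 1), ∑ s', if s ≠ s' then
      N * F.pairSum (path (ξ N) ω) t (fun k k' => FeynmanKac.meet k k' s * FeynmanKac.meet k k' s')
        (fun _ => 1) else 0) - 0|) P := (hi2.sub (integrable_const 0)).abs
    refine integral_mono hd.abs hi3 fun ω => ?_
    simp only [sub_zero]
    exact (hle N hN ω).trans (le_abs_self _)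

lemma tendsto_div_sub_one : Tendsto (fun N : ℕ => (N : ℝ) / ((N : ℝ) - 1)) atTop (nhds 1) := by
  have h1 : Tendsto (fun N : ℕ => 1 + 1 / ((N : ℝ) - 1)) atTop (nhds (1 + 0)) := by
    refine tendsto_const_nhds.add ?_
    refine Tendsto.div_atTop tendsto_const_nhds ?_
    exact tendsto_atTop_add_const_right _ (-1) tendsto_natCast_atTop_atTop
  rw [add_zero] at h1
  refine h1.congr' ?_
  filter_upwards [eventually_gt_atTop 1] with N hN
  have h2 : (N : ℝ) - 1 ≠ 0 := by
    have : (1 : ℝ) < N := by exact_mod_cast hN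
    linarith
  field_simp
  ring

/-- With `x = N / (N - 1)` one has `N (x - 1) = x`, so the expression is `x` times a geometric sum
of `t + 1` terms, each tending to one. This limit counts the copies of `-γ_t(h)²` in the asymptotic
variance. -/
lemma tendsto_mul_pow_sub_one (t : ℕ) :
    Tendsto (fun N : ℕ => (N : ℝ) * (((N : ℝ) / ((N : ℝ) - 1)) ^ (t + 1) - 1)) atTop
      (nhds (t + 1)) := by
  have h1 : Tendsto (fun N : ℕ => (∑ i ∈ Finset.range (t + 1), ((N : ℝ) / ((N : ℝ) - 1)) ^ i) *
      ((N : ℝ) / ((N : ℝ) - 1))) atTop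
      (nhds ((∑ i ∈ Finset.range (t + 1), (1 : ℝ) ^ i) * 1)) :=
    (tendsto_finsetSum _ fun i _ => tendsto_div_sub_one.pow i).mul tendsto_div_sub_one
  simp only [one_pow, Finset.sum_const, Finset.card_range, nsmul_eq_mul, mul_one] at h1
  push_cast at h1
  refine h1.congr' ?_
  filter_upwards [eventually_gt_atTop 1] with N hN
  have h2 : (N : ℝ) - 1 ≠ 0 := by
    have : (1 : ℝ) < N := by exact_mod_cast hN
    linarith
  rw [← geom_sum_mul, mul_left_comm]
  congr 1
  field_simp
  ring

lemma asymptVar_eq (hG : ∀ t x, 0 < F.g t x ∧ F.g t x ≤ G) (t : ℕ) {h : X → ℝ}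
    (hh : Measurable h) {C : ℝ} (hC : ∀ x, |h x| ≤ C) :
    F.asymptVar t h = 1 * (∑ s : Fin (t + 1),
        (F.γ s).real Set.univ * ∫ x, F.opQs s (t - s) h x ^ 2 ∂(F.γ s)) +
      (-((t : ℝ) + 1)) * ((∫ x, h x ∂(F.γ t)) * ∫ x, h x ∂(F.γ t)) := by
  rw [FeynmanKac.asymptVar, Finset.sum_sub_distrib, one_mul]
  simp only [FeynmanKac.integral_Qmarg hG _ _ hh hC]
  rw [Fin.sum_univ_eq_sum_range
    (fun s => (F.γ s).real Set.univ * ∫ x, F.opQs s (t - s) h x ^ 2 ∂(F.γ s)) (t + 1)]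
  simp only [Finset.sum_const, Finset.card_range, nsmul_eq_mul]
  push_cast
  ring

end Filter

end SMC

end

theorem mainTheorem2 {X Ω : Type*} [MeasurableSpace X] [MeasurableSpace Ω]
    (F : SMC.FeynmanKac X)
    (hg : F.PotentialsBounded) (hpos : F.DensitiesPositive) (hbdd : F.DensitiesBounded)
    (P : Measure Ω) [IsProbabilityMeasure P]
    (ξ : (N : ℕ) → ℕ → Fin N → Ω → X) (A : (N : ℕ) → ℕ → Fin N → Ω → Fin N)
    (hξ : ∀ N, 0 < N → SMC.IsBootstrapFilter F P (ξ N) (A N))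
    (t : ℕ) (h : X → ℝ) (hh : Measurable h) (hhb : ∃ C, ∀ x, |h x| ≤ C) :
    TendstoInMeasure P
      (fun (N : ℕ) (ω : Ω) => F.varEstimator (fun s i => ξ N s i ω) t h)
      atTop (fun _ => F.asymptVar t h) := by
  obtain ⟨G, hG0, hG⟩ := hg
  obtain ⟨σ, hσ0, hσ⟩ := hbdd
  obtain ⟨C, hC'⟩ := hhb
  have hC : ∀ x, |h x| ≤ |C| := fun x => (hC' x).trans (le_abs_self C)
  -- The two summands match those of `varEstimator_eq`: the meetings with coefficient tending to
  -- one, the squared particle estimate with coefficient tending to `-(t + 1)`.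
  have hlim := ((SMC.tendstoL1_mul_sub_pairSum hG0 hG hpos hσ0 hσ hξ t hh (abs_nonneg C)
    hC).seq_mul (by simpa using SMC.tendsto_div_sub_one.pow (t + 1))).add
    ((SMC.tendstoL1_γN_mul_γN hG0 hG hξ t hh hC hh hC).seq_mul
      (SMC.tendsto_mul_pow_sub_one t).neg)
  rw [← SMC.asymptVar_eq hG t hh hC] at hlim
  refine SMC.TendstoL1.tendstoInMeasure (hlim.congr ?_)
  filter_upwards [eventually_gt_atTop 0] with N hN ω
  rw [neg_mul, ← sub_eq_add_neg]
  exact F.varEstimator_eq hN _ t h
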